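/- Let $G$ be an infinite, connected, locally finite (simple) graph. For a finite connected graph, the uniform spanning tree is the uniform measure on its set of spanning trees. An exhaustion of $G$ is an increasing sequence $(G_n)$ of finite connected subgraphs of $G$ with union $G$. The free spanning forest $\mathsf{FSF}(G)$ is the law on subgraphs of $G$ that is the weak limit (on every finite set of edges) of the uniform spanning trees of $G_n$, for every exhaustion $(G_n)$. The wired spanning forest $\mathsf{WSF}(G)$ is the corresponding weak limit, for every exhaustion $(G_n)$ by induced subgraphs, of the uniform spanning trees of $\widehat{G_n}$, the multigraph obtained from $G$ by identifying all vertices not in $G_n$ to a single vertex. Write $\mathfrak F_{\mathrm w}$ and $\mathfrak F_{\mathrm f}$ for samples of $\mathsf{WSF}(G)$ and $\mathsf{FSF}(G)$. For a subgraph $H$ of $G$, the induced-component graph $\overline H$ has the same vertices as $H$, and an edge of $G$ belongs to $\overline H$ if and only if both its endpoints belong to the same component of $H$. For a random subgraph $H$ of $G$ with infinite components, $\mathsf{WSF}(H)$ (resp. $\mathsf{FSF}(H)$) denotes the unconditional law of the random subgraph of $G$ obtained by first sampling $H$ and then sampling a wired (resp. free) spanning forest independently on each component of $H$. An end of a tree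 is an equivalence class of infinite simple paths in it, where two paths are equivalent if their symmetric difference is finite; a tree is one-ended if it has exactly one end. Corollary 1.6. 1. If almost surely every component of $\mathfrak F_{\mathrm w}$ is one-ended, then $$\mathsf{WSF}(\overline{\mathfrak F_{\mathrm w}})=\mathsf{WSF}(G).$$ 2. If almost surely every component of $\mathfrak F_{\mathrm f}$ is one-ended, then $$\mathsf{WSF}(\overline{\mathfrak F_{\mathrm f}})=\mathsf{FSF}(G),\qquad \mathsf{FSF}(\overline{\mathfrak F_{\mathrm w}})=\mathsf{FSF}(G),\qquad \mathsf{FSF}(\overline{\mathfrak F_{\mathrm f}})=\mathsf{FSF}(G).$$ -/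

import Mathlib

open MeasureTheory Filter Topology

noncomputable section

namespace SpanningForest

universe u

/-! A spanning subgraph of a graph with vertex type `V` is recorded by its set of edges, an element
of `Set (Sym2 V)`. This space carries the product σ-algebra (generated by the events `e ∈ T`). -/

/-! ### Uniform spanning trees -/

section Finite

variable {V : Type u} {G : SimpleGraph V}

/-- The edge sets of the spanning trees of the subgraph `H` of `G`: subgraphs of `H` that are trees
and have the same vertices as `H`. -/
def spanningTrees (H : G.Subgraph) : Set (Set (Sym2 V)) :=
  {T | ∃ S : G.Subgraph, S ≤ H ∧ S.verts = H.verts ∧ S.coe.IsTree ∧ S.edgeSet = T}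

/-- The equivalence relation on the vertices of `G` that identifies all vertices outside `B`. -/
def wiredSetoid (B : Set V) : Setoid V where
  r x y := x = y ∨ (x ∉ B ∧ y ∉ B)
  iseqv :=
    { refl := fun _ => Or.inl rfl
      symm := by
        rintro x y (h | ⟨h, h'⟩)
        · exact Or.inl h.symm
        · exact Or.inr ⟨h', h⟩
      trans := by
        rintro x y z (rfl | ⟨h, h'⟩) (rfl | ⟨k, k'⟩)
        · exact Or.inl rfl
        · exact Or.inr ⟨k, k'⟩
        · exact Or.inr ⟨h, h'⟩
        · exact Or.inr ⟨h, k'⟩ }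

/-- The vertices of the wired graph: all vertices of `G` outside `B` become a single vertex. -/
abbrev WiredVertex (B : Set V) : Type u := Quotient (wiredSetoid B)

/-- The edge of the wired graph (possibly a loop) that an edge of `G` becomes. -/
def wiredEdge (B : Set V) (e : Sym2 V) : Sym2 (WiredVertex B) :=
  e.map (Quotient.mk (wiredSetoid B))

/-- The edge sets of the spanning trees of the wired graph of `H` relative to `G`, that is, of the
multigraph obtained from `G` by identifying all vertices not in `H` to a single vertex. Its edges
are the edges of `G` (parallel edges stay distinct). A set `T` of edges of a multigraph forms a
spanning tree if it has no loops and no two parallel edges and if the simple graph that it forms on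
the vertices of the multigraph is a tree. -/
def wiredSpanningTrees (H : G.Subgraph) : Set (Set (Sym2 V)) :=
  {T | T ⊆ G.edgeSet ∧
    (∀ e ∈ T, ¬ (wiredEdge H.verts e).IsDiag) ∧
    Set.InjOn (wiredEdge H.verts) T ∧
    (SimpleGraph.fromEdgeSet (wiredEdge H.verts '' T)).IsTree}

/-- The probability of the event `P` under the uniform measure on the finite set `𝒯`. -/
def uniformProb (𝒯 P : Set (Set (Sym2 V))) : ℝ :=
  ((𝒯 ∩ P).ncard : ℝ) / (𝒯.ncard : ℝ)

/-- The event that the random edge set `T` restricted to the finite set of edges `K` is `A`. -/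
def cylinderEvent (K A : Finset (Sym2 V)) : Set (Set (Sym2 V)) :=
  {T | T ∩ (K : Set (Sym2 V)) = (A : Set (Sym2 V))}

/-- An exhaustion of `G`: an increasing sequence of finite connected subgraphs with union `G`. -/
structure IsExhaustion (Gs : ℕ → G.Subgraph) : Prop where
  finite : ∀ n, (Gs n).verts.Finite
  connected : ∀ n, (Gs n).Connected
  mono : Monotone Gs
  iSup_eq_top : ⨆ n, Gs n = ⊤

end Finite

/-! ### Free and wired spanning forests of a connected, locally finite graph -/

section Forests

variable {V : Type u} (G : SimpleGraph V)

/-- `μ` is the free spanning forest measure of `G`: along every exhaustion, the uniform spanning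
trees of the finite subgraphs, restricted to any fixed finite set of edges, converge in law to `μ`
restricted to these edges. -/
structure IsFSF (μ : Measure (Set (Sym2 V))) : Prop where
  isProbabilityMeasure : IsProbabilityMeasure μ
  tendsto : ∀ Gs : ℕ → G.Subgraph, IsExhaustion Gs → ∀ K A : Finset (Sym2 V),
    Tendsto (fun n => uniformProb (spanningTrees (Gs n)) (cylinderEvent K A)) atTop
      (𝓝 (μ.real (cylinderEvent K A)))

/-- `μ` is the wired spanning forest measure of `G`: along every exhaustion by induced subgraphs,
the uniform spanning trees of the wired graphs, restricted to any fixed finite set of edges,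
converge in law to `μ` restricted to these edges. -/
structure IsWSF (μ : Measure (Set (Sym2 V))) : Prop where
  isProbabilityMeasure : IsProbabilityMeasure μ
  tendsto : ∀ Gs : ℕ → G.Subgraph, IsExhaustion Gs → (∀ n, (Gs n).IsInduced) →
    ∀ K A : Finset (Sym2 V),
    Tendsto (fun n => uniformProb (wiredSpanningTrees (Gs n)) (cylinderEvent K A)) atTop
      (𝓝 (μ.real (cylinderEvent K A)))

open Classical in
/-- The free spanning forest `FSF(G)`, the measure characterized by `IsFSF` (which exists and is
unique for every connected, locally finite `G`; the value for other graphs is a default). -/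
def FSF : Measure (Set (Sym2 V)) :=
  if h : ∃ μ, IsFSF G μ then h.choose else Measure.dirac ∅

open Classical in
/-- The wired spanning forest `WSF(G)`, the measure characterized by `IsWSF` (which exists and is
unique for every connected, locally finite `G`; the value for other graphs is a default). -/
def WSF : Measure (Set (Sym2 V)) :=
  if h : ∃ μ, IsWSF G μ then h.choose else Measure.dirac ∅

instance : IsProbabilityMeasure (FSF G) := by
  unfold FSF
  split_ifs with h
  · exact h.choose_spec.isProbabilityMeasure
  · infer_instance

instance : IsProbabilityMeasure (WSF G) := by
  unfold WSF
  split_ifs with h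
  · exact h.choose_spec.isProbabilityMeasure
  · infer_instance

/-! ### Forests sampled independently on the components of a graph -/

/-- The union, as a set of edges on `V`, of one set of edges for each component of `H`. -/
def glue {H : SimpleGraph V} (F : ∀ C : H.ConnectedComponent, Set (Sym2 C)) : Set (Sym2 V) :=
  ⋃ C : H.ConnectedComponent, Sym2.map ((↑) : C → V) '' F C

/-- The law of the random subgraph obtained by sampling a free spanning forest independently on
each component of `H`. -/
def componentwiseFSF (H : SimpleGraph V) : Measure (Set (Sym2 V)) :=
  (Measure.infinitePi fun C : H.ConnectedComponent => FSF C.toSimpleGraph).map glue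

/-- The law of the random subgraph obtained by sampling a wired spanning forest independently on
each component of `H`. -/
def componentwiseWSF (H : SimpleGraph V) : Measure (Set (Sym2 V)) :=
  (Measure.infinitePi fun C : H.ConnectedComponent => WSF C.toSimpleGraph).map glue

/-- The induced-component graph of the spanning subgraph of `G` with edge set `ω`: an edge of `G`
belongs to it if and only if both endpoints belong to the same component of that subgraph. -/
def inducedComponentGraph (ω : Set (Sym2 V)) : SimpleGraph V where
  Adj x y := G.Adj x y ∧ (SimpleGraph.fromEdgeSet ω).Reachable x y
  symm := ⟨fun _ _ h => ⟨h.1.symm, h.2.symm⟩⟩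
  loopless := ⟨fun x h => G.loopless.irrefl x h.1⟩

/-- The unconditional law of the random subgraph of `G` obtained by first sampling `ω` from `ν`,
and then sampling a free spanning forest independently on each component of the induced-component
graph of `ω`. -/
def resampleFSF (ν : Measure (Set (Sym2 V))) : Measure (Set (Sym2 V)) :=
  ν.bind fun ω => componentwiseFSF (inducedComponentGraph G ω)

/-- The unconditional law of the random subgraph of `G` obtained by first sampling `ω` from `ν`,
and then sampling a wired spanning forest independently on each component of the induced-component
graph of `ω`. -/
def resampleWSF (ν : Measure (Set (Sym2 V))) : Measure (Set (Sym2 V)) :=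
  ν.bind fun ω => componentwiseWSF (inducedComponentGraph G ω)

end Forests

/-! ### Ends of trees -/

section Ends

variable {V : Type u} (T : SimpleGraph V)

/-- Infinite simple paths `v₀, v₁, v₂, …` in `T`. -/
structure Ray where
  vertex : ℕ → V
  adj : ∀ n, T.Adj (vertex n) (vertex (n + 1))
  injective : Function.Injective vertex

variable {T} in
/-- The set of edges of an infinite simple path. -/
def Ray.edges (r : Ray T) : Set (Sym2 V) :=
  Set.range fun n => s(r.vertex n, r.vertex (n + 1))

/-- Two infinite simple paths are equivalent if their symmetric difference is finite. -/
def raySetoid : Setoid (Ray T) where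
  r p q := (symmDiff p.edges q.edges).Finite
  iseqv :=
    { refl := fun p => by simp
      symm := fun {p q} h => by rwa [symmDiff_comm]
      trans := fun {p q r} h h' => (h.union h').subset (symmDiff_triangle _ _ _) }

/-- The ends of a tree: the equivalence classes of its infinite simple paths. -/
abbrev TreeEnd : Type u := Quotient (raySetoid T)

/-- A tree is one-ended if it has exactly one end. -/
def IsOneEnded : Prop := Nat.card (TreeEnd T) = 1

/-- Every connected component of the spanning subgraph with edge set `ω` is one-ended. -/
def ComponentsOneEnded (ω : Set (Sym2 V)) : Prop :=
  ∀ C : (SimpleGraph.fromEdgeSet ω).ConnectedComponent, IsOneEnded C.toSimpleGraph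

end Ends

end SpanningForest

end

/-! The theorem rests on one domination statement and one rigidity statement.

Domination. Let `μ` be a weak limit of uniform spanning forests, such as `WSF` or `FSF`. Resampling
a wired forest in each component of the induced-component graph gives a law stochastically below `μ`
(`stochLE_resampleWSF`). In finite volume, given the edges of a uniform tree outside a finite set
`F` and given which edges of `F` have connected endpoints, the edges of the tree in `F` form a
uniform spanning forest of a contracted graph. Wiring identifies more vertices still, and
identification of vertices decreases a uniform spanning forest stochastically
(`average_resample_le`, `average_bases_le_of_le`). This last monotonicity is the Feder–Mihail
theorem. It needs pairwise negative correlation for all minors, which follows from the matrix-tree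
theorem, since the generating function of the bases is a determinant and a rank-two perturbation
shows the correlation defect to be a square.

Rigidity. In a one-ended forest each edge `e` has a finite side `S`, and `e` is the only forest edge
that leaves `S`. A random edge set that crosses every finite cut and sits below such a forest in a
coupling must therefore contain every edge of it. `StochLE.eq_of_hitting` proves this without a
coupling, by comparing increasing events. Wired forests on graphs with infinite components cross all
finite cuts (`IsWiredLimit.ae_hitting`). Hence wired resampling fixes a one-ended `WSF`. In the same
way `WSF = FSF` when `FSF` is one-ended, because `WSF` is dominated by `FSF`.

Free resampling. If `μ` is fixed by wired resampling, the freely resampled law dominates `μ`. An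
edge `e` is absent from a forest either because its endpoints are in different components or because
they are joined without `e`. The first event of the original forest forces `e` to be absent after
resampling, and the second event is increasing. So `e` is absent at least as often after free
resampling, and domination together with this comparison of marginals gives equality
(`StochLE.eq_of_marginals`).

Technically, a multigraph is a setoid on the vertices together with an indexed family of edges, and
connection is expressed dually: an edge is spanned by `T` if no cut separates its endpoints without
being crossed by `T`. The forest measures of a disconnected graph are limits of uniform bases, and
they factor over the components. -/

noncomputable section

namespace SpanningForest

universe v

/-! ### Graphic matroids of multigraphs, described by cuts -/

section Closure

variable {V : Type u} {ι : Type v}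

/-- The vertex set `S` contains exactly one endpoint of `e`. -/
def Cuts (S : Set V) (e : Sym2 V) : Prop := ∃ x y, e = s(x, y) ∧ x ∈ S ∧ y ∉ S

theorem cuts_mk {S : Set V} {x y : V} : Cuts S s(x, y) ↔ ¬(x ∈ S ↔ y ∈ S) := by
  constructor
  · rintro ⟨a, b, h, ha, hb⟩
    rw [Sym2.eq_iff] at h
    rcases h with ⟨rfl, rfl⟩ | ⟨rfl, rfl⟩ <;> tauto
  · intro h
    by_cases hx : x ∈ S
    · exact ⟨x, y, rfl, hx, by tauto⟩
    · exact ⟨y, x, Sym2.eq_swap, by tauto, hx⟩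

theorem cuts_symmDiff {S S' : Set V} {e : Sym2 V} :
    Cuts (symmDiff S S') e ↔ ¬(Cuts S e ↔ Cuts S' e) := by
  induction e with
  | _ x y => simp only [cuts_mk, Set.mem_symmDiff]; tauto

theorem cuts_compl {S : Set V} {e : Sym2 V} : Cuts Sᶜ e ↔ Cuts S e := by
  induction e with
  | _ x y => simp only [cuts_mk, Set.mem_compl_iff]; tauto

/-- `S` is a union of classes of `r`. -/
def Saturated (r : Setoid V) (S : Set V) : Prop := ∀ x y, r x y → (x ∈ S ↔ y ∈ S)

theorem saturated_bot (S : Set V) : Saturated (⊥ : Setoid V) S := by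
  rintro x y h
  have : x = y := h
  rw [this]

theorem Saturated.symmDiff {r : Setoid V} {S S' : Set V} (h : Saturated r S)
    (h' : Saturated r S') : Saturated r (symmDiff S S') := by
  intro x y hxy
  have := h x y hxy
  have := h' x y hxy
  simp only [Set.mem_symmDiff]; tauto

theorem Saturated.compl {r : Setoid V} {S : Set V} (h : Saturated r S) : Saturated r Sᶜ := by
  intro x y hxy
  have := h x y hxy
  simp only [Set.mem_compl_iff]; tauto

/-- In the multigraph with vertices the classes of `r` and edges `T` (the edge `i` has endpoints
`q i`), the endpoints of `e` are connected. -/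
def Spans (r : Setoid V) (q : ι → Sym2 V) (T : Set ι) (e : Sym2 V) : Prop :=
  ∀ S, Saturated r S → (∀ i ∈ T, ¬ Cuts S (q i)) → ¬ Cuts S e

variable {r r' : Setoid V} {q : ι → Sym2 V} {T T' : Set ι} {e f : Sym2 V}

theorem Spans.mono (hr : r ≤ r') (hT : T ⊆ T') (h : Spans r q T e) : Spans r' q T' e :=
  fun S hS hS' => h S (fun x y hxy => hS x y (hr hxy)) fun i hi => hS' i (hT hi)

theorem spans_of_mem {i : ι} (h : i ∈ T) : Spans r q T (q i) := fun _ _ hS => hS i h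

theorem Spans.trans (h : Spans r q T' e) (hT : ∀ i ∈ T', Spans r q T (q i)) : Spans r q T e :=
  fun S hS hS' => h S hS fun i hi => hT i hi S hS hS'

/-- Cuts add modulo two under symmetric difference. A set `S'` that separates `q j` without crossing
`T` must cut `q i`; if `S` refuted the conclusion, then `symmDiff S S'` would refute the hypothesis.
-/
theorem Spans.exchange {i j : ι} (h : Spans r q (insert i T) (q j)) (hj : ¬ Spans r q T (q j)) :
    Spans r q (insert j T) (q i) := by
  intro S hS hST hSi
  simp only [Spans, not_forall, not_not] at hj
  obtain ⟨S', hS', hST', hSj'⟩ := hj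
  have h1 : Cuts S' (q i) := by
    by_contra h1
    refine h S' hS' ?_ hSj'
    rintro k (rfl | hk)
    · exact h1
    · exact hST' k hk
  refine h (symmDiff S S') (hS.symmDiff hS') ?_ ?_
  · rintro k (rfl | hk)
    · rw [cuts_symmDiff]; tauto
    · have := hST' k hk
      have := hST k (Set.mem_insert_of_mem _ hk)
      rw [cuts_symmDiff]; tauto
  · have := hST j (Set.mem_insert _ _)
    rw [cuts_symmDiff]; tauto

/-- `T` is the edge set of a maximal spanning forest of the multigraph with vertices the classes
of `r` and edges `E`. -/
structure IsBasis (r : Setoid V) (q : ι → Sym2 V) (E T : Finset ι) : Prop where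
  subset : T ⊆ E
  spans : ∀ i ∈ E, Spans r q T (q i)
  indep : ∀ i ∈ T, ¬ Spans r q (↑T \ {i}) (q i)

open Classical in
/-- The finite set of all maximal spanning forests. -/
def bases (r : Setoid V) (q : ι → Sym2 V) (E : Finset ι) : Finset (Finset ι) :=
  E.powerset.filter (IsBasis r q E)

theorem mem_bases {r : Setoid V} {q : ι → Sym2 V} {E T : Finset ι} :
    T ∈ bases r q E ↔ IsBasis r q E T := by
  classical
  simp only [bases, Finset.mem_filter, Finset.mem_powerset, and_iff_right_iff_imp]
  exact fun h => h.subset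

/-- A spanning set of edges contains a basis. -/
theorem exists_isBasis_subset {E T : Finset ι} (hTE : T ⊆ E) (hT : ∀ i ∈ E, Spans r q T (q i)) :
    ∃ T' ⊆ T, IsBasis r q E T' := by
  classical
  induction hn : T.card using Nat.strong_induction_on generalizing T with
  | _ n ih =>
    by_cases h : ∀ i ∈ T, ¬ Spans r q (↑T \ {i}) (q i)
    · exact ⟨T, subset_rfl, hTE, hT, h⟩
    · push Not at h
      obtain ⟨i, hi, hs⟩ := h
      have hcoe : ((T.erase i : Finset ι) : Set ι) = ↑T \ {i} := by simp
      obtain ⟨T', hT', hb⟩ := ih (T.erase i).card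
        (by rw [← hn]; exact Finset.card_erase_lt_of_mem hi)
        ((Finset.erase_subset i T).trans hTE)
        (by
          intro j hj
          refine (hT j hj).trans fun k hk => ?_
          rw [hcoe]
          by_cases hki : k = i
          · rw [hki]; exact hs
          · exact spans_of_mem ⟨hk, hki⟩) rfl
      exact ⟨T', hT'.trans (Finset.erase_subset i T), hb⟩

theorem bases_nonempty (r : Setoid V) (q : ι → Sym2 V) (E : Finset ι) : (bases r q E).Nonempty := by
  obtain ⟨T, -, hT⟩ := exists_isBasis_subset (r := r) (q := q) (subset_refl E)
    fun i hi => spans_of_mem (by exact_mod_cast hi)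
  exact ⟨T, mem_bases.2 hT⟩

end Closure

/-! ### Potentials, total unimodularity and Gram determinants -/

section Unimodular

variable {V : Type u} {ι : Type v}

/-- The coboundary of a potential along the edge `e`, for some orientation of `e`. -/
def cobdry (ψ : V → ℤ) (e : Sym2 V) : ℤ := ψ (Quot.out e).1 - ψ (Quot.out e).2

theorem cuts_out {S : Set V} {e : Sym2 V} :
    Cuts S e ↔ ¬((Quot.out e).1 ∈ S ↔ (Quot.out e).2 ∈ S) := by
  conv_lhs => rw [← Quot.out_eq e]
  exact cuts_mk

/-- The potential `ψ` is constant on the classes of `r`. -/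
def Invariant (r : Setoid V) (ψ : V → ℤ) : Prop := ∀ x y, r x y → ψ x = ψ y

open Classical in
/-- The indicator potential of a set of vertices. -/
def indPot (S : Set V) : V → ℤ := fun x => if x ∈ S then 1 else 0

theorem invariant_indPot {r : Setoid V} {S : Set V} (hS : Saturated r S) :
    Invariant r (indPot S) := by
  intro x y hxy
  have := hS x y hxy
  unfold indPot
  split_ifs <;> simp_all

theorem cobdry_indPot {S : Set V} {e : Sym2 V} : cobdry (indPot S) e = 0 ↔ ¬ Cuts S e := by
  rw [cuts_out]
  simp only [cobdry, indPot]
  split_ifs <;> simp_all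

theorem cobdry_indPot_mul_self {S : Set V} {e : Sym2 V} (h : Cuts S e) :
    cobdry (indPot S) e * cobdry (indPot S) e = 1 := by
  rw [cuts_out] at h
  simp only [cobdry, indPot]
  split_ifs <;> simp_all

variable {r : Setoid V} {q : ι → Sym2 V}

/-- If `T` spans `e`, the coboundary along `e` is an integer combination of those along `T`. -/
theorem Spans.exists_combination {T : Finset ι} {e : Sym2 V} (h : Spans r q T e) :
    ∃ c : ι → ℤ, ∀ ψ, Invariant r ψ → cobdry ψ e = ∑ i ∈ T, c i * cobdry ψ (q i) := by
  classical
  -- Vertices whose potential difference from the first endpoint of `e` is an integer combination of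
  -- coboundaries along `T`. This set is saturated and not cut by `T`, so it contains the second
  -- endpoint as well.
  let S : Set V := {y | ∃ c : ι → ℤ, ∀ ψ, Invariant r ψ →
    ψ (Quot.out e).1 - ψ y = ∑ i ∈ T, c i * cobdry ψ (q i)}
  have hS : Saturated r S := by
    intro x y hxy
    simp only [S, Set.mem_ofPred_eq]
    refine exists_congr fun c => forall_congr' fun ψ => forall_congr' fun hψ => ?_
    rw [hψ x y hxy]
  have hstep : ∀ i ∈ T, ((Quot.out (q i)).1 ∈ S ↔ (Quot.out (q i)).2 ∈ S) := by
    intro i hi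
    constructor
    · rintro ⟨c, hc⟩
      refine ⟨fun j => c j + if j = i then 1 else 0, fun ψ hψ => ?_⟩
      have hadd : ∑ j ∈ T, (c j + if j = i then 1 else 0) * cobdry ψ (q j)
          = ∑ j ∈ T, c j * cobdry ψ (q j) + cobdry ψ (q i) := by
        simp [add_mul, Finset.sum_add_distrib, hi]
      rw [hadd, ← hc ψ hψ, cobdry.eq_1 ψ (q i)]
      ring
    · rintro ⟨c, hc⟩
      refine ⟨fun j => c j - if j = i then 1 else 0, fun ψ hψ => ?_⟩
      have hsub : ∑ j ∈ T, (c j - if j = i then 1 else 0) * cobdry ψ (q j)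
          = ∑ j ∈ T, c j * cobdry ψ (q j) - cobdry ψ (q i) := by
        simp [sub_mul, Finset.sum_sub_distrib, hi]
      rw [hsub, ← hc ψ hψ, cobdry.eq_1 ψ (q i)]
      ring
  have h1 := h S hS fun i hi => by
    rw [cuts_out, not_not]; exact hstep i (by exact_mod_cast hi)
  rw [cuts_out, not_not] at h1
  exact h1.1 ⟨0, fun ψ _ => by simp⟩

variable {E T₀ : Finset ι}

/-- Each edge of a basis has a potential that changes only along this edge of the basis. -/
theorem IsBasis.exists_potential [DecidableEq ι] (h : IsBasis r q E T₀) (j : ι) (hj : j ∈ T₀) :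
    ∃ φ : V → ℤ, Invariant r φ ∧ ∀ i ∈ T₀, cobdry φ (q i) = if i = j then 1 else 0 := by
  have := h.indep j hj
  simp only [Spans, not_forall, not_not] at this
  obtain ⟨S, hS, hST, hSj⟩ := this
  -- The coboundary of the cut along `q j` is `±1`; multiplying by it normalises the value there to
  -- `1`.
  refine ⟨fun x => cobdry (indPot S) (q j) * indPot S x, fun x y hxy => ?_, fun i hi => ?_⟩
  · simp only [invariant_indPot hS x y hxy]
  · have : cobdry (fun x => cobdry (indPot S) (q j) * indPot S x) (q i)
        = cobdry (indPot S) (q j) * cobdry (indPot S) (q i) := by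
      rw [cobdry.eq_1 (fun x => _) (q i), cobdry.eq_1 (indPot S) (q i)]; ring
    rw [this]
    split_ifs with hij
    · rw [hij]; exact cobdry_indPot_mul_self hSj
    · rw [cobdry_indPot.2 (hST i ⟨by exact_mod_cast hi, hij⟩), mul_zero]

/-- The potentials of the fundamental cuts of a basis. -/
def fundPot [DecidableEq ι] (h : IsBasis r q E T₀) (j : T₀) : V → ℤ := (h.exists_potential j j.2).choose

theorem invariant_fundPot [DecidableEq ι] (h : IsBasis r q E T₀) (j : T₀) : Invariant r (fundPot h j) :=
  (h.exists_potential j j.2).choose_spec.1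

theorem cobdry_fundPot [DecidableEq ι] (h : IsBasis r q E T₀) (i j : T₀) :
    cobdry (fundPot h j) (q i) = if i = j then 1 else 0 := by
  rw [fundPot, (h.exists_potential j j.2).choose_spec.2 i i.2]
  simp only [Subtype.ext_iff]

/-- The coordinates of the edges in the basis `T₀`. -/
def coordMatrix [DecidableEq ι] (h : IsBasis r q E T₀) : Matrix ι T₀ ℤ := fun i j => cobdry (fundPot h j) (q i)

/-- The coordinates of a spanning set have an integer left inverse. -/
theorem exists_mul_coordMatrix_eq_one [DecidableEq ι] (h : IsBasis r q E T₀) {T : Finset ι}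
    (hT : ∀ i ∈ E, Spans r q T (q i)) :
    ∃ P : Matrix T₀ T ℤ, P * (coordMatrix h).submatrix (Subtype.val : T → ι) id = 1 := by
  have := fun j : T₀ => (hT j (h.subset j.2)).exists_combination
  choose c hc using this
  refine ⟨Matrix.of fun j i => c j i, ?_⟩
  ext j k
  rw [Matrix.mul_apply, Matrix.one_apply, ← cobdry_fundPot h j k, hc j _ (invariant_fundPot h k)]
  exact Finset.sum_coe_sort T fun i => c j i * cobdry (fundPot h k) (q i)

/-- The identity matrix of size `T₀.card` factors through a space of dimension `T.card`, so the
claim is a comparison of ranks. -/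
theorem IsBasis.card_le (h : IsBasis r q E T₀) {T : Finset ι}
    (hT : ∀ i ∈ E, Spans r q T (q i)) : T₀.card ≤ T.card := by
  classical
  obtain ⟨P, hP⟩ := exists_mul_coordMatrix_eq_one h hT
  have h1 := Matrix.rank_mul_le_left P ((coordMatrix h).submatrix (Subtype.val : T → ι) id)
  rw [hP, Matrix.rank_one] at h1
  simpa using h1.trans (Matrix.rank_le_card_width P)

theorem IsBasis.card_eq {T : Finset ι} (h : IsBasis r q E T₀) (hT : IsBasis r q E T) :
    T.card = T₀.card := by
  exact le_antisymm (hT.card_le h.spans) (h.card_le hT.spans)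

theorem IsBasis.of_card (h : IsBasis r q E T₀) {T : Finset ι} (hTE : T ⊆ E)
    (hT : ∀ i ∈ E, Spans r q T (q i)) (hcard : T.card ≤ T₀.card) : IsBasis r q E T := by
  obtain ⟨T', hT', hb⟩ := exists_isBasis_subset hTE hT
  rwa [← Finset.eq_of_subset_of_card_le hT' (by rw [h.card_eq hb]; exact hcard)]

/-- Unimodularity: the Gram determinant of a set of edges of the size of a basis is `1` if the set
is a basis and `0` otherwise. -/
theorem det_gram [DecidableEq ι] (h : IsBasis r q E T₀) {T : Finset ι} (hTE : T ⊆ E) (hcard : T.card = T₀.card)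
    [Decidable (IsBasis r q E T)] :
    (Matrix.of fun j k : T₀ => ∑ i ∈ T, coordMatrix h i j * coordMatrix h i k).det
      = if IsBasis r q E T then 1 else 0 := by
  set M := (Matrix.of fun j k : T₀ => ∑ i ∈ T, coordMatrix h i j * coordMatrix h i k)
  split_ifs with hT
  -- The coordinate matrix of a basis is square after reindexing and has an integer left inverse, so
  -- its determinant is `±1`; the Gram determinant is the square of it.
  · obtain ⟨P, hP⟩ := exists_mul_coordMatrix_eq_one h hT.spans
    let A := (coordMatrix h).submatrix (Subtype.val : T → ι) id
    have hM : M = A.transpose * A := by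
      ext j k
      simp only [M, A, Matrix.mul_apply, Matrix.of_apply, Matrix.transpose_apply,
        Matrix.submatrix_apply, id]
      rw [← Finset.sum_coe_sort]
    let ε : T₀ ≃ T := Finset.equivOfCardEq hcard.symm
    have h1 : A.transpose * A
        = (A.submatrix ε id).transpose * (A.submatrix ε id) := by
      exact ((A.submatrix ε id).transpose_submatrix _ _ ▸ Matrix.submatrix_mul_equiv A.transpose A id ε id).symm
    have h2 : (P.submatrix id ε) * (A.submatrix ε id) = 1 := by
      rw [Matrix.submatrix_mul_equiv, hP]; rfl
    have h3 := congrArg Matrix.det h2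
    rw [Matrix.det_mul, Matrix.det_one] at h3
    rw [hM, h1, Matrix.det_mul, Matrix.det_transpose]
    rcases Int.isUnit_iff.1 (IsUnit.of_mul_eq_one_right _ h3) with h4 | h4 <;> rw [h4] <;> norm_num
  -- A set of the right size that is not a basis fails to span, so some cut misses it and still
  -- separates an edge of `E`. The coordinates of this cut on `T₀` form a nonzero vector in the
  -- kernel of the Gram matrix.
  · have hns : ¬ ∀ i ∈ E, Spans r q T (q i) := fun hs => hT (h.of_card hTE hs hcard.le)
    simp only [Spans, not_forall, not_not] at hns
    obtain ⟨e, he, S, hS, hST, hSe⟩ := hns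
    have hexp : ∀ i ∈ E, cobdry (indPot S) (q i)
        = ∑ j : T₀, coordMatrix h i j * cobdry (indPot S) (q j) := by
      intro i hi
      obtain ⟨d, hd⟩ := (h.spans i hi).exists_combination
      rw [hd _ (invariant_indPot hS), ← Finset.sum_coe_sort]
      refine Finset.sum_congr rfl fun j _ => ?_
      congr 1
      rw [coordMatrix, hd _ (invariant_fundPot h j), ← Finset.sum_coe_sort]
      simp [cobdry_fundPot]
    rw [← Matrix.exists_mulVec_eq_zero_iff]
    refine ⟨fun j => cobdry (indPot S) (q j), fun h0 => ?_, ?_⟩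
    · have := hexp e he
      rw [Finset.sum_eq_zero] at this
      · exact cobdry_indPot.1 this hSe
      · intro j _
        have := congrFun h0 j
        simp only [Pi.zero_apply] at this
        rw [this, mul_zero]
    · ext j
      simp only [Matrix.mulVec, dotProduct, M, Matrix.of_apply, Pi.zero_apply, Finset.sum_mul]
      rw [Finset.sum_comm]
      refine Finset.sum_eq_zero fun i hi => ?_
      simp_rw [mul_assoc]
      rw [← Finset.mul_sum, ← hexp i (hTE hi), cobdry_indPot.2 (hST i (by exact_mod_cast hi)),
        mul_zero]

end Unimodular

/-! ### A Cauchy–Binet formula -/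

section CauchyBinet

variable {ι n R : Type*} [Fintype n] [DecidableEq n] [CommRing R]

/-- Row `j` is the combination of the vectors `a i` with coefficients `w i * a i j`. Multilinearity
in the rows expands the determinant over all choices `s j` of an index for each row. -/
theorem det_sum_rank_one_eq_sum_piFinset (a : ι → n → R) (w : ι → R) (E : Finset ι) :
    (Matrix.of fun j k => ∑ i ∈ E, w i * (a i j * a i k)).det
      = ∑ s ∈ Fintype.piFinset (fun _ : n => E),
        (∏ j, w (s j)) * ((∏ j, a (s j) j) * (Matrix.of fun j k => a (s j) k).det) := by
  have h1 : (Matrix.of fun j k => ∑ i ∈ E, w i * (a i j * a i k))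
      = fun j => ∑ i ∈ E, (w i * a i j) • a i := by
    ext j k
    simp [Finset.sum_apply, mul_assoc]
  have h2 := (Matrix.detRowAlternating (n := n) (R := R)).toMultilinearMap.map_sum_finset
    (fun j i => (w i * a i j) • a i) (fun _ => E)
  have h3 : (Matrix.of fun j k => ∑ i ∈ E, w i * (a i j * a i k)).det
      = (Matrix.detRowAlternating (n := n) (R := R)).toMultilinearMap
        (fun j => ∑ i ∈ E, (w i * a i j) • a i) := by rw [h1]; rfl
  rw [h3, h2]
  refine Finset.sum_congr rfl fun s _ => ?_
  have h4 := (Matrix.detRowAlternating (n := n) (R := R)).toMultilinearMap.map_smul_univ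
    (fun j => w (s j) * a (s j) j) (fun j => a (s j))
  rw [h4, Finset.prod_mul_distrib, smul_eq_mul, mul_assoc]
  rfl

/-- The Cauchy–Binet formula for weighted sums of rank-one matrices. -/
theorem det_sum_rank_one [DecidableEq ι] (a : ι → n → R) (w : ι → R) (E : Finset ι) :
    (Matrix.of fun j k => ∑ i ∈ E, w i * (a i j * a i k)).det
      = ∑ T ∈ E.powersetCard (Fintype.card n),
        (∏ i ∈ T, w i) * (Matrix.of fun j k => ∑ i ∈ T, a i j * a i k).det := by
  classical
  have hzero : ∀ s : n → ι, ¬ Function.Injective s →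
      (Matrix.of fun j k => a (s j) k).det = 0 := by
    intro s hs
    simp only [Function.Injective, not_forall] at hs
    obtain ⟨j, k, hjk, hne⟩ := hs
    exact Matrix.det_zero_of_row_eq hne (by ext l; simp [hjk])
  rw [det_sum_rank_one_eq_sum_piFinset]
  rw [← Finset.sum_filter_of_ne (p := Function.Injective)
    (fun s _ hs => by
      by_contra hi
      rw [hzero s hi, mul_zero, mul_zero] at hs
      exact hs rfl)]
  rw [← Finset.sum_fiberwise_of_maps_to (t := E.powersetCard (Fintype.card n))
    (g := fun s : n → ι => Finset.univ.image s)]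
  · refine Finset.sum_congr rfl fun T hT => ?_
    rw [Finset.mem_powersetCard] at hT
    -- The same expansion, applied to `T` alone with unit weights, evaluates the sum of the terms
    -- whose choice function has image `T`; choices that are not injective vanish.
    have h := det_sum_rank_one_eq_sum_piFinset a (fun _ => 1) T
    simp only [one_mul, Finset.prod_const_one] at h
    rw [h, ← Finset.sum_filter_of_ne (p := Function.Injective)
      (s := Fintype.piFinset fun _ => T)
      (fun s _ hs => by
        by_contra hi
        rw [hzero s hi, mul_zero] at hs
        exact hs rfl), Finset.mul_sum]
    refine Finset.sum_congr ?_ ?_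
    · ext s
      simp only [Finset.mem_filter, Fintype.mem_piFinset]
      constructor
      · rintro ⟨⟨h1, h2⟩, h3⟩
        exact ⟨fun j => h3 ▸ Finset.mem_image_of_mem s (Finset.mem_univ j), h2⟩
      · rintro ⟨h1, h2⟩
        refine ⟨⟨fun j => hT.1 (h1 j), h2⟩, Finset.eq_of_subset_of_card_le ?_ ?_⟩
        · intro i hi
          obtain ⟨j, -, rfl⟩ := Finset.mem_image.1 hi
          exact h1 j
        · rw [hT.2, Finset.card_image_of_injective _ h2, Finset.card_univ]
    · intro s hs
      simp only [Finset.mem_filter, Fintype.mem_piFinset] at hs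
      congr 1
      have himg : Finset.univ.image s = T := by
        refine Finset.eq_of_subset_of_card_le ?_ ?_
        · intro i hi
          obtain ⟨j, -, rfl⟩ := Finset.mem_image.1 hi
          exact hs.1 j
        · rw [hT.2, Finset.card_image_of_injective _ hs.2, Finset.card_univ]
      rw [← himg, Finset.prod_image fun x _ y _ hxy => hs.2 hxy]
  · intro s hs
    simp only [Finset.mem_filter, Fintype.mem_piFinset] at hs
    rw [Finset.mem_powersetCard]
    refine ⟨?_, by rw [Finset.card_image_of_injective _ hs.2, Finset.card_univ]⟩
    intro i hi
    obtain ⟨j, -, rfl⟩ := Finset.mem_image.1 hi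
    exact hs.1 j

end CauchyBinet

/-! ### Determinants under rank-two perturbation -/

section RankTwo

variable {n : Type*} [Fintype n] [DecidableEq n]

/-- The determinant of a symmetric matrix perturbed by two rank-one matrices. -/
theorem exists_det_add_rank_two (L : Matrix n n ℝ) (hL : L.transpose = L) (hdet : L.det ≠ 0)
    (a b : n → ℝ) : ∃ α β γ : ℝ, ∀ x y : ℝ,
      (Matrix.of fun j k => L j k + x * (a j * a k) + y * (b j * b k)).det
        = L.det * ((1 + x * α) * (1 + y * β) - x * y * (γ * γ)) := by
  let U : Matrix n (Fin 2) ℝ := Matrix.of fun j c => if c = 0 then a j else b j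
  let D : ℝ → ℝ → Matrix (Fin 2) n ℝ := fun x y => Matrix.of fun c k =>
    if c = 0 then x * a k else y * b k
  -- The constants are the values of the bilinear form of `L⁻¹` on `a` and `b`. The identity `det (1
  -- + X * Y) = det (1 + Y * X)` reduces to a two-by-two determinant, and the symmetry of `L` makes
  -- its two mixed values equal, whence the square `γ * γ`.
  refine ⟨a ⬝ᵥ (L⁻¹.mulVec a), b ⬝ᵥ (L⁻¹.mulVec b), a ⬝ᵥ (L⁻¹.mulVec b), fun x y => ?_⟩
  have hunit : IsUnit L.det := isUnit_iff_ne_zero.2 hdet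
  have h1 : (Matrix.of fun j k => L j k + x * (a j * a k) + y * (b j * b k))
      = L * (1 + (L⁻¹ * U) * D x y) := by
    rw [Matrix.mul_add, Matrix.mul_one, ← Matrix.mul_assoc, ← Matrix.mul_assoc,
      Matrix.mul_nonsing_inv _ hunit, Matrix.one_mul]
    ext j k
    simp [U, D, Matrix.mul_apply, Fin.sum_univ_two]
    ring
  have hsymm : b ⬝ᵥ (L⁻¹.mulVec a) = a ⬝ᵥ (L⁻¹.mulVec b) := by
    have : L⁻¹.transpose = L⁻¹ := by rw [Matrix.transpose_nonsing_inv, hL]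
    rw [Matrix.dotProduct_mulVec, ← Matrix.mulVec_transpose, this, dotProduct_comm]
  have h2 : ∀ c d : Fin 2, (D x y * (L⁻¹ * U)) c d
      = (if c = 0 then x else y) * ((if c = 0 then a else b) ⬝ᵥ
          (L⁻¹.mulVec (if d = 0 then a else b))) := by
    intro c d
    simp only [Matrix.mul_apply, dotProduct, Matrix.mulVec, D, U, Matrix.of_apply,
      Finset.mul_sum]
    refine Finset.sum_congr rfl fun j _ => Finset.sum_congr rfl fun k _ => ?_
    split_ifs <;> ring
  rw [h1, Matrix.det_mul, Matrix.det_one_add_mul_comm, Matrix.det_fin_two]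
  simp only [Matrix.add_apply, h2, Matrix.one_apply]
  simp only [Fin.isValue, if_true, zero_ne_one, one_ne_zero, if_false, hsymm]
  ring

end RankTwo

/-! ### The matrix-tree theorem and negative correlation of edges -/

section NegativeCorrelation

variable {V : Type u} {ι : Type v} [DecidableEq ι] {r : Setoid V} {q : ι → Sym2 V}

/-- The weighted matrix-tree theorem. -/
theorem sum_bases_prod_eq_det {E T₀ : Finset ι} (h : IsBasis r q E T₀) (w : ι → ℝ) :
    ∑ T ∈ bases r q E, ∏ i ∈ T, w i
      = (Matrix.of fun j k : T₀ => ∑ i ∈ E,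
          w i * ((coordMatrix h i j : ℝ) * (coordMatrix h i k : ℝ))).det := by
  classical
  rw [det_sum_rank_one, Fintype.card_coe]
  have : bases r q E ⊆ E.powersetCard T₀.card := fun T hT => by
    rw [mem_bases] at hT
    exact Finset.mem_powersetCard.2 ⟨hT.subset, h.card_eq hT⟩
  rw [← Finset.sum_subset this]
  · refine Finset.sum_congr rfl fun T hT => ?_
    rw [mem_bases] at hT
    have h1 := det_gram h hT.subset (h.card_eq hT)
    rw [if_pos hT] at h1
    have h2 := congrArg (Int.castRingHom ℝ) h1
    rw [RingHom.map_det] at h2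
    simp only [map_one] at h2
    have h3 : (Matrix.of fun j k : T₀ => ∑ i ∈ T,
        ((coordMatrix h i j : ℝ) * (coordMatrix h i k : ℝ))).det = 1 := by
      rw [← h2]
      congr 1
      ext j k
      simp
    rw [h3, mul_one]
  · intro T hT hTb
    rw [mem_bases] at hTb
    rw [Finset.mem_powersetCard] at hT
    have h1 := det_gram h hT.1 hT.2
    rw [if_neg hTb] at h1
    have h2 := congrArg (Int.castRingHom ℝ) h1
    rw [RingHom.map_det] at h2
    simp only [map_zero] at h2
    rw [← mul_zero (∏ i ∈ T, w i), ← h2]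
    congr 2
    ext j k
    simp

/-- Negative correlation of two edges under a weighted measure on the bases. -/
theorem sum_bases_mul_le (E : Finset ι) (w : ι → ℝ) (hw : ∀ i, 0 ≤ w i) {e f : ι} (hef : e ≠ f)
    (he : w e = 1) (hf : w f = 1) :
    (∑ T ∈ bases r q E with e ∈ T ∧ f ∈ T, ∏ i ∈ T, w i) *
        (∑ T ∈ bases r q E with e ∉ T ∧ f ∉ T, ∏ i ∈ T, w i) ≤
      (∑ T ∈ bases r q E with e ∈ T ∧ f ∉ T, ∏ i ∈ T, w i) *
        (∑ T ∈ bases r q E with e ∉ T ∧ f ∈ T, ∏ i ∈ T, w i) := by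
  classical
  have hnn : ∀ P : Finset ι → Prop, ∀ [DecidablePred P],
      0 ≤ ∑ T ∈ bases r q E with P T, ∏ i ∈ T, w i := fun P _ =>
    Finset.sum_nonneg fun T _ => Finset.prod_nonneg fun i _ => hw i
  by_cases hmem : e ∈ E ∧ f ∈ E
  swap
  · rw [Finset.sum_eq_zero, zero_mul]
    · exact mul_nonneg (hnn _) (hnn _)
    · intro T hT
      rw [Finset.mem_filter, mem_bases] at hT
      exact absurd ⟨hT.1.subset hT.2.1, hT.1.subset hT.2.2⟩ hmem
  obtain ⟨heE, hfE⟩ := hmem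
  obtain ⟨T₀, hT₀⟩ := bases_nonempty r q E
  rw [mem_bases] at hT₀
  -- With the weights of `e` and `f` made variable, the generating function of the bases is affine
  -- in each variable, and its four coefficients are the four sums to be compared.
  let w' : ℝ → ℝ → ι → ℝ := fun x y i => if i = e then x else if i = f then y else w i
  have hprod : ∀ (x y : ℝ) (T : Finset ι), ∏ i ∈ T, w' x y i
      = (if e ∈ T then x else 1) * (if f ∈ T then y else 1) * ∏ i ∈ T, w i := by
    intro x y T
    have h1 : ∀ i ∈ T, w' x y i
        = (if i = e then x else 1) * (if i = f then y else 1) * w i := by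
      intro i _
      simp only [w']
      split_ifs with h1 h2 h2
      · exact absurd (h1.symm.trans h2) hef
      · rw [h1, he]; ring
      · rw [h2, hf]; ring
      · ring
    rw [Finset.prod_congr rfl h1, Finset.prod_mul_distrib, Finset.prod_mul_distrib,
      Finset.prod_ite_eq', Finset.prod_ite_eq']
  set S11 := ∑ T ∈ bases r q E with e ∈ T ∧ f ∈ T, ∏ i ∈ T, w i
  set S00 := ∑ T ∈ bases r q E with e ∉ T ∧ f ∉ T, ∏ i ∈ T, w i
  set S10 := ∑ T ∈ bases r q E with e ∈ T ∧ f ∉ T, ∏ i ∈ T, w i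
  set S01 := ∑ T ∈ bases r q E with e ∉ T ∧ f ∈ T, ∏ i ∈ T, w i
  have hZ : ∀ x y : ℝ, ∑ T ∈ bases r q E, ∏ i ∈ T, w' x y i
      = S00 + x * S10 + y * S01 + x * y * S11 := by
    intro x y
    simp only [S00, S10, S01, S11, Finset.sum_filter, Finset.mul_sum, ← Finset.sum_add_distrib]
    refine Finset.sum_congr rfl fun T _ => ?_
    rw [hprod]
    by_cases h1 : e ∈ T <;> by_cases h2 : f ∈ T <;> simp [h1, h2]
  let a : ι → T₀ → ℝ := fun i j => (coordMatrix hT₀ i j : ℝ)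
  let L : Matrix T₀ T₀ ℝ := Matrix.of fun j k => ∑ i ∈ E, w' 0 0 i * (a i j * a i k)
  have hdet : ∀ x y : ℝ, S00 + x * S10 + y * S01 + x * y * S11
      = (Matrix.of fun j k => L j k + x * (a e j * a e k) + y * (a f j * a f k)).det := by
    intro x y
    rw [← hZ, sum_bases_prod_eq_det hT₀]
    congr 1
    ext j k
    have h1 : ∀ i ∈ E, w' x y i * (a i j * a i k) = w' 0 0 i * (a i j * a i k)
        + (if i = e then x * (a e j * a e k) else 0)
        + (if i = f then y * (a f j * a f k) else 0) := by
      intro i _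
      simp only [w']
      split_ifs with h1 h2 h2
      · exact absurd (h1.symm.trans h2) hef
      · rw [h1]; ring
      · rw [h2]; ring
      · ring
    simp only [Matrix.of_apply, L]
    rw [Finset.sum_congr rfl h1, Finset.sum_add_distrib, Finset.sum_add_distrib,
      Finset.sum_ite_eq', Finset.sum_ite_eq', if_pos heE, if_pos hfE]
  have hL0 : S00 = L.det := by
    have := hdet 0 0
    simp only [zero_mul, add_zero] at this
    rw [this]; rfl
  -- `L.det` is the sum over the bases that avoid both edges, so the left side vanishes in the
  -- singular case.
  by_cases hLd : L.det = 0
  · rw [hL0, hLd, mul_zero]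
    exact mul_nonneg (hnn _) (hnn _)
  · have hLs : L.transpose = L := by
      ext j k
      simp only [L, Matrix.transpose_apply, Matrix.of_apply]
      exact Finset.sum_congr rfl fun i _ => by ring
    obtain ⟨α, β, γ, h⟩ := exists_det_add_rank_two L hLs hLd (a e) (a f)
    have h10 := (hdet 1 0).trans (h 1 0)
    have h01 := (hdet 0 1).trans (h 0 1)
    have h11 := (hdet 1 1).trans (h 1 1)
    have e10 : S10 = L.det * α := by linarith
    have e01 : S01 = L.det * β := by linarith
    have e11 : S11 = L.det * (α * β - γ * γ) := by
      rw [e10, e01, hL0] at h11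
      linarith
    rw [e11, e10, e01, hL0]
    -- The right side minus the left side is exactly `(L.det * γ) ^ 2`.
    nlinarith [mul_self_nonneg (L.det * γ)]

/-- A family of finite sets of the same size in which any two elements are negatively correlated,
also after conditioning on containing `I` and avoiding `J`. -/
structure Balanced (𝓑 : Finset (Finset ι)) : Prop where
  card_eq : ∀ T ∈ 𝓑, ∀ T' ∈ 𝓑, T.card = T'.card
  mul_le : ∀ (I J : Finset ι) (e f : ι), e ≠ f →
    ((𝓑.filter fun T => I ⊆ T ∧ Disjoint J T ∧ e ∈ T ∧ f ∈ T).card : ℝ) *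
        (𝓑.filter fun T => I ⊆ T ∧ Disjoint J T ∧ e ∉ T ∧ f ∉ T).card ≤
      ((𝓑.filter fun T => I ⊆ T ∧ Disjoint J T ∧ e ∈ T ∧ f ∉ T).card : ℝ) *
        (𝓑.filter fun T => I ⊆ T ∧ Disjoint J T ∧ e ∉ T ∧ f ∈ T).card

theorem balanced_bases (r : Setoid V) (q : ι → Sym2 V) (E : Finset ι) :
    Balanced (bases r q E) := by
  classical
  refine ⟨fun T hT T' hT' => (mem_bases.1 hT').card_eq (mem_bases.1 hT), ?_⟩
  intro I J e f hef
  -- In each of these degenerate cases one factor on the left counts an empty family.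
  by_cases htriv : e ∈ I ∨ e ∈ J ∨ f ∈ I ∨ f ∈ J ∨ ¬ Disjoint I J
  · have : ((bases r q E).filter fun T => I ⊆ T ∧ Disjoint J T ∧ e ∈ T ∧ f ∈ T).card = 0 ∨
        ((bases r q E).filter fun T => I ⊆ T ∧ Disjoint J T ∧ e ∉ T ∧ f ∉ T).card = 0 := by
      simp only [Finset.card_eq_zero, Finset.filter_eq_empty_iff]
      rcases htriv with h | h | h | h | h
      · right; rintro T - ⟨h1, -, h2, -⟩; exact h2 (h1 h)
      · left; rintro T - ⟨-, h1, h2, -⟩; exact Finset.disjoint_left.1 h1 h h2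
      · right; rintro T - ⟨h1, -, -, h2⟩; exact h2 (h1 h)
      · left; rintro T - ⟨-, h1, -, h2⟩; exact Finset.disjoint_left.1 h1 h h2
      · left; rintro T - ⟨h1, h2, -⟩; exact h (h2.mono_right h1).symm
    rcases this with h | h <;> rw [h] <;> simp only [Nat.cast_zero, zero_mul, mul_zero] <;>
      positivity
  push Not at htriv
  obtain ⟨heI, heJ, hfI, hfJ, hIJ⟩ := htriv
  -- The weight `s ^ (I \ T).card` interpolates the condition `I ⊆ T`: at `s = 0` it is the
  -- indicator of that condition, because `0 ^ 0 = 1`. The inequality is proved for `s > 0` and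
  -- extended by continuity.
  let g : (P : Finset ι → Prop) → [DecidablePred P] → ℝ → ℝ := fun P _ s =>
    ∑ T ∈ bases r q E with Disjoint J T ∧ P T, s ^ (I \ T).card
  have hg0 : ∀ (P : Finset ι → Prop) [DecidablePred P], g P 0
      = ((bases r q E).filter fun T => I ⊆ T ∧ Disjoint J T ∧ P T).card := by
    intro P _
    simp only [g, Finset.card_filter, Finset.sum_filter, Nat.cast_sum]
    refine Finset.sum_congr rfl fun T _ => ?_
    by_cases h1 : I ⊆ T
    · simp [h1, Finset.sdiff_eq_empty_iff_subset.2 h1]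
    · have : (I \ T).card ≠ 0 := by
        rwa [Ne, Finset.card_eq_zero, Finset.sdiff_eq_empty_iff_subset]
      simp [h1, this]
  have hgc : ∀ (P : Finset ι → Prop) [DecidablePred P], Continuous (g P) := fun P _ => continuous_finsetSum _ fun T _ => by fun_prop
  have hpos : ∀ s : ℝ, 0 < s → g (fun T => e ∈ T ∧ f ∈ T) s * g (fun T => e ∉ T ∧ f ∉ T) s ≤
      g (fun T => e ∈ T ∧ f ∉ T) s * g (fun T => e ∉ T ∧ f ∈ T) s := by
    intro s hs
    -- Weight `0` forbids the elements of `J`, and weight `s⁻¹` on `I` gives `s ^ (I \ T).card`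
    -- after multiplication by `s ^ I.card`. The edges `e` and `f` keep weight `1`, as
    -- `sum_bases_mul_le` requires.
    let w : ι → ℝ := fun i => if i ∈ I then s⁻¹ else if i ∈ J then 0 else 1
    have hw : ∀ (P : Finset ι → Prop) [DecidablePred P],
        g P s = s ^ I.card * ∑ T ∈ bases r q E with P T, ∏ i ∈ T, w i := by
      intro P _
      simp only [g, Finset.sum_filter, Finset.mul_sum]
      refine Finset.sum_congr rfl fun T _ => ?_
      by_cases hP : P T
      swap
      · simp [hP]
      simp only [hP, and_true, if_true]
      split_ifs with hJ
      · have h1 : ∀ i ∈ T, w i = if i ∈ I then s⁻¹ else 1 := by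
          intro i hi
          simp only [w, if_neg (Finset.disjoint_right.1 hJ hi)]
        rw [Finset.prod_congr rfl h1, Finset.prod_ite, Finset.prod_const_one, mul_one,
          Finset.prod_const, Finset.filter_mem_eq_inter, ← Finset.card_sdiff_add_card_inter I T,
          pow_add, Finset.inter_comm T I, mul_assoc, ← mul_pow, mul_inv_cancel₀ hs.ne', one_pow,
          mul_one]
      · rw [Finset.not_disjoint_iff] at hJ
        obtain ⟨i, hi, hiT⟩ := hJ
        rw [Finset.prod_eq_zero hiT, mul_zero]
        simp [w, Finset.disjoint_right.1 hIJ hi, hi]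
    have hmain := sum_bases_mul_le (r := r) (q := q) E w
      (fun i => by simp only [w]; split_ifs <;> positivity) hef (by simp [w, heI, heJ])
      (by simp [w, hfI, hfJ])
    simp only [hw]
    have h2 : 0 ≤ s ^ I.card * s ^ I.card := by positivity
    calc _ = (s ^ I.card * s ^ I.card) * _ := by ring
      _ ≤ (s ^ I.card * s ^ I.card) * _ := mul_le_mul_of_nonneg_left hmain h2
      _ = _ := by ring
  have h0 : (0 : ℝ) ∈ closure (Set.Ioi (0 : ℝ)) := by rw [closure_Ioi]; exact Set.self_mem_Ici
  have := le_on_closure (f := fun s => g (fun T => e ∈ T ∧ f ∈ T) s * g (fun T => e ∉ T ∧ f ∉ T) s)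
    (g := fun s => g (fun T => e ∈ T ∧ f ∉ T) s * g (fun T => e ∉ T ∧ f ∈ T) s) hpos
    ((hgc _).mul (hgc _)).continuousOn ((hgc _).mul (hgc _)).continuousOn h0
  simpa only [hg0] using this

end NegativeCorrelation

/-! ### The Feder–Mihail theorem for balanced families -/

section FederMihail

variable {ι : Type v} [DecidableEq ι]

/-- Conditioning on an element is absorbed into `I`. Stability under such conditioning, here and in
`Balanced.filter_notMem`, lets the Feder–Mihail induction pass to subfamilies. -/
theorem Balanced.filter_mem {𝓑 : Finset (Finset ι)} (h : Balanced 𝓑) (g : ι) :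
    Balanced (𝓑.filter fun T => g ∈ T) := by
  refine ⟨fun T hT T' hT' => h.card_eq T (Finset.mem_filter.1 hT).1 T' (Finset.mem_filter.1 hT').1,
    fun I J e f hef => ?_⟩
  have key := h.mul_le (insert g I) J e f hef
  have conv : ∀ (P : Finset ι → Prop) [DecidablePred P],
      ((𝓑.filter fun T => g ∈ T).filter fun T => I ⊆ T ∧ Disjoint J T ∧ P T)
        = 𝓑.filter fun T => insert g I ⊆ T ∧ Disjoint J T ∧ P T := by
    intro P _
    ext T
    simp only [Finset.mem_filter, Finset.insert_subset_iff]
    tauto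
  simpa only [conv] using key

theorem Balanced.filter_notMem {𝓑 : Finset (Finset ι)} (h : Balanced 𝓑) (g : ι) :
    Balanced (𝓑.filter fun T => g ∉ T) := by
  refine ⟨fun T hT T' hT' => h.card_eq T (Finset.mem_filter.1 hT).1 T' (Finset.mem_filter.1 hT').1,
    fun I J e f hef => ?_⟩
  have key := h.mul_le I (insert g J) e f hef
  have conv : ∀ (P : Finset ι → Prop) [DecidablePred P],
      ((𝓑.filter fun T => g ∉ T).filter fun T => I ⊆ T ∧ Disjoint J T ∧ P T)
        = 𝓑.filter fun T => I ⊆ T ∧ Disjoint (insert g J) T ∧ P T := by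
    intro P _
    ext T
    simp only [Finset.mem_filter, Finset.disjoint_insert_left]
    tauto
  simpa only [conv] using key

/-- The digits record whether `e` is present, and the letters `g`, `h` whether the element `g` is
present or absent; `F` are sums of the function and `n` are counts. Among sets with `e`, the average
is a mixture of the averages `A` (with `g`) and `B ≤ A` (without `g`). Removing `e` raises both
averages by induction, and by negative correlation it shifts weight towards `g`, that is, towards
the larger average. -/
theorem feder_mihail_step {F1g F1h F0g F0h n1g n1h n0g n0h : ℝ} (hn1g : 0 < n1g) (hn1h : 0 ≤ n1h)
    (hn0h : 0 ≤ n0h) (h1 : n1h = 0 → F1h = 0) (h0 : n0h = 0 → F0h = 0)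
    (hg : F1g * n0g ≤ F0g * n1g) (hh : F1h * n0h ≤ F0h * n1h)
    (hnc : n1g * n0h ≤ n1h * n0g) (hch : F1h * n1g ≤ F1g * n1h) :
    (F1g + F1h) * (n0g + n0h) ≤ (F0g + F0h) * (n1g + n1h) := by
  rcases hn1h.eq_or_lt with hz | hpos
  · have hz' := hz.symm
    have : n0h = 0 := by
      rw [hz', zero_mul] at hnc
      nlinarith
    rw [hz', h1 hz', this, h0 this]
    simpa using hg
  · set A := F1g / n1g with hA
    set B := F1h / n1h with hB
    have eA : F1g = A * n1g := by rw [hA]; field_simp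
    have eB : F1h = B * n1h := by rw [hB]; field_simp
    have hAB : B ≤ A := by
      rw [hA, hB, div_le_div_iff₀ hpos hn1g]
      exact hch
    have h3 : A * n0g ≤ F0g := by
      rw [eA] at hg
      nlinarith
    have h4 : B * n0h ≤ F0h := by
      rw [eB] at hh
      nlinarith
    rw [eA, eB]
    nlinarith [mul_le_mul_of_nonneg_right h3 (add_nonneg hn1g.le hn1h),
      mul_le_mul_of_nonneg_right h4 (add_nonneg hn1g.le hn1h),
      mul_nonneg (sub_nonneg.2 hAB) (sub_nonneg.2 hnc)]

/-- The Feder–Mihail theorem: in a balanced family, an increasing function that does not depend on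
the element `e` is negatively correlated with `e`. -/
theorem Balanced.feder_mihail {f : Finset ι → ℝ} (hf : Monotone f) (e : ι) (D : Finset ι) :
    ∀ {𝓑 : Finset (Finset ι)}, Balanced 𝓑 →
      (∀ g, g ≠ e → g ∉ D → ∀ T ∈ 𝓑, ∀ T' ∈ 𝓑, g ∈ T → g ∈ T') → e ∉ D →
      (∑ T ∈ 𝓑 with e ∈ T, f (T.erase e)) * (𝓑.filter fun T => e ∉ T).card ≤
        (∑ T ∈ 𝓑 with e ∉ T, f (T.erase e)) * (𝓑.filter fun T => e ∈ T).card := by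
  -- `D` contains the elements other than `e` whose membership may still vary over the family.
  -- Conditioning on an element of `D` removes it from `D`.
  induction D using Finset.strongInduction with
  | _ D ih =>
    intro 𝓑 hb hD heD
    rcases (𝓑.filter fun T => e ∈ T).eq_empty_or_nonempty with hem | ⟨T₁, hT₁⟩
    · rw [hem]; simp
    have hT₁' := (Finset.mem_filter.1 hT₁)
    by_cases hall : ∀ T ∈ 𝓑.filter (fun T => e ∈ T), ∀ g ∈ D, g ∉ T
    · -- no other element is free in the sets containing `e`
      have hsub : ∀ T ∈ 𝓑, T₁.erase e ⊆ T.erase e := by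
        intro T hT g hg
        rw [Finset.mem_erase] at hg ⊢
        exact ⟨hg.1, hD g hg.1 (fun hgD => hall T₁ hT₁ g hgD hg.2) T₁ hT₁'.1 T hT hg.2⟩
      have hup : (∑ T ∈ 𝓑 with e ∈ T, f (T.erase e))
          = (𝓑.filter fun T => e ∈ T).card * f (T₁.erase e) := by
        rw [← nsmul_eq_mul, ← Finset.sum_const]
        refine Finset.sum_congr rfl fun T hT => ?_
        have hT' := Finset.mem_filter.1 hT
        congr 1
        refine Finset.Subset.antisymm (fun g hg => ?_) (hsub T hT'.1)
        rw [Finset.mem_erase] at hg ⊢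
        exact ⟨hg.1, hD g hg.1 (fun hgD => hall T hT g hgD hg.2) T hT'.1 T₁ hT₁'.1 hg.2⟩
      have hlow : ((𝓑.filter fun T => e ∉ T).card : ℝ) * f (T₁.erase e)
          ≤ ∑ T ∈ 𝓑 with e ∉ T, f (T.erase e) := by
        rw [← nsmul_eq_mul, ← Finset.sum_const]
        exact Finset.sum_le_sum fun T hT => hf (hsub T (Finset.mem_filter.1 hT).1)
      rw [hup]
      have := mul_le_mul_of_nonneg_right hlow
        (Nat.cast_nonneg (α := ℝ) (𝓑.filter fun T => e ∈ T).card)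
      linarith
    · -- choose an element positively correlated with `f` in the sets containing `e`
      -- Sets that contain `e` have equal size and agree outside `D`, so they meet `D` in the same
      -- number of elements. The covariances of the function with the elements of `D` thus add up to
      -- zero, and some element has a nonnegative one.
      have hc : ∀ T ∈ 𝓑.filter (fun T => e ∈ T), (T ∩ D).card = (T₁ ∩ D).card := by
        intro T hT
        have hT' := Finset.mem_filter.1 hT
        have h1 : T \ D = T₁ \ D := by
          ext g
          simp only [Finset.mem_sdiff, and_congr_left_iff]
          intro hgD
          by_cases hge : g = e
          · subst hge; exact iff_of_true hT'.2 hT₁'.2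
          · exact ⟨hD g hge hgD T hT'.1 T₁ hT₁'.1, hD g hge hgD T₁ hT₁'.1 T hT'.1⟩
        have h2 := Finset.card_sdiff_add_card_inter T D
        have h3 := Finset.card_sdiff_add_card_inter T₁ D
        have h4 := hb.card_eq T hT'.1 T₁ hT₁'.1
        rw [h1] at h2
        omega
      let 𝓐 := 𝓑.filter fun T => e ∈ T
      have hswap : ∀ φ : Finset ι → ℝ, ∑ g ∈ D, ∑ T ∈ 𝓐 with g ∈ T, φ T
          = (T₁ ∩ D).card * ∑ T ∈ 𝓐, φ T := by
        intro φ
        simp only [Finset.sum_filter]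
        rw [Finset.sum_comm, Finset.mul_sum]
        refine Finset.sum_congr rfl fun T hT => ?_
        rw [← Finset.sum_filter, Finset.sum_const, ← hc T hT, nsmul_eq_mul,
          Finset.filter_mem_eq_inter, Finset.inter_comm]
      -- Elements that occur in no set containing `e` contribute nothing to the sums; they are
      -- dropped because `feder_mihail_step` needs a positive count with both `e` and `g`.
      let D' := D.filter fun g => (𝓐.filter fun T => g ∈ T).Nonempty
      have hD'ne : D'.Nonempty := by
        push Not at hall
        obtain ⟨T, hT, g, hg, hgT⟩ := hall
        exact ⟨g, Finset.mem_filter.2 ⟨hg, T, Finset.mem_filter.2 ⟨hT, hgT⟩⟩⟩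
      have hswap' : ∀ φ : Finset ι → ℝ, ∑ g ∈ D', ∑ T ∈ 𝓐 with g ∈ T, φ T
          = (T₁ ∩ D).card * ∑ T ∈ 𝓐, φ T := by
        intro φ
        rw [← hswap φ]
        refine Finset.sum_filter_of_ne fun g _ hne => ?_
        by_contra hemp
        rw [Finset.not_nonempty_iff_eq_empty] at hemp
        rw [hemp, Finset.sum_empty] at hne
        exact hne rfl
      obtain ⟨g, hgD', hg⟩ := Finset.exists_le_of_sum_le hD'ne
        (f := fun g => (∑ T ∈ 𝓐, f (T.erase e)) * ∑ T ∈ 𝓐 with g ∈ T, (1 : ℝ))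
        (g := fun g => (∑ T ∈ 𝓐 with g ∈ T, f (T.erase e)) * ∑ T ∈ 𝓐, (1 : ℝ))
        (by
          rw [← Finset.mul_sum, ← Finset.sum_mul, hswap', hswap']
          exact le_of_eq (by ring))
      obtain ⟨hgD, hgne⟩ := Finset.mem_filter.1 hgD'
      have hge : g ≠ e := fun h => heD (h ▸ hgD)
      have e1 : D.erase g ⊂ D := Finset.erase_ssubset hgD
      have e2 : e ∉ D.erase g := fun h => heD (Finset.mem_of_mem_erase h)
      have ihg := ih _ e1 (hb.filter_mem g) (fun k hk hkD T hT T' hT' hkT => by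
          rw [Finset.mem_filter] at hT hT'
          by_cases hkg : k = g
          · rw [hkg]; exact hT'.2
          · exact hD k hk (fun h => hkD (Finset.mem_erase.2 ⟨hkg, h⟩)) T hT.1 T' hT'.1 hkT) e2
      have ihh := ih _ e1 (hb.filter_notMem g) (fun k hk hkD T hT T' hT' hkT => by
          rw [Finset.mem_filter] at hT hT'
          by_cases hkg : k = g
          · rw [hkg] at hkT; exact absurd hkT hT.2
          · exact hD k hk (fun h => hkD (Finset.mem_erase.2 ⟨hkg, h⟩)) T hT.1 T' hT'.1 hkT) e2
      have hnc := hb.mul_le ∅ ∅ g e hge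
      have split : ∀ (P : Finset ι → Prop) [DecidablePred P] (φ : Finset ι → ℝ),
          ∑ T ∈ 𝓑 with P T, φ T = ∑ T ∈ (𝓑.filter fun T => g ∈ T) with P T, φ T
            + ∑ T ∈ (𝓑.filter fun T => g ∉ T) with P T, φ T := by
        intro P _ φ
        rw [Finset.filter_comm, Finset.filter_comm (fun T => g ∉ T)]
        exact (Finset.sum_filter_add_sum_filter_not _ _ _).symm
      have cardsum : ∀ s : Finset (Finset ι), (s.card : ℝ) = ∑ T ∈ s, 1 := fun s => by simp
      simp only [Finset.empty_subset, Finset.disjoint_empty_left, true_and,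
        ← Finset.filter_filter] at hnc
      rw [Finset.filter_comm (fun T => e ∈ T)] at hg
      rw [Finset.filter_comm (fun T => e ∈ T)] at hgne
      have hg' : (∑ T ∈ (𝓑.filter fun T => g ∉ T) with e ∈ T, f (T.erase e))
            * ((𝓑.filter fun T => g ∈ T).filter fun T => e ∈ T).card
          ≤ (∑ T ∈ (𝓑.filter fun T => g ∈ T) with e ∈ T, f (T.erase e))
            * ((𝓑.filter fun T => g ∉ T).filter fun T => e ∈ T).card := by
        simp only [𝓐] at hg
        rw [split (fun T => e ∈ T), split (fun T => e ∈ T), ← cardsum, ← cardsum] at hg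
        linarith
      rw [cardsum (𝓑.filter fun T => e ∉ T), cardsum (𝓑.filter fun T => e ∈ T),
        split (fun T => e ∈ T), split (fun T => e ∉ T), split (fun T => e ∈ T),
        split (fun T => e ∉ T), ← cardsum, ← cardsum, ← cardsum, ← cardsum]
      refine feder_mihail_step (by exact_mod_cast Finset.card_pos.2 hgne) (Nat.cast_nonneg _)
        (Nat.cast_nonneg _) (fun h => ?_) (fun h => ?_) ihg ihh (hnc.trans_eq (mul_comm _ _)) hg'
      · rw [Nat.cast_eq_zero, Finset.card_eq_zero] at h
        rw [h, Finset.sum_empty]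
      · rw [Nat.cast_eq_zero, Finset.card_eq_zero] at h
        rw [h, Finset.sum_empty]

/-- The average of `f` over the finite family `𝓑`. -/
def average (𝓑 : Finset (Finset ι)) (f : Finset ι → ℝ) : ℝ := (∑ T ∈ 𝓑, f T) / 𝓑.card

theorem Balanced.average_le {𝓑 : Finset (Finset ι)} (hb : Balanced 𝓑) {f : Finset ι → ℝ}
    (hf : Monotone f) (e : ι) (h0 : (𝓑.filter fun T => e ∉ T).Nonempty) :
    average 𝓑 (fun T => f (T.erase e)) ≤ average (𝓑.filter fun T => e ∉ T) f ∧
    ((𝓑.filter fun T => e ∈ T).Nonempty →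
      average (𝓑.filter fun T => e ∈ T) (fun T => f (T.erase e))
        ≤ average (𝓑.filter fun T => e ∉ T) f) := by
  have h := hb.feder_mihail hf e ((𝓑.biUnion id).erase e) (fun g hge hgD T hT T' hT' hgT =>
    absurd (Finset.mem_erase.2 ⟨hge, Finset.mem_biUnion.2 ⟨T, hT, hgT⟩⟩) hgD) (by simp)
  have hs : ∑ T ∈ 𝓑 with e ∉ T, f (T.erase e) = ∑ T ∈ 𝓑 with e ∉ T, f T :=
    Finset.sum_congr rfl fun T hT => by rw [Finset.erase_eq_of_notMem (Finset.mem_filter.1 hT).2]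
  rw [hs] at h
  have hn0 : (0 : ℝ) < (𝓑.filter fun T => e ∉ T).card := by exact_mod_cast Finset.card_pos.2 h0
  refine ⟨?_, fun h1 => ?_⟩
  · have hpos : (0 : ℝ) < 𝓑.card := by
      exact_mod_cast Finset.card_pos.2 (h0.mono (Finset.filter_subset _ _))
    rw [average, average, div_le_div_iff₀ hpos hn0]
    have e1 := Finset.sum_filter_add_sum_filter_not 𝓑 (fun T => e ∈ T) (fun T => f (T.erase e))
    have e2 : ((𝓑.filter fun T => e ∈ T).card : ℝ) + (𝓑.filter fun T => e ∉ T).card = 𝓑.card := by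
      exact_mod_cast Finset.card_filter_add_card_filter_not (s := 𝓑) (fun T => e ∈ T)
    rw [← e1, ← e2, hs]
    linarith
  · have hn1 : (0 : ℝ) < (𝓑.filter fun T => e ∈ T).card := by exact_mod_cast Finset.card_pos.2 h1
    rw [average, average, div_le_div_iff₀ hn1 hn0]
    exact h

end FederMihail

/-! ### Deletion, contraction and stochastic monotonicity -/

section Operations

variable {V : Type u} {ι : Type v} {r r' : Setoid V} {q : ι → Sym2 V}

/-- The setoid generated by `r` and the identification of the endpoints of each edge in `Q`. -/
def identify (r : Setoid V) (Q : Set (Sym2 V)) : Setoid V where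
  r x y := ∀ S, Saturated r S → (∀ e ∈ Q, ¬ Cuts S e) → (x ∈ S ↔ y ∈ S)
  iseqv :=
    { refl := fun _ _ _ _ => Iff.rfl
      symm := fun h S hS hQ => (h S hS hQ).symm
      trans := fun h h' S hS hQ => (h S hS hQ).trans (h' S hS hQ) }

theorem saturated_identify {Q : Set (Sym2 V)} {S : Set V} :
    Saturated (identify r Q) S ↔ Saturated r S ∧ ∀ e ∈ Q, ¬ Cuts S e := by
  constructor
  · intro h
    refine ⟨fun x y hxy => h x y fun S' hS' _ => hS' x y hxy, fun e he => ?_⟩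
    induction e with
    | _ x y =>
      rw [cuts_mk, not_not]
      exact h x y fun S' _ hQ => by
        have := hQ _ he
        rwa [cuts_mk, not_not] at this
  · rintro ⟨h, h'⟩ x y hxy
    exact hxy S h h'

theorem identify_empty : identify r ∅ = r := by
  ext x y
  constructor
  · intro h
    exact r.symm ((h {z | r z x} (fun a b hab => ⟨fun ha => r.trans (r.symm hab) ha,
      fun hb => r.trans hab hb⟩) (by simp)).1 (r.refl x))
  · intro h S hS _
    exact hS x y h

theorem identify_le {Q : Set (Sym2 V)} (h : r ≤ r') (hQ : ∀ x y, s(x, y) ∈ Q → r' x y) :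
    identify r Q ≤ r' := by
  intro x y hxy
  refine r'.symm ((hxy {z | r' z x} (fun a b hab => ⟨fun ha => r'.trans (r'.symm (h hab)) ha,
      fun hb => r'.trans (h hab) hb⟩) ?_).1 (r'.refl x))
  rintro e he ⟨a, b, rfl, ha, hb⟩
  exact hb (r'.trans (r'.symm (hQ a b he)) ha)

theorem identify_insert {Q : Set (Sym2 V)} {e : Sym2 V} :
    identify r (insert e Q) = identify (identify r Q) {e} := by
  ext x y
  have : ∀ S, (Saturated r S ∧ ∀ e' ∈ insert e Q, ¬ Cuts S e') ↔
      (Saturated (identify r Q) S ∧ ∀ e' ∈ ({e} : Set (Sym2 V)), ¬ Cuts S e') := by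
    intro S
    rw [saturated_identify]
    simp only [Set.mem_insert_iff, forall_eq_or_imp, Set.mem_singleton_iff, forall_eq]
    tauto
  constructor
  · intro h S h1 h2
    obtain ⟨h3, h4⟩ := (this S).2 ⟨h1, h2⟩
    exact h S h3 h4
  · intro h S h1 h2
    obtain ⟨h3, h4⟩ := (this S).1 ⟨h1, h2⟩
    exact h S h3 h4

theorem spans_identify {Q : Set (Sym2 V)} {T T' : Set ι} {e : Sym2 V} (h : q '' T' = Q) :
    Spans (identify r Q) q T e ↔ Spans r q (T ∪ T') e := by
  subst h
  simp only [Spans, saturated_identify, Set.forall_mem_image, Set.mem_union]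
  constructor
  · intro h S hS hT
    exact h S ⟨hS, fun i hi => hT i (Or.inr hi)⟩ fun i hi => hT i (Or.inl hi)
  · intro h S hS hT
    exact h S hS.1 fun i hi => hi.elim (fun hi => hT i hi) fun hi => hS.2 hi

theorem average_congr {𝓑 𝓑' : Finset (Finset ι)} {f f' : Finset ι → ℝ} (h : 𝓑 = 𝓑')
    (hf : ∀ T ∈ 𝓑, f T = f' T) : average 𝓑 f = average 𝓑' f' := by
  subst h
  rw [average, average, Finset.sum_congr rfl hf]

theorem average_bij {κ : Type*} {𝓑 : Finset (Finset ι)} {𝓑' : Finset (Finset κ)}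
    {f : Finset ι → ℝ} {f' : Finset κ → ℝ} (i : Finset ι → Finset κ) (j : Finset κ → Finset ι)
    (hi : ∀ T ∈ 𝓑, i T ∈ 𝓑') (hj : ∀ T ∈ 𝓑', j T ∈ 𝓑) (hji : ∀ T ∈ 𝓑, j (i T) = T)
    (hij : ∀ T ∈ 𝓑', i (j T) = T) (hf : ∀ T ∈ 𝓑, f T = f' (i T)) :
    average 𝓑 f = average 𝓑' f' := by
  rw [average, average, Finset.sum_nbij' i j hi hj hji hij hf,
    Finset.card_nbij' i j (fun T hT => hi T hT) (fun T hT => hj T hT) hji hij]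

theorem spans_comp_iff {κ : Type*} {p : κ → Sym2 V} (j : ι ↪ κ) (hj : ∀ i, p (j i) = q i)
    {T : Finset ι} {e : Sym2 V} :
    Spans r p ((T.map j : Finset κ) : Set κ) e ↔ Spans r q T e := by
  simp [Spans, hj]

variable [DecidableEq ι] {E : Finset ι} {g : ι}

/-- An edge not spanned by the others is a bridge. It belongs to every basis, and by exchange its
presence does not change which of the other edges are spanned. -/
theorem isBasis_insert_coloop (hg : ¬ Spans r q E (q g)) {T : Finset ι} :
    IsBasis r q (insert g E) T ↔ g ∈ T ∧ IsBasis r q E (T.erase g) := by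
  have hgE : g ∉ E := fun h => hg (spans_of_mem (by exact_mod_cast h))
  constructor
  · intro h
    have hgT : g ∈ T := by
      by_contra hgT
      refine hg ((h.spans g (Finset.mem_insert_self _ _)).mono le_rfl fun i hi => ?_)
      rcases Finset.mem_insert.1 (h.subset hi) with rfl | hi'
      · exact absurd hi hgT
      · exact hi'
    have hsub : T.erase g ⊆ E := fun i hi => by
      rw [Finset.mem_erase] at hi
      exact (Finset.mem_insert.1 (h.subset hi.2)).resolve_left hi.1
    refine ⟨hgT, hsub, fun i hi => ?_, fun i hi hs => ?_⟩
    · by_contra hns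
      have h1 := h.spans i (Finset.mem_insert_of_mem hi)
      rw [← Finset.insert_erase hgT, Finset.coe_insert] at h1
      refine hg ((h1.exchange hns).mono le_rfl ?_)
      rw [Set.insert_subset_iff]
      exact ⟨by exact_mod_cast hi, by exact_mod_cast hsub⟩
    · refine h.indep i (Finset.mem_of_mem_erase hi) (hs.mono le_rfl ?_)
      rw [Finset.coe_erase]
      exact Set.sdiff_subset_sdiff_left Set.sdiff_subset
  · rintro ⟨hgT, h⟩
    have hT : (T : Set ι) = insert g ((T.erase g : Finset ι) : Set ι) := by
      rw [← Finset.coe_insert, Finset.insert_erase hgT]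
    refine ⟨fun i hi => ?_, fun i hi => ?_, fun i hi hs => ?_⟩
    · by_cases hig : i = g
      · rw [hig]; exact Finset.mem_insert_self _ _
      · exact Finset.mem_insert_of_mem (h.subset (Finset.mem_erase.2 ⟨hig, hi⟩))
    · rcases Finset.mem_insert.1 hi with rfl | hi'
      · exact spans_of_mem (by exact_mod_cast hgT)
      · exact (h.spans i hi').mono le_rfl (by rw [hT]; exact Set.subset_insert _ _)
    · by_cases hig : i = g
      · rw [hig] at hs
        refine hg (hs.mono le_rfl ?_)
        rw [← Finset.coe_erase]
        exact_mod_cast h.subset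
      · have hi' : i ∈ T.erase g := Finset.mem_erase.2 ⟨hig, hi⟩
        have h1 : (T : Set ι) \ {i} = insert g (((T.erase g : Finset ι) : Set ι) \ {i}) := by
          rw [hT, Set.insert_sdiff_of_notMem]
          simpa using fun h => hig h.symm
        rw [h1] at hs
        refine hg ((hs.exchange (h.indep i hi')).mono le_rfl ?_)
        rw [Set.insert_sdiff_singleton, Set.insert_subset_iff]
        exact ⟨h.subset hi', by exact_mod_cast h.subset⟩

theorem isBasis_insert_of_spans (hg : Spans r q E (q g)) {T : Finset ι} (hgT : g ∉ T) :
    IsBasis r q (insert g E) T ↔ IsBasis r q E T := by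
  constructor
  · intro h
    exact ⟨fun i hi => (Finset.mem_insert.1 (h.subset hi)).resolve_left fun h => hgT (h ▸ hi),
      fun i hi => h.spans i (Finset.mem_insert_of_mem hi), h.indep⟩
  · intro h
    refine ⟨h.subset.trans (Finset.subset_insert _ _), fun i hi => ?_, h.indep⟩
    rcases Finset.mem_insert.1 hi with rfl | hi'
    · exact hg.trans fun j hj => h.spans j (by exact_mod_cast hj)
    · exact h.spans i hi'

/-- Identifying the endpoints of `g` has the same effect on spanning as keeping `g` permanently in
the set. Loops must be excluded, since no basis contains one. -/
theorem isBasis_identify_iff (hgE : g ∉ E) (hg : ¬ Spans r q ∅ (q g)) {T : Finset ι} (hgT : g ∉ T) :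
    IsBasis (identify r {q g}) q E T ↔ IsBasis r q (insert g E) (insert g T) := by
  have key : ∀ (T : Set ι) (e : Sym2 V),
      Spans (identify r {q g}) q T e ↔ Spans r q (insert g T) e := by
    intro T e
    rw [spans_identify (T' := {g}) (by simp), Set.union_singleton]
  constructor
  · intro h
    refine ⟨Finset.insert_subset_insert _ h.subset, fun i hi => ?_, fun i hi hs => ?_⟩
    · rw [Finset.coe_insert]
      rcases Finset.mem_insert.1 hi with rfl | hi'
      · exact spans_of_mem (Set.mem_insert _ _)
      · exact (key _ _).1 (h.spans i hi')
    · rw [Finset.coe_insert] at hs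
      by_cases hig : i = g
      · subst hig
        rw [Set.insert_sdiff_of_mem _ (Set.mem_singleton i), Set.sdiff_singleton_eq_self (by exact_mod_cast hgT)] at hs
        -- A minimal part of `T` that spans `g`. It is nonempty because `g` is not a loop, and
        -- exchanging one of its edges for `g` contradicts the independence of `T` after
        -- contraction.
        obtain ⟨T', hT'1, hT'2, hT'3⟩ : ∃ T' ⊆ T, Spans r q T' (q i) ∧
            ∀ j ∈ T', ¬ Spans r q (T'.erase j : Finset ι) (q i) := by
          clear hi h hgT
          induction T using Finset.strongInduction with
          | _ T ih =>
            by_cases hm : ∀ j ∈ T, ¬ Spans r q (T.erase j : Finset ι) (q i)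
            · exact ⟨T, subset_rfl, hs, hm⟩
            · push Not at hm
              obtain ⟨j, hj, hjs⟩ := hm
              obtain ⟨T', h1, h2⟩ := ih _ (Finset.erase_ssubset hj) hjs
              exact ⟨T', h1.trans (Finset.erase_subset _ _), h2⟩
        rcases T'.eq_empty_or_nonempty with rfl | ⟨j, hj⟩
        · exact hg (by simpa using hT'2)
        · have h1 := hT'3 j hj
          rw [← Finset.insert_erase hj, Finset.coe_insert] at hT'2
          have h2 := hT'2.exchange h1
          refine h.indep j (hT'1 hj) ((key _ _).2 (h2.mono le_rfl ?_))
          refine Set.insert_subset_insert ?_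
          rw [Finset.coe_erase]
          exact Set.sdiff_subset_sdiff_left (by exact_mod_cast hT'1)
      · have hi' : i ∈ T := (Finset.mem_insert.1 hi).resolve_left hig
        rw [Set.insert_sdiff_of_notMem _ (by simpa using fun h => hig h.symm)] at hs
        exact h.indep i hi' ((key _ _).2 hs)
  · intro h
    refine ⟨fun i hi => ?_, fun i hi => ?_, fun i hi hs => ?_⟩
    · refine (Finset.mem_insert.1 (h.subset (Finset.mem_insert_of_mem hi))).resolve_left ?_
      exact fun hig => hgT (hig ▸ hi)
    · rw [key, ← Finset.coe_insert]
      exact h.spans i (Finset.mem_insert_of_mem hi)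
    · rw [key] at hs
      refine h.indep i (Finset.mem_insert_of_mem hi) ?_
      rwa [Finset.coe_insert, Set.insert_sdiff_of_notMem]
      simpa using fun h : g = i => hgT (h ▸ hi)

theorem bases_congr (h : ∀ T ⊆ E, ∀ i ∈ E, Spans r q (T : Set ι) (q i) ↔ Spans r' q (T : Set ι) (q i)) :
    bases r q E = bases r' q E := by
  ext T
  rw [mem_bases, mem_bases]
  constructor
  · intro hT
    refine ⟨hT.subset, fun i hi => (h T hT.subset i hi).1 (hT.spans i hi), fun i hi hs => ?_⟩
    refine hT.indep i hi ?_
    rw [← Finset.coe_erase] at hs ⊢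
    exact (h _ ((Finset.erase_subset _ _).trans hT.subset) i (hT.subset hi)).2 hs
  · intro hT
    refine ⟨hT.subset, fun i hi => (h T hT.subset i hi).2 (hT.spans i hi), fun i hi hs => ?_⟩
    refine hT.indep i hi ?_
    rw [← Finset.coe_erase] at hs ⊢
    exact (h _ ((Finset.erase_subset _ _).trans hT.subset) i (hT.subset hi)).1 hs

/-- Adding an edge decreases the maximal spanning forest on the other edges stochastically. -/
theorem average_bases_insert_le {f : Finset ι → ℝ} (hf : Monotone f) (hgE : g ∉ E) :
    average (bases r q (insert g E)) (fun T => f (T.erase g)) ≤ average (bases r q E) f := by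
  -- If `E` spans `g`, the bases of `E` are the bases of `insert g E` that avoid `g`, and the
  -- Feder–Mihail theorem applies. If `g` is a bridge, erasing it is a bijection of bases and
  -- equality holds.
  by_cases hg : Spans r q E (q g)
  · have h1 : (bases r q (insert g E)).filter (fun T => g ∉ T) = bases r q E := by
      ext T
      rw [Finset.mem_filter, mem_bases, mem_bases]
      constructor
      · rintro ⟨h, hgT⟩
        exact (isBasis_insert_of_spans hg hgT).1 h
      · intro h
        have hgT : g ∉ T := fun h' => hgE (h.subset h')
        exact ⟨(isBasis_insert_of_spans hg hgT).2 h, hgT⟩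
    have := (balanced_bases r q (insert g E)).average_le hf g (by
      rw [h1]; exact bases_nonempty r q E)
    rw [h1] at this
    exact this.1
  · refine le_of_eq (average_bij (fun T => T.erase g) (fun T => insert g T) ?_ ?_ ?_ ?_ ?_)
    · intro T hT
      rw [mem_bases, isBasis_insert_coloop hg] at hT
      exact mem_bases.2 hT.2
    · intro T hT
      rw [mem_bases] at hT
      rw [mem_bases, isBasis_insert_coloop hg]
      refine ⟨Finset.mem_insert_self _ _, ?_⟩
      rwa [Finset.erase_insert fun h' => hgE (hT.subset h')]
    · intro T hT
      rw [mem_bases, isBasis_insert_coloop hg] at hT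
      exact Finset.insert_erase hT.1
    · intro T hT
      rw [mem_bases] at hT
      exact Finset.erase_insert fun h' => hgE (hT.subset h')
    · intro T _
      rfl

theorem average_bases_mono {f : Finset ι → ℝ} (hf : Monotone f) {E' : Finset ι} (hE : E ⊆ E')
    (hfE : ∀ T, f (T ∩ E) = f T) :
    average (bases r q E') f ≤ average (bases r q E) f := by
  obtain ⟨D, hD, rfl⟩ : ∃ D, Disjoint D E ∧ E' = D ∪ E :=
    ⟨E' \ E, Finset.sdiff_disjoint, (Finset.sdiff_union_of_subset hE).symm⟩
  clear hE
  induction D using Finset.induction_on with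
  | empty => simp
  | insert g D hgD ih =>
    rw [Finset.disjoint_insert_left] at hD
    refine le_trans ?_ (ih hD.2)
    rw [Finset.insert_union]
    refine le_trans (le_of_eq (average_congr rfl fun T _ => ?_))
      (average_bases_insert_le hf (g := g) (by simp [hgD, hD.1]))
    rw [← hfE T, ← hfE (T.erase g), Finset.erase_inter, Finset.erase_eq_of_notMem]
    simp [hD.1]

/-- Contraction of `g` conditions a basis of `insert g E` to contain `g`, and deletion conditions it
to avoid `g`. The Feder–Mihail theorem compares the two; loops and bridges are treated separately
because one of the two conditionings is then impossible. -/
theorem average_bases_identify_index_le {f : Finset ι → ℝ} (hf : Monotone f) (hgE : g ∉ E) :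
    average (bases (identify r {q g}) q E) f ≤ average (bases r q E) f := by
  by_cases hloop : Spans r q ∅ (q g)
  · refine le_of_eq (average_congr (bases_congr fun T _ i _ => ?_) fun _ _ => rfl)
    rw [spans_identify (T' := {g}) (by simp)]
    refine ⟨fun h => h.trans ?_, fun h => h.mono le_rfl Set.subset_union_left⟩
    rintro k (hk | hk)
    · exact spans_of_mem hk
    · rw [Set.mem_singleton_iff.1 hk]
      exact hloop.mono le_rfl (Set.empty_subset _)
  have hlink : average (bases (identify r {q g}) q E) f
      = average ((bases r q (insert g E)).filter fun T => g ∈ T) (fun T => f (T.erase g)) := by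
    refine average_bij (fun T => insert g T) (fun T => T.erase g) ?_ ?_ ?_ ?_ ?_
    · intro T hT
      rw [mem_bases] at hT
      rw [Finset.mem_filter, mem_bases]
      exact ⟨(isBasis_identify_iff hgE hloop fun h' => hgE (hT.subset h')).1 hT,
        Finset.mem_insert_self _ _⟩
    · intro T hT
      rw [Finset.mem_filter, mem_bases] at hT
      rw [mem_bases, isBasis_identify_iff hgE hloop (Finset.notMem_erase _ _),
        Finset.insert_erase hT.2]
      exact hT.1
    · intro T hT
      rw [mem_bases] at hT
      exact Finset.erase_insert fun h' => hgE (hT.subset h')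
    · intro T hT
      exact Finset.insert_erase (Finset.mem_filter.1 hT).2
    · intro T hT
      rw [mem_bases] at hT
      rw [Finset.erase_insert fun h' => hgE (hT.subset h')]
  rw [hlink]
  by_cases hg : Spans r q E (q g)
  · have h1 : (bases r q (insert g E)).filter (fun T => g ∉ T) = bases r q E := by
      ext T
      rw [Finset.mem_filter, mem_bases, mem_bases]
      constructor
      · rintro ⟨h, hgT⟩
        exact (isBasis_insert_of_spans hg hgT).1 h
      · intro h
        have hgT : g ∉ T := fun h' => hgE (h.subset h')
        exact ⟨(isBasis_insert_of_spans hg hgT).2 h, hgT⟩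
    have := (balanced_bases r q (insert g E)).average_le hf g (by
      rw [h1]; exact bases_nonempty r q E)
    rw [h1] at this
    refine this.2 ?_
    obtain ⟨T, hT⟩ := bases_nonempty (identify r {q g}) q E
    rw [mem_bases] at hT
    refine ⟨insert g T, Finset.mem_filter.2 ⟨mem_bases.2 ?_, Finset.mem_insert_self _ _⟩⟩
    exact (isBasis_identify_iff hgE hloop fun h' => hgE (hT.subset h')).1 hT
  · refine le_trans (le_of_eq (average_congr ?_ fun _ _ => rfl)) (average_bases_insert_le hf hgE)
    rw [Finset.filter_eq_self]
    intro T hT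
    rw [mem_bases, isBasis_insert_coloop hg] at hT
    exact hT.1

section Transfer

variable {W : Type*} {κ : Type*} {s : Setoid W} {p : κ → Sym2 W}

theorem isBasis_map_iff [DecidableEq κ] (j : ι ↪ κ)
    (h : ∀ T ⊆ E, ∀ i ∈ E, Spans r q (T : Set ι) (q i) ↔
      Spans s p ((T.map j : Finset κ) : Set κ) (p (j i))) {T : Finset ι} :
    IsBasis s p (E.map j) (T.map j) ↔ IsBasis r q E T := by
  have hcoe : ∀ i, ((T.map j : Finset κ) : Set κ) \ {j i} = ((T.erase i).map j : Finset κ) := by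
    intro i
    rw [Finset.map_erase, Finset.coe_erase]
  constructor
  · intro hT
    have hsub : T ⊆ E := Finset.map_subset_map.1 hT.subset
    refine ⟨hsub, fun i hi => (h T hsub i hi).2 (hT.spans _ (Finset.mem_map_of_mem j hi)),
      fun i hi hs => ?_⟩
    refine hT.indep (j i) (Finset.mem_map_of_mem j hi) ?_
    rw [hcoe]
    rw [← Finset.coe_erase] at hs
    exact (h _ ((Finset.erase_subset _ _).trans hsub) i (hsub hi)).1 hs
  · intro hT
    refine ⟨Finset.map_subset_map.2 hT.subset, fun k hk => ?_, fun k hk hs => ?_⟩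
    · obtain ⟨i, hi, rfl⟩ := Finset.mem_map.1 hk
      exact (h T hT.subset i hi).1 (hT.spans i hi)
    · obtain ⟨i, hi, rfl⟩ := Finset.mem_map.1 hk
      refine hT.indep i hi ?_
      rw [hcoe] at hs
      rw [← Finset.coe_erase]
      exact (h _ ((Finset.erase_subset _ _).trans hT.subset) i (hT.subset hi)).2 hs

/-- The bases of isomorphic systems correspond to each other. -/
theorem average_bases_map (j : ι ↪ κ)
    (h : ∀ T ⊆ E, ∀ i ∈ E, Spans r q (T : Set ι) (q i) ↔
      Spans s p ((T.map j : Finset κ) : Set κ) (p (j i))) (f : Finset κ → ℝ) :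
    average (bases s p (E.map j)) f = average (bases r q E) (fun T => f (T.map j)) := by
  classical
  symm
  have key : ∀ T ⊆ E.map j, (T.preimage j j.injective.injOn).map j = T := by
    intro T hT
    classical
    rw [Finset.map_eq_image, Finset.image_preimage, Finset.filter_true_of_mem]
    intro k hk
    obtain ⟨i, -, rfl⟩ := Finset.mem_map.1 (hT hk)
    exact ⟨i, rfl⟩
  refine average_bij (fun T => T.map j) (fun T => T.preimage j j.injective.injOn) ?_ ?_ ?_ ?_ ?_
  · intro T hT
    rw [mem_bases] at hT ⊢
    exact (isBasis_map_iff j h).2 hT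
  · intro T hT
    rw [mem_bases] at hT ⊢
    rw [← isBasis_map_iff j h, key T hT.subset]
    exact hT
  · intro T _
    exact Finset.preimage_map j T
  · intro T hT
    rw [mem_bases] at hT
    exact key T hT.subset
  · intro T _
    rfl

end Transfer

/-- An arbitrary pair of vertices can be contracted by adjoining it as a new edge, indexed by
`none`, that the bases under comparison do not use. -/
theorem average_bases_identify_le {f : Finset ι → ℝ} (hf : Monotone f) (e : Sym2 V) :
    average (bases (identify r {e}) q E) f ≤ average (bases r q E) f := by
  let p : Option ι → Sym2 V := fun o => o.elim e q
  have h : ∀ r' : Setoid V, average (bases r' q E) f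
      = average (bases r' p (E.map Function.Embedding.some)) (fun T => f T.eraseNone) := by
    intro r'
    rw [average_bases_map (r := r') (q := q) (s := r') (p := p) Function.Embedding.some
      fun T _ i _ => (spans_comp_iff (q := q) (p := p) Function.Embedding.some (fun i => rfl)).symm]
    simp
  rw [h, h]
  have := average_bases_identify_index_le (r := r) (q := p)
    (E := E.map Function.Embedding.some) (g := none)
    (f := fun T => f T.eraseNone) (fun S T hST => hf (Finset.eraseNone.monotone hST)) (by simp)
  exact this

/-- Only the finitely many endpoints of `E` matter, so passing from `r` to `r'` amounts to a finite
sequence of identifications of pairs, each of which lowers the average. -/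
theorem average_bases_le_of_le {f : Finset ι → ℝ} (hf : Monotone f) (hr : r ≤ r') :
    average (bases r' q E) f ≤ average (bases r q E) f := by
  classical
  have hfin : ∀ Q : Finset (Sym2 V),
      average (bases (identify r Q) q E) f ≤ average (bases r q E) f := by
    intro Q
    induction Q using Finset.induction_on with
    | empty => rw [Finset.coe_empty, identify_empty]
    | insert e Q _ ih =>
      rw [Finset.coe_insert, identify_insert]
      exact (average_bases_identify_le hf e).trans ih
  let X : Set V := {x | ∃ i ∈ E, x ∈ q i}
  have hX : X.Finite := by
    have : X = ⋃ i ∈ E, {x | x ∈ q i} := by ext; simp [X]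
    rw [this]
    refine Set.Finite.biUnion E.finite_toSet fun i _ => ?_
    induction q i with
    | _ x y =>
      refine (Set.toFinite {x, y}).subset fun z hz => ?_
      simpa using hz
  let Q : Set (Sym2 V) := (fun z : V × V => s(z.1, z.2)) '' {z | z.1 ∈ X ∧ z.2 ∈ X ∧ r' z.1 z.2}
  have hQ : Q.Finite := ((hX.prod hX).subset fun z hz => ⟨hz.1, hz.2.1⟩).image _
  refine le_trans (le_of_eq (average_congr (bases_congr fun T hT i hi => ?_) fun _ _ => rfl))
    (hfin hQ.toFinset)
  rw [hQ.coe_toFinset]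
  constructor
  · intro h S hS hST
    rw [saturated_identify] at hS
    -- The `r'`-saturation of `S ∩ X`. It agrees with `S` on `X`, because `S` is not cut by the
    -- pairs of `r'`-equivalent points of `X`, and so it cuts the same edges of `E`.
    let S' : Set V := {v | ∃ x ∈ S ∩ X, r' v x}
    have hS' : Saturated r' S' := by
      intro x y hxy
      constructor
      · rintro ⟨z, hz, hxz⟩; exact ⟨z, hz, r'.trans (r'.symm hxy) hxz⟩
      · rintro ⟨z, hz, hyz⟩; exact ⟨z, hz, r'.trans hxy hyz⟩
    have hSS : ∀ v ∈ X, (v ∈ S' ↔ v ∈ S) := by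
      intro v hv
      constructor
      · rintro ⟨x, hx, hvx⟩
        have := hS.2 s(v, x) ⟨(v, x), ⟨hv, hx.2, hvx⟩, rfl⟩
        rw [cuts_mk] at this
        have := hx.1
        tauto
      · intro hvS
        exact ⟨v, ⟨hvS, hv⟩, r'.refl v⟩
    have hcut : ∀ k ∈ E, (Cuts S' (q k) ↔ Cuts S (q k)) := by
      intro k hk
      have : ∀ v ∈ q k, v ∈ X := fun v hv => ⟨k, hk, hv⟩
      induction hqk : q k with
      | _ x y =>
        rw [cuts_mk, cuts_mk, hSS x (this x (by simp [hqk])), hSS y (this y (by simp [hqk]))]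
    rw [← hcut i hi]
    exact h S' hS' fun k hk => by rw [hcut k (hT (by exact_mod_cast hk))]; exact hST k hk
  · intro h
    refine h.mono (identify_le hr ?_) subset_rfl
    rintro x y ⟨⟨a, b⟩, ⟨_, _, hab⟩, he⟩
    rcases Sym2.eq_iff.1 he with ⟨rfl, rfl⟩ | ⟨rfl, rfl⟩
    · exact hab
    · exact r'.symm hab

/-! ### Direct sums and independence -/

section DirectSum

variable {E₁ E₂ : Finset ι}

theorem isBasis_union_iff (hd : Disjoint E₁ E₂)
    (h₁ : ∀ T₁ ⊆ E₁, ∀ T₂ ⊆ E₂, ∀ i ∈ E₁, Spans r q (↑T₁ ∪ ↑T₂) (q i) → Spans r q T₁ (q i))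
    (h₂ : ∀ T₁ ⊆ E₁, ∀ T₂ ⊆ E₂, ∀ i ∈ E₂, Spans r q (↑T₁ ∪ ↑T₂) (q i) → Spans r q T₂ (q i))
    {T₁ T₂ : Finset ι} (hT₁ : T₁ ⊆ E₁) (hT₂ : T₂ ⊆ E₂) :
    IsBasis r q (E₁ ∪ E₂) (T₁ ∪ T₂) ↔ IsBasis r q E₁ T₁ ∧ IsBasis r q E₂ T₂ := by
  have hno₁ : ∀ i ∈ E₁, i ∉ T₂ := fun i hi h => Finset.disjoint_left.1 hd hi (hT₂ h)
  have hno₂ : ∀ i ∈ E₂, i ∉ T₁ := fun i hi h => Finset.disjoint_left.1 hd (hT₁ h) hi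
  constructor
  · intro h
    have hs := h.spans
    have hi := h.indep
    rw [Finset.coe_union] at hs hi
    refine ⟨⟨hT₁, fun i hi => h₁ T₁ hT₁ T₂ hT₂ i hi (hs i (Finset.mem_union_left _ hi)),
      fun i hiT hsp => hi i (Finset.mem_union_left _ hiT) (hsp.mono le_rfl ?_)⟩,
      ⟨hT₂, fun i hi => h₂ T₁ hT₁ T₂ hT₂ i hi (hs i (Finset.mem_union_right _ hi)),
      fun i hiT hsp => hi i (Finset.mem_union_right _ hiT) (hsp.mono le_rfl ?_)⟩⟩
    · exact Set.sdiff_subset_sdiff_left Set.subset_union_left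
    · exact Set.sdiff_subset_sdiff_left Set.subset_union_right
  · rintro ⟨b₁, b₂⟩
    refine ⟨Finset.union_subset_union hT₁ hT₂, fun i hi => ?_, fun i hi hs => ?_⟩
    · rw [Finset.coe_union]
      rcases Finset.mem_union.1 hi with hi | hi
      · exact (b₁.spans i hi).mono le_rfl Set.subset_union_left
      · exact (b₂.spans i hi).mono le_rfl Set.subset_union_right
    · rw [Finset.coe_union, Set.union_sdiff_distrib] at hs
      rcases Finset.mem_union.1 hi with hi | hi
      · rw [Set.sdiff_singleton_eq_self (s := (T₂ : Set ι))
          (by exact_mod_cast hno₁ i (hT₁ hi)), ← Finset.coe_erase] at hs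
        have := h₁ _ ((Finset.erase_subset i T₁).trans hT₁) T₂ hT₂ i (hT₁ hi) hs
        rw [Finset.coe_erase] at this
        exact b₁.indep i hi this
      · rw [Set.sdiff_singleton_eq_self (s := (T₁ : Set ι))
          (by exact_mod_cast hno₂ i (hT₂ hi)), ← Finset.coe_erase] at hs
        have := h₂ T₁ hT₁ _ ((Finset.erase_subset i T₂).trans hT₂) i (hT₂ hi) hs
        rw [Finset.coe_erase] at this
        exact b₂.indep i hi this

/-- In a direct sum, the restrictions of a uniform basis to the summands are independent. -/
theorem average_bases_union (hd : Disjoint E₁ E₂)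
    (h₁ : ∀ T₁ ⊆ E₁, ∀ T₂ ⊆ E₂, ∀ i ∈ E₁, Spans r q (↑T₁ ∪ ↑T₂) (q i) → Spans r q T₁ (q i))
    (h₂ : ∀ T₁ ⊆ E₁, ∀ T₂ ⊆ E₂, ∀ i ∈ E₂, Spans r q (↑T₁ ∪ ↑T₂) (q i) → Spans r q T₂ (q i))
    (f₁ f₂ : Finset ι → ℝ) :
    average (bases r q (E₁ ∪ E₂)) (fun T => f₁ (T ∩ E₁) * f₂ (T ∩ E₂))
      = average (bases r q E₁) f₁ * average (bases r q E₂) f₂ := by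
  have hr₁ : ∀ {T₁ T₂}, T₁ ⊆ E₁ → T₂ ⊆ E₂ → (T₁ ∪ T₂) ∩ E₁ = T₁ := by
    intro T₁ T₂ hT₁ hT₂
    rw [Finset.union_inter_distrib_right, Finset.inter_eq_left.2 hT₁,
      Finset.disjoint_iff_inter_eq_empty.1 (hd.symm.mono_left hT₂), Finset.union_empty]
  have hr₂ : ∀ {T₁ T₂}, T₁ ⊆ E₁ → T₂ ⊆ E₂ → (T₁ ∪ T₂) ∩ E₂ = T₂ := by
    intro T₁ T₂ hT₁ hT₂
    rw [Finset.union_inter_distrib_right, Finset.inter_eq_left.2 hT₂,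
      Finset.disjoint_iff_inter_eq_empty.1 (hd.mono_left hT₁), Finset.empty_union]
  have hsplit : ∀ T ∈ bases r q (E₁ ∪ E₂), T ∩ E₁ ∪ T ∩ E₂ = T := by
    intro T hT
    rw [← Finset.inter_union_distrib_left]
    exact Finset.inter_eq_left.2 (mem_bases.1 hT).subset
  have hi : ∀ T ∈ bases r q (E₁ ∪ E₂), (T ∩ E₁, T ∩ E₂) ∈ bases r q E₁ ×ˢ bases r q E₂ := by
    intro T hT
    have h := hsplit T hT
    rw [mem_bases, ← h, isBasis_union_iff hd h₁ h₂ Finset.inter_subset_right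
      Finset.inter_subset_right] at hT
    exact Finset.mem_product.2 ⟨mem_bases.2 hT.1, mem_bases.2 hT.2⟩
  have hj : ∀ z ∈ bases r q E₁ ×ˢ bases r q E₂, z.1 ∪ z.2 ∈ bases r q (E₁ ∪ E₂) := by
    rintro ⟨T₁, T₂⟩ hz
    obtain ⟨b₁, b₂⟩ := Finset.mem_product.1 hz
    rw [mem_bases] at b₁ b₂
    exact mem_bases.2 ((isBasis_union_iff hd h₁ h₂ b₁.subset b₂.subset).2 ⟨b₁, b₂⟩)
  have hij : ∀ z ∈ bases r q E₁ ×ˢ bases r q E₂, ((z.1 ∪ z.2) ∩ E₁, (z.1 ∪ z.2) ∩ E₂) = z := by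
    rintro ⟨T₁, T₂⟩ hz
    obtain ⟨b₁, b₂⟩ := Finset.mem_product.1 hz
    rw [mem_bases] at b₁ b₂
    rw [hr₁ b₁.subset b₂.subset, hr₂ b₁.subset b₂.subset]
  have hcard : (bases r q (E₁ ∪ E₂)).card = (bases r q E₁).card * (bases r q E₂).card := by
    rw [← Finset.card_product]
    exact Finset.card_nbij' (fun T => (T ∩ E₁, T ∩ E₂)) (fun z => z.1 ∪ z.2) hi hj hsplit hij
  have hsum : ∑ T ∈ bases r q (E₁ ∪ E₂), f₁ (T ∩ E₁) * f₂ (T ∩ E₂)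
      = (∑ T ∈ bases r q E₁, f₁ T) * ∑ T ∈ bases r q E₂, f₂ T := by
    rw [Finset.sum_mul_sum, ← Finset.sum_product']
    exact Finset.sum_nbij' (fun T => (T ∩ E₁, T ∩ E₂)) (fun z => z.1 ∪ z.2) hi hj hsplit hij
      fun _ _ => rfl
  rw [average, average, average, hsum, hcard, Nat.cast_mul, div_mul_div_comm]

end DirectSum

end Operations

/-! ### The resampling inequality in finite volume -/

section Resampling

variable {V : Type u} {ι : Type v} [DecidableEq ι] {r r₂ : Setoid V} {q : ι → Sym2 V}
  {E F E' : Finset ι}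

open Classical in
/-- The edges of `F` whose endpoints are connected by the edges of `T` in `E'`. -/
def connectedEdges (q : ι → Sym2 V) (F E' T : Finset ι) : Finset ι :=
  F.filter fun i => Spans ⊥ q ((T ∩ E' : Finset ι) : Set ι) (q i)

theorem mem_connectedEdges {T : Finset ι} {i : ι} :
    i ∈ connectedEdges q F E' T ↔ i ∈ F ∧ Spans ⊥ q ((T ∩ E' : Finset ι) : Set ι) (q i) := by
  simp [connectedEdges]

/-- Conditionally on the edges outside `F` and on the edges of `F` whose endpoints are connected
inside `E'`, the edges in `F` of a uniform basis form a uniform basis of a smaller system. -/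
theorem mem_bases_resample_iff (hF : F ⊆ E) (hFE' : F ⊆ E') {T₁ T : Finset ι}
    (hT₁ : T₁ ∈ bases r q E) :
    (T ∈ bases r q E ∧ T \ F = T₁ \ F ∧ connectedEdges q F E' T = connectedEdges q F E' T₁) ↔
      (T \ F = T₁ \ F ∧ T ∩ F ∈ bases (identify ⊥ (q '' (((T₁ ∩ E') \ F : Finset ι) : Set ι))) q
        (connectedEdges q F E' T₁)) := by
  have hdec : ∀ T : Finset ι, T \ F = T₁ \ F →
      ((T ∩ E' : Finset ι) : Set ι) = ((T ∩ F : Finset ι) : Set ι) ∪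
        (((T₁ ∩ E') \ F : Finset ι) : Set ι) := by
    intro T hT
    ext i
    have h1 : i ∈ T \ F ↔ i ∈ T₁ \ F := by rw [hT]
    have h2 := @hFE' i
    simp only [Finset.mem_sdiff] at h1
    simp only [Finset.coe_inter, Finset.coe_sdiff, Set.mem_union, Set.mem_inter_iff,
      Finset.mem_coe, Set.mem_sdiff]
    tauto
  have hsp : ∀ (T : Finset ι), T \ F = T₁ \ F → ∀ e,
      (Spans (identify ⊥ (q '' (((T₁ ∩ E') \ F : Finset ι) : Set ι))) q
        ((T ∩ F : Finset ι) : Set ι) e ↔ Spans ⊥ q ((T ∩ E' : Finset ι) : Set ι) e) := by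
    intro T hT e
    rw [spans_identify rfl, hdec T hT]
  have hfwd : ∀ T ∈ bases r q E, T \ F = T₁ \ F →
      connectedEdges q F E' T = connectedEdges q F E' T₁ →
      T ∩ F ∈ bases (identify ⊥ (q '' (((T₁ ∩ E') \ F : Finset ι) : Set ι))) q
        (connectedEdges q F E' T₁) := by
    intro T hT hTF hTc
    rw [mem_bases] at hT ⊢
    rw [← hTc]
    refine ⟨fun i hi => ?_, fun i hi => ?_, fun i hi hs => ?_⟩
    · rw [Finset.mem_inter] at hi
      rw [mem_connectedEdges]
      refine ⟨hi.2, spans_of_mem ?_⟩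
      rw [Finset.mem_coe, Finset.mem_inter]
      exact ⟨hi.1, hFE' hi.2⟩
    · rw [hsp T hTF]
      exact (mem_connectedEdges.1 hi).2
    · rw [spans_identify rfl] at hs
      refine hT.indep i (Finset.mem_inter.1 hi).1 (hs.mono bot_le ?_)
      intro k hk
      have hiF : i ∈ F := (Finset.mem_inter.1 hi).2
      have h1 : k ∈ T \ F ↔ k ∈ T₁ \ F := by rw [hTF]
      simp only [Finset.mem_sdiff] at h1
      simp only [Finset.coe_inter, Finset.coe_sdiff, Set.mem_union, Set.mem_inter_iff,
        Finset.mem_coe, Set.mem_sdiff, Set.mem_singleton_iff] at hk ⊢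
      rcases hk with ⟨⟨h2, -⟩, h3⟩ | ⟨⟨h2, -⟩, h3⟩
      · exact ⟨h2, h3⟩
      · exact ⟨(h1.2 ⟨h2, h3⟩).1, fun h => h3 (h ▸ hiF)⟩
  constructor
  · rintro ⟨hT, hTF, hTc⟩
    exact ⟨hTF, hfwd T hT hTF hTc⟩
  · rintro ⟨hTF, hT⟩
    have hb₁ := mem_bases.1 (hfwd T₁ hT₁ rfl rfl)
    have hb := mem_bases.1 hT
    have heq : ∀ e, (Spans ⊥ q ((T ∩ E' : Finset ι) : Set ι) e ↔
        Spans ⊥ q ((T₁ ∩ E' : Finset ι) : Set ι) e) := by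
      intro e
      rw [← hsp T hTF, ← hsp T₁ rfl]
      exact ⟨fun h => h.trans fun i hi => hb₁.spans i (hb.subset hi),
        fun h => h.trans fun i hi => hb.spans i (hb₁.subset hi)⟩
    refine ⟨?_, hTF, ?_⟩
    · rw [mem_bases] at hT₁ ⊢
      have hTu : T = T₁ \ F ∪ T ∩ F := by rw [← hTF, Finset.sdiff_union_inter]
      -- `T ∩ F` and `T₁ ∩ F` are bases of the same contracted system. Hence `T` and `T₁` make the
      -- same connections inside `E'` and have the same size, so `T` spans and is a basis by
      -- cardinality.
      refine hT₁.of_card ?_ (fun i hi => (hT₁.spans i hi).trans fun k hk => ?_) ?_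
      · rw [hTu]
        exact Finset.union_subset (Finset.sdiff_subset.trans hT₁.subset)
          (Finset.inter_subset_right.trans hF)
      · by_cases hkF : k ∈ F
        · have h1 : Spans ⊥ q ((T₁ ∩ E' : Finset ι) : Set ι) (q k) := by
            refine spans_of_mem ?_
            rw [Finset.mem_coe, Finset.mem_inter]
            exact ⟨hk, hFE' hkF⟩
          refine ((heq _).2 h1).mono bot_le ?_
          exact_mod_cast Finset.inter_subset_left
        · refine spans_of_mem ?_
          have : k ∈ T \ F := by rw [hTF]; exact Finset.mem_sdiff.2 ⟨hk, hkF⟩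
          exact (Finset.mem_sdiff.1 this).1
      · rw [← Finset.card_sdiff_add_card_inter T F, ← Finset.card_sdiff_add_card_inter T₁ F, hTF,
          hb.card_eq hb₁]
    · ext i
      rw [mem_connectedEdges, mem_connectedEdges, heq]

/-- Resampling the edges in `F` of a uniform basis, given the edges of `F` whose endpoints it
connects inside `E'`, with the identifications of `r₂`, decreases it stochastically. -/
theorem average_resample_le (hF : F ⊆ E) (hFE' : F ⊆ E')
    (hr₂ : ∀ i ∈ E' \ F, ∀ x y, q i = s(x, y) → r₂ x y) {f : Finset ι → ℝ} (hf : Monotone f)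
    (hfF : ∀ T, f (T ∩ F) = f T) :
    average (bases r q E) (fun T => average (bases r₂ q (connectedEdges q F E' T)) f)
      ≤ average (bases r q E) f := by
  rw [average, average]
  refine div_le_div_of_nonneg_right ?_ (Nat.cast_nonneg _)
  -- The fibres of `key` are the conditioning events. On each fibre the resampled average is
  -- constant, and the edges of the basis in `F` run over the bases of one contracted system.
  let key : Finset ι → Finset ι × Finset ι := fun T => (T \ F, connectedEdges q F E' T)
  have hmaps : ∀ T ∈ bases r q E, key T ∈ (bases r q E).image key := fun T hT =>
    Finset.mem_image_of_mem key hT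
  rw [← Finset.sum_fiberwise_of_maps_to hmaps, ← Finset.sum_fiberwise_of_maps_to hmaps]
  refine Finset.sum_le_sum fun k hk => ?_
  obtain ⟨T₁, hT₁, rfl⟩ := Finset.mem_image.1 hk
  set ρ := identify ⊥ (q '' (((T₁ ∩ E') \ F : Finset ι) : Set ι))
  have hfib : ∀ T, T ∈ (bases r q E).filter (fun T => key T = key T₁) ↔
      (T \ F = T₁ \ F ∧ T ∩ F ∈ bases ρ q (connectedEdges q F E' T₁)) := by
    intro T
    rw [← mem_bases_resample_iff hF hFE' hT₁, Finset.mem_filter]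
    simp only [key, Prod.mk.injEq]
  have hsubF : ∀ ξ ∈ bases ρ q (connectedEdges q F E' T₁), ξ ⊆ F := fun ξ hξ =>
    (mem_bases.1 hξ).subset.trans fun i hi => (mem_connectedEdges.1 hi).1
  have hi : ∀ T ∈ (bases r q E).filter (fun T => key T = key T₁),
      T ∩ F ∈ bases ρ q (connectedEdges q F E' T₁) := fun T hT => ((hfib T).1 hT).2
  have hsd : ∀ ξ ∈ bases ρ q (connectedEdges q F E' T₁),
      (T₁ \ F ∪ ξ) \ F = T₁ \ F ∧ (T₁ \ F ∪ ξ) ∩ F = ξ := by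
    intro ξ hξ
    have := hsubF ξ hξ
    constructor
    · ext i
      have := @this i
      simp only [Finset.mem_sdiff, Finset.mem_union]; tauto
    · ext i
      have := @this i
      simp only [Finset.mem_sdiff, Finset.mem_union, Finset.mem_inter]; tauto
  have hj : ∀ ξ ∈ bases ρ q (connectedEdges q F E' T₁),
      T₁ \ F ∪ ξ ∈ (bases r q E).filter (fun T => key T = key T₁) := by
    intro ξ hξ
    rw [hfib, (hsd ξ hξ).1, (hsd ξ hξ).2]
    exact ⟨rfl, hξ⟩
  have hji : ∀ T ∈ (bases r q E).filter (fun T => key T = key T₁), T₁ \ F ∪ T ∩ F = T := by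
    intro T hT
    rw [← ((hfib T).1 hT).1, Finset.sdiff_union_inter]
  have hij : ∀ ξ ∈ bases ρ q (connectedEdges q F E' T₁), (T₁ \ F ∪ ξ) ∩ F = ξ :=
    fun ξ hξ => (hsd ξ hξ).2
  have hsum : ∑ T ∈ bases r q E with key T = key T₁, f T
      = ∑ ξ ∈ bases ρ q (connectedEdges q F E' T₁), f ξ :=
    Finset.sum_nbij' (fun T => T ∩ F) (fun ξ => T₁ \ F ∪ ξ) hi hj hji hij
      fun T _ => (hfF T).symm
  have hcard : ((bases r q E).filter (fun T => key T = key T₁)).card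
      = (bases ρ q (connectedEdges q F E' T₁)).card :=
    Finset.card_nbij' (fun T => T ∩ F) (fun ξ => T₁ \ F ∪ ξ) hi hj hji hij
  -- The conditional law contracts only the edges of `T₁` in `E' \ F`. Since `r₂` identifies the
  -- endpoints of all those edges, it is the coarser relation and gives the smaller average.
  have hle : average (bases r₂ q (connectedEdges q F E' T₁)) f
      ≤ average (bases ρ q (connectedEdges q F E' T₁)) f := by
    refine average_bases_le_of_le hf (identify_le bot_le ?_)
    rintro x y ⟨i, hi, hxy⟩
    refine hr₂ i ?_ x y hxy
    simp only [Finset.coe_sdiff, Finset.coe_inter, Set.mem_sdiff, Set.mem_inter_iff,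
      Finset.mem_coe] at hi
    exact Finset.mem_sdiff.2 ⟨hi.1.2, hi.2⟩
  have hconst : ∑ T ∈ bases r q E with key T = key T₁,
      average (bases r₂ q (connectedEdges q F E' T)) f
      = (bases ρ q (connectedEdges q F E' T₁)).card
        * average (bases r₂ q (connectedEdges q F E' T₁)) f := by
    rw [← hcard, ← nsmul_eq_mul, ← Finset.sum_const]
    refine Finset.sum_congr rfl fun T hT => ?_
    have : key T = key T₁ := (Finset.mem_filter.1 hT).2
    rw [(Prod.mk.inj this).2]
  rw [hconst, hsum]
  have hpos : (0 : ℝ) < (bases ρ q (connectedEdges q F E' T₁)).card := by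
    exact_mod_cast Finset.card_pos.2 (bases_nonempty _ _ _)
  have := mul_le_mul_of_nonneg_left hle hpos.le
  rwa [average.eq_1 (bases ρ q _), mul_div_cancel₀ _ hpos.ne'] at this

end Resampling

/-! ### Laws of random sets and their weak limits -/

section RandomSets

variable {α : Type u}

/-- The event that a random set contains the finite set `A`. -/
def containing (A : Finset α) : Set (Set α) := {ω | ↑A ⊆ ω}

theorem mem_containing {A : Finset α} {ω : Set α} : ω ∈ containing A ↔ ↑A ⊆ ω := Iff.rfl

theorem containing_empty : containing (∅ : Finset α) = Set.univ := by
  ext ω; simp [containing]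

theorem containing_union [DecidableEq α] (A B : Finset α) :
    containing (A ∪ B) = containing A ∩ containing B := by
  ext ω; simp [containing]

theorem containing_eq_iInter (A : Finset α) : containing A = ⋂ a ∈ A, {ω | a ∈ ω} := by
  ext ω
  simp [containing, Set.subset_def]

theorem measurableSet_containing (A : Finset α) : MeasurableSet (containing A) := by
  rw [containing_eq_iInter]
  exact Finset.measurableSet_biInter A fun a _ => measurableSet_mem a

theorem isPiSystem_containing : IsPiSystem (Set.range (containing (α := α))) := by
  classical
  rintro _ ⟨A, rfl⟩ _ ⟨B, rfl⟩ _
  exact ⟨A ∪ B, containing_union A B⟩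

theorem generateFrom_containing :
    (Set.instMeasurableSpace : MeasurableSpace (Set α))
      = MeasurableSpace.generateFrom (Set.range containing) := by
  apply le_antisymm
  · have h : @Measurable (Set α) (Set α) (MeasurableSpace.generateFrom (Set.range containing)) _
        id := by
      refine @measurable_set_iff α (Set α) (MeasurableSpace.generateFrom _) id |>.2 fun a => ?_
      refine @measurableSet_setOfPred (Set α) (MeasurableSpace.generateFrom _) _ |>.1 ?_
      exact MeasurableSpace.measurableSet_generateFrom ⟨{a}, by ext; simp [containing]⟩
    intro s hs
    exact h hs
  · refine MeasurableSpace.generateFrom_le ?_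
    rintro _ ⟨A, rfl⟩
    exact measurableSet_containing A

theorem measure_ext_containing {μ ν : Measure (Set α)} [IsProbabilityMeasure μ]
    [IsProbabilityMeasure ν] (h : ∀ A, μ.real (containing A) = ν.real (containing A)) : μ = ν := by
  refine ext_of_generate_finite _ generateFrom_containing isPiSystem_containing ?_ (by simp)
  rintro _ ⟨A, rfl⟩
  have := h A
  rwa [measureReal_def, measureReal_def, ENNReal.toReal_eq_toReal_iff' (measure_ne_top _ _)
    (measure_ne_top _ _)] at this

/-- The function `φ` of a random set depends only on its intersection with `K`. -/
def IsLocal (K : Finset α) (φ : Set α → ℝ) : Prop := ∀ ω, φ (ω ∩ K) = φ ω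

/-- The uniform measures on the families `𝓑 n` converge to `μ` on the events `containing A`. -/
def ConvergesTo {β : Type*} (l : Filter β) (𝓑 : β → Finset (Finset α)) (μ : Measure (Set α)) :
    Prop :=
  ∀ A, Tendsto (fun n => average (𝓑 n) fun T => (containing A).indicator 1 (T : Set α)) l
    (𝓝 (μ.real (containing A)))

theorem average_sub (𝓑 : Finset (Finset α)) (f g : Finset α → ℝ) :
    average 𝓑 (fun T => f T - g T) = average 𝓑 f - average 𝓑 g := by
  simp only [average, Finset.sum_sub_distrib, sub_div]

theorem average_const_mul (𝓑 : Finset (Finset α)) (c : ℝ) (f : Finset α → ℝ) :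
    average 𝓑 (fun T => c * f T) = c * average 𝓑 f := by
  simp only [average, ← Finset.mul_sum, mul_div_assoc]

theorem average_sum {κ : Type*} (𝓑 : Finset (Finset α)) (s : Finset κ) (f : κ → Finset α → ℝ) :
    average 𝓑 (fun T => ∑ k ∈ s, f k T) = ∑ k ∈ s, average 𝓑 (f k) := by
  simp only [average, ← Finset.sum_div]
  rw [Finset.sum_comm]

theorem average_mono {𝓑 : Finset (Finset α)} {f g : Finset α → ℝ} (h : ∀ T ∈ 𝓑, f T ≤ g T) :
    average 𝓑 f ≤ average 𝓑 g :=
  div_le_div_of_nonneg_right (Finset.sum_le_sum h) (Nat.cast_nonneg _)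

theorem average_const {𝓑 : Finset (Finset α)} (h : 𝓑.Nonempty) (c : ℝ) :
    average 𝓑 (fun _ => c) = c := by
  have : (𝓑.card : ℝ) ≠ 0 := by exact_mod_cast (Finset.card_pos.2 h).ne'
  simp [average, this]

theorem average_nonneg {𝓑 : Finset (Finset α)} {f : Finset α → ℝ} (h : ∀ T ∈ 𝓑, 0 ≤ f T) :
    0 ≤ average 𝓑 f :=
  div_nonneg (Finset.sum_nonneg h) (Nat.cast_nonneg _)

theorem average_le_one {𝓑 : Finset (Finset α)} {f : Finset α → ℝ} (h : ∀ T ∈ 𝓑, f T ≤ 1) :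
    average 𝓑 f ≤ 1 := by
  rcases 𝓑.eq_empty_or_nonempty with rfl | hne
  · simp [average]
  · exact (average_mono h).trans_eq (average_const hne 1)

theorem IsLocal.eq_sum {K : Finset α} {φ : Set α → ℝ} (h : IsLocal K φ) (ω : Set α) :
    φ ω = ∑ A ∈ K.powerset, φ A * {ω : Set α | ω ∩ K = A}.indicator 1 ω := by
  classical
  rw [Finset.sum_eq_single (K.filter fun a => a ∈ ω)]
  · have : (((K.filter fun a => a ∈ ω) : Finset α) : Set α) = ω ∩ K := by
      ext a; simp [and_comm]
    rw [this, h ω, Set.indicator_of_mem (by simp)]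
    simp
  · intro A _ hne
    rw [Set.indicator_of_notMem, mul_zero]
    intro hA
    refine hne ?_
    have hA' : ω ∩ K = A := hA
    rw [← Finset.coe_inj, ← hA']
    ext a; simp [and_comm]
  · intro hn
    simp at hn

theorem measurableSet_inter_eq (K A : Finset α) : MeasurableSet {ω : Set α | ω ∩ K = A} := by
  classical
  have : {ω : Set α | ω ∩ K = A} = if A ⊆ K then
      (⋂ a ∈ A, {ω | a ∈ ω}) ∩ ⋂ a ∈ K \ A, {ω | a ∈ ω}ᶜ else ∅ := by
    split_ifs with hAK
    · ext ω
      simp only [Set.mem_ofPred_eq, Set.ext_iff, Set.mem_inter_iff, Finset.mem_coe,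
        Set.mem_iInter, Set.mem_compl_iff, Finset.mem_sdiff]
      constructor
      · intro h
        exact ⟨fun a ha => ((h a).2 ha).1, fun a ha ha' => ha.2 ((h a).1 ⟨ha', ha.1⟩)⟩
      · rintro ⟨h1, h2⟩ a
        exact ⟨fun h => by_contra fun hn => h2 a ⟨h.2, hn⟩ h.1, fun h => ⟨h1 a h, hAK h⟩⟩
    · rw [Set.eq_empty_iff_forall_notMem]
      intro ω hω
      have hω' : ω ∩ K = A := hω
      exact hAK (by rw [← Finset.coe_subset, ← hω']; exact Set.inter_subset_right)
  rw [this]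
  split_ifs
  · exact (Finset.measurableSet_biInter _ fun a _ => measurableSet_mem a).inter
      (Finset.measurableSet_biInter _ fun a _ => (measurableSet_mem a).compl)
  · exact MeasurableSet.empty

theorem IsLocal.measurable {K : Finset α} {φ : Set α → ℝ} (h : IsLocal K φ) : Measurable φ := by
  have : φ = fun ω => ∑ A ∈ K.powerset, φ A * {ω : Set α | ω ∩ K = A}.indicator 1 ω :=
    funext h.eq_sum
  rw [this]
  exact Finset.measurable_sum _ fun A _ =>
    (measurable_one.indicator (measurableSet_inter_eq K A)).const_mul _

theorem IsLocal.exists_bound {K : Finset α} {φ : Set α → ℝ} (h : IsLocal K φ) :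
    ∃ C, ∀ ω, ‖φ ω‖ ≤ C := by
  classical
  refine ⟨∑ A ∈ K.powerset, ‖φ A‖, fun ω => ?_⟩
  have h1 : (((K.filter fun a => a ∈ ω) : Finset α) : Set α) = ω ∩ K := by
    ext a; simp [and_comm]
  rw [← h ω, ← h1]
  exact Finset.single_le_sum (f := fun A : Finset α => ‖φ A‖) (fun _ _ => norm_nonneg _)
    (Finset.mem_powerset.2 (Finset.filter_subset _ _))

/-- Inclusion–exclusion, with one more avoided element at a time. Measurability is carried through
the induction because the measure of a difference needs it. -/
theorem ConvergesTo.tendsto_indicator {β : Type*} {l : Filter β} {𝓑 : β → Finset (Finset α)}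
    {μ : Measure (Set α)} [IsFiniteMeasure μ] (h : ConvergesTo l 𝓑 μ) (J : Finset α) :
    ∀ A : Finset α, MeasurableSet {ω : Set α | ↑A ⊆ ω ∧ Disjoint (J : Set α) ω} ∧
      Tendsto (fun n => average (𝓑 n) fun T =>
        {ω : Set α | ↑A ⊆ ω ∧ Disjoint (J : Set α) ω}.indicator 1 (T : Set α)) l
      (𝓝 (μ.real {ω : Set α | ↑A ⊆ ω ∧ Disjoint (J : Set α) ω})) := by
  classical
  induction J using Finset.induction_on with
  | empty =>
    intro A
    have : {ω : Set α | ↑A ⊆ ω ∧ Disjoint ((∅ : Finset α) : Set α) ω} = containing A := by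
      ext ω; simp [containing]
    rw [this]
    exact ⟨measurableSet_containing A, h A⟩
  | insert g J _ ih =>
    intro A
    obtain ⟨m1, t1⟩ := ih A
    obtain ⟨m2, t2⟩ := ih (insert g A)
    set S1 := {ω : Set α | ↑A ⊆ ω ∧ Disjoint (J : Set α) ω}
    set S2 := {ω : Set α | ↑(insert g A : Finset α) ⊆ ω ∧ Disjoint (J : Set α) ω}
    have hsub : S2 ⊆ S1 := fun ω hω => ⟨fun a ha => hω.1 (by simp at ha ⊢; exact Or.inr ha), hω.2⟩
    have hS : {ω : Set α | ↑A ⊆ ω ∧ Disjoint ((insert g J : Finset α) : Set α) ω} = S1 \ S2 := by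
      ext ω
      simp only [S1, S2, Set.mem_ofPred_eq, Set.mem_sdiff, Finset.coe_insert,
        Set.disjoint_insert_left, Set.insert_subset_iff]
      tauto
    rw [hS]
    refine ⟨m1.diff m2, ?_⟩
    rw [measureReal_sdiff hsub m2]
    refine (t1.sub t2).congr fun n => ?_
    rw [← average_sub]
    refine average_congr rfl fun T _ => ?_
    rw [Set.indicator_sdiff hsub]
    rfl

/-- Convergence on the events `containing A` implies convergence for all local functions. -/
theorem ConvergesTo.tendsto_average {β : Type*} {l : Filter β} {𝓑 : β → Finset (Finset α)}
    {μ : Measure (Set α)} [IsFiniteMeasure μ] (h : ConvergesTo l 𝓑 μ) {K : Finset α}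
    {φ : Set α → ℝ} (hφ : IsLocal K φ) :
    Tendsto (fun n => average (𝓑 n) fun T => φ T) l (𝓝 (∫ ω, φ ω ∂μ)) := by
  classical
  have hcyl : ∀ A ∈ K.powerset, {ω : Set α | ω ∩ K = A}
      = {ω : Set α | ↑A ⊆ ω ∧ Disjoint ((K \ A : Finset α) : Set α) ω} := by
    intro A hA
    rw [Finset.mem_powerset] at hA
    ext ω
    simp only [Set.mem_ofPred_eq, Set.ext_iff, Set.mem_inter_iff, Finset.mem_coe,
      Set.disjoint_left, Finset.coe_sdiff, Set.mem_sdiff, Set.subset_def]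
    constructor
    · intro h
      exact ⟨fun a ha => ((h a).2 ha).1, fun a ha ha' => ha.2 ((h a).1 ⟨ha', ha.1⟩)⟩
    · rintro ⟨h1, h2⟩ a
      exact ⟨fun h => by_contra fun hn => h2 ⟨h.2, hn⟩ h.1, fun h => ⟨h1 a h, hA h⟩⟩
  have hint : ∫ ω, φ ω ∂μ = ∑ A ∈ K.powerset, φ A * μ.real {ω : Set α | ω ∩ K = A} := by
    rw [integral_congr_ae (Eventually.of_forall hφ.eq_sum), integral_finsetSum]
    · refine Finset.sum_congr rfl fun A _ => ?_
      rw [integral_const_mul, integral_indicator_one (measurableSet_inter_eq K A)]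
    · intro A _
      exact ((integrable_const (1 : ℝ)).indicator (measurableSet_inter_eq K A)).const_mul _
  rw [hint]
  have : ∀ n, average (𝓑 n) (fun T => φ T) = ∑ A ∈ K.powerset, φ A *
      average (𝓑 n) fun T => {ω : Set α | ω ∩ K = A}.indicator 1 (T : Set α) := by
    intro n
    simp_rw [← average_const_mul]
    rw [← average_sum]
    exact average_congr rfl fun T _ => hφ.eq_sum _
  simp_rw [this]
  refine tendsto_finsetSum _ fun A hA => Tendsto.const_mul _ ?_
  rw [hcyl A hA]
  exact (h.tendsto_indicator (K \ A) A).2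

theorem uniformProb_image_coe (𝓑 : Finset (Finset (Sym2 α))) (P : Set (Set (Sym2 α))) :
    uniformProb ((fun T : Finset (Sym2 α) => (T : Set (Sym2 α))) '' 𝓑) P
      = average 𝓑 fun T => P.indicator 1 (T : Set (Sym2 α)) := by
  classical
  have hinj : Function.Injective (fun T : Finset (Sym2 α) => (T : Set (Sym2 α))) :=
    Finset.coe_injective
  have h1 : (fun T : Finset (Sym2 α) => (T : Set (Sym2 α))) '' 𝓑 ∩ P
      = (fun T : Finset (Sym2 α) => (T : Set (Sym2 α))) ''
        (↑(𝓑.filter fun T : Finset (Sym2 α) => (T : Set (Sym2 α)) ∈ P) : Set (Finset (Sym2 α))) := by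
    ext ω
    simp only [Set.mem_inter_iff, Set.mem_image, Finset.coe_filter, Set.mem_ofPred_eq,
      Finset.mem_coe]
    constructor
    · rintro ⟨⟨T, hT, rfl⟩, hP⟩; exact ⟨T, ⟨hT, hP⟩, rfl⟩
    · rintro ⟨T, ⟨hT, hP⟩, rfl⟩; exact ⟨⟨T, hT, rfl⟩, hP⟩
  rw [uniformProb, h1, Set.ncard_image_of_injective _ hinj, Set.ncard_image_of_injective _ hinj,
    Set.ncard_coe_finset, Set.ncard_coe_finset, average]
  congr 1
  rw [Finset.card_filter, Nat.cast_sum]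
  refine Finset.sum_congr rfl fun T _ => ?_
  by_cases h : (T : Set (Sym2 α)) ∈ P <;> simp [h]

theorem tendsto_measureReal_of_isClopen {Ω β : Type*} [TopologicalSpace Ω] [MeasurableSpace Ω]
    [OpensMeasurableSpace Ω] [HasOuterApproxClosed Ω] {l : Filter β} {m : β → ProbabilityMeasure Ω}
    {ν : ProbabilityMeasure Ω} (h : Tendsto m l (𝓝 ν)) {S : Set Ω} (hS : IsClopen S) :
    Tendsto (fun n => (m n : Measure Ω).real S) l (𝓝 ((ν : Measure Ω).real S)) := by
  have := ProbabilityMeasure.tendsto_measure_of_null_frontier_of_tendsto' h (E := S)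
    (by rw [hS.frontier_eq]; simp)
  exact (ENNReal.tendsto_toReal (measure_ne_top _ _)).comp this

/-- If the probabilities of the events `containing A` converge, then they converge to those of a
probability measure. -/
theorem exists_convergesTo [Countable α] {β : Type*} {l : Filter β} [l.NeBot]
    (𝓑 : β → Finset (Finset α)) (hne : ∀ n, (𝓑 n).Nonempty)
    (h : ∀ A, ∃ c, Tendsto (fun n => average (𝓑 n) fun T =>
      (containing A).indicator 1 (T : Set α)) l (𝓝 c)) :
    ∃ μ : Measure (Set α), IsProbabilityMeasure μ ∧ ConvergesTo l 𝓑 μ := by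
  classical
  let bool : Finset α → (α → Bool) := fun T a => decide (a ∈ T)
  let m₀ : β → Measure (α → Bool) := fun n =>
    ((𝓑 n).card : ENNReal)⁻¹ • ∑ T ∈ 𝓑 n, Measure.dirac (bool T)
  have hcard : ∀ n, ((𝓑 n).card : ENNReal) ≠ 0 := fun n => by
    exact_mod_cast (Finset.card_pos.2 (hne n)).ne'
  have hm₀ : ∀ n, IsProbabilityMeasure (m₀ n) := fun n => ⟨by
    simp only [m₀, Measure.smul_apply, Measure.finsetSum_apply, measure_univ, Finset.sum_const,
      nsmul_eq_mul, mul_one, smul_eq_mul]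
    exact ENNReal.inv_mul_cancel (hcard n) (ENNReal.natCast_ne_top _)⟩
  let m : β → ProbabilityMeasure (α → Bool) := fun n => ⟨m₀ n, hm₀ n⟩
  -- Probability measures on the compact space `α → Bool` form a compact space, which yields a limit
  -- along an ultrafilter. The assumed convergence then identifies the containment probabilities of
  -- this limit along the whole filter.
  obtain ⟨ν, -, hν⟩ := (isCompact_univ (X := ProbabilityMeasure (α → Bool))).ultrafilter_le_nhds
    ((Ultrafilter.of l).map m) (by simp)
  have hν' : Tendsto m (Ultrafilter.of l) (𝓝 ν) := hν
  let toSet : (α → Bool) → Set α := fun b => {a | b a = true}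
  have hmeas : Measurable toSet := by
    rw [measurable_set_iff]
    intro a
    refine measurableSet_setOfPred.1 ?_
    exact (measurable_pi_apply (X := fun _ : α => Bool) a) (measurableSet_singleton true)
  have hS : ∀ A, toSet ⁻¹' containing A = ⋂ a ∈ A, {b : α → Bool | b a = true} := by
    intro A
    ext b
    simp [toSet, containing, Set.subset_def]
  have hclopen : ∀ A, IsClopen (toSet ⁻¹' containing A) := by
    intro A
    rw [hS]
    refine isClopen_biInter_finset fun a _ => ?_
    exact (isClopen_discrete {true}).preimage (continuous_apply a)
  have hreal : ∀ A n, ((m n : ProbabilityMeasure (α → Bool)) : Measure (α → Bool)).real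
      (toSet ⁻¹' containing A)
      = average (𝓑 n) fun T => (containing A).indicator 1 (T : Set α) := by
    intro A n
    have h1 : ∀ T, toSet (bool T) = (T : Set α) := fun T => by ext a; simp [toSet, bool]
    have h2 : ∀ T ∈ 𝓑 n, Measure.dirac (bool T) (toSet ⁻¹' containing A)
        = (if (T : Set α) ∈ containing A then 1 else 0 : ENNReal) := by
      intro T _
      rw [Measure.dirac_apply' _ (hmeas (measurableSet_containing A)), Set.indicator_apply,
        Set.mem_preimage, h1]
      rfl
    change (m₀ n).real _ = _
    simp only [m₀, measureReal_def, Measure.smul_apply, Measure.finsetSum_apply, smul_eq_mul,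
      ENNReal.toReal_mul, ENNReal.toReal_inv, ENNReal.toReal_natCast]
    rw [Finset.sum_congr rfl h2, ENNReal.toReal_sum (fun T _ => by split_ifs <;> simp), average,
      div_eq_inv_mul]
    congr 1
    refine Finset.sum_congr rfl fun T _ => ?_
    by_cases hT : (T : Set α) ∈ containing A <;> simp [hT]
  refine ⟨(ν : Measure (α → Bool)).map toSet, Measure.isProbabilityMeasure_map hmeas.aemeasurable,
    fun A => ?_⟩
  obtain ⟨c, hc⟩ := h A
  have hlim := tendsto_measureReal_of_isClopen hν' (hclopen A)
  simp_rw [hreal A] at hlim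
  have : c = (ν : Measure (α → Bool)).real (toSet ⁻¹' containing A) :=
    tendsto_nhds_unique (hc.mono_left (Ultrafilter.of_le l)) hlim
  rw [measureReal_def, Measure.map_apply hmeas (measurableSet_containing A), ← measureReal_def,
    ← this]
  exact hc

end RandomSets

/-! ### Free and wired limits along finite edge and vertex sets -/

section Limits

variable {V : Type u}

open Classical in
/-- A set as a finite set; infinite sets get the value `∅`. -/
def finsetOf {α : Type*} (s : Set α) : Finset α := if h : s.Finite then h.toFinset else ∅

theorem coe_finsetOf {α : Type*} {s : Set α} (h : s.Finite) : (finsetOf s : Set α) = s := by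
  simp [finsetOf, h]

theorem mem_finsetOf {α : Type*} {s : Set α} (h : s.Finite) {a : α} : a ∈ finsetOf s ↔ a ∈ s := by
  simp [finsetOf, h]

/-- The edges of `H` with an endpoint in `B`. -/
def touching (H : SimpleGraph V) (B : Set V) : Set (Sym2 V) := {e ∈ H.edgeSet | ∃ x ∈ B, x ∈ e}

theorem touching_mono (H : SimpleGraph V) {B B' : Set V} (h : B ⊆ B') :
    touching H B ⊆ touching H B' := fun _ he => ⟨he.1, he.2.imp fun _ hx => ⟨h hx.1, hx.2⟩⟩

theorem touching_finite {H : SimpleGraph V} (hH : ∀ v, (H.neighborSet v).Finite) {B : Set V}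
    (hB : B.Finite) : (touching H B).Finite := by
  have : touching H B ⊆ ⋃ x ∈ B, (fun y => s(x, y)) '' H.neighborSet x := by
    rintro e ⟨he, x, hx, hxe⟩
    obtain ⟨y, rfl⟩ := hxe
    exact Set.mem_biUnion hx ⟨y, he, rfl⟩
  exact (hB.biUnion fun x _ => (hH x).image _).subset this

theorem neighborSet_finite_of_le {G H : SimpleGraph V} (hG : ∀ v, (G.neighborSet v).Finite)
    (h : H ≤ G) (v : V) : (H.neighborSet v).Finite :=
  (hG v).subset fun _ hw => h hw

open Classical in
/-- The edges of `H` in `E`. -/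
def edgesIn (H : SimpleGraph V) (E : Finset (Sym2 V)) : Finset (Sym2 V) :=
  E.filter fun e => e ∈ H.edgeSet

theorem mem_edgesIn {H : SimpleGraph V} {E : Finset (Sym2 V)} {e : Sym2 V} :
    e ∈ edgesIn H E ↔ e ∈ E ∧ e ∈ H.edgeSet := by
  classical
  exact Finset.mem_filter

/-- The maximal spanning forests of the subgraph of `H` with the edges in `E`. -/
def freeBases (H : SimpleGraph V) (E : Finset (Sym2 V)) : Finset (Finset (Sym2 V)) :=
  bases ⊥ id (edgesIn H E)

/-- The maximal spanning forests of the multigraph obtained from `H` by identifying all vertices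
outside `B`. -/
def wiredBases (H : SimpleGraph V) (B : Finset V) : Finset (Finset (Sym2 V)) :=
  bases (wiredSetoid (B : Set V)) id (finsetOf (touching H B))

/-- `μ` is the free spanning forest measure of the possibly disconnected graph `H`. -/
def IsFreeLimit (H : SimpleGraph V) (μ : Measure (Set (Sym2 V))) : Prop :=
  ConvergesTo atTop (freeBases H) μ

/-- `μ` is the wired spanning forest measure of the possibly disconnected graph `H`. -/
def IsWiredLimit (H : SimpleGraph V) (μ : Measure (Set (Sym2 V))) : Prop :=
  ConvergesTo atTop (wiredBases H) μ

theorem monotone_indicator_containing {α : Type*} (A : Finset α) :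
    Monotone fun T : Finset α => (containing A).indicator (1 : Set α → ℝ) (T : Set α) := by
  intro T T' h
  by_cases hT : (T : Set α) ∈ containing A
  · have : (T' : Set α) ∈ containing A := Set.Subset.trans hT (by exact_mod_cast h)
    simp [hT, this]
  · simp only [Set.indicator_of_notMem hT]
    exact Set.indicator_nonneg (fun _ _ => zero_le_one) _

theorem indicator_containing_inter {α : Type*} [DecidableEq α] {A E : Finset α} (h : A ⊆ E)
    (T : Finset α) : (containing A).indicator (1 : Set α → ℝ) ((T ∩ E : Finset α) : Set α)
      = (containing A).indicator 1 (T : Set α) := by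
  have : ((T ∩ E : Finset α) : Set α) ∈ containing A ↔ (T : Set α) ∈ containing A := by
    simp only [mem_containing, Finset.coe_subset, Finset.subset_inter_iff]
    tauto
  by_cases hT : (T : Set α) ∈ containing A
  · rw [Set.indicator_of_mem hT, Set.indicator_of_mem (this.2 hT)]; rfl
  · rw [Set.indicator_of_notMem hT, Set.indicator_of_notMem fun h => hT (this.1 h)]

theorem average_indicator_containing_eq_zero {α : Type*} {𝓑 : Finset (Finset α)} {A : Finset α}
    (h : ∀ T ∈ 𝓑, ¬ A ⊆ T) :
    average 𝓑 (fun T => (containing A).indicator 1 (T : Set α)) = 0 := by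
  rw [average, Finset.sum_eq_zero, zero_div]
  intro T hT
  rw [Set.indicator_of_notMem]
  rw [mem_containing, Finset.coe_subset]
  exact h T hT

theorem isBasis_of_loops {ι : Type v} {r : Setoid V} {q : ι → Sym2 V} {E E' : Finset ι} (hE : E ⊆ E')
    (hl : ∀ i ∈ E', i ∉ E → Spans r q ∅ (q i)) : bases r q E' = bases r q E := by
  ext T
  rw [mem_bases, mem_bases]
  constructor
  · intro h
    refine ⟨fun i hi => ?_, fun i hi => h.spans i (hE hi), h.indep⟩
    by_contra hiE
    exact h.indep i hi ((hl i (h.subset hi) hiE).mono le_rfl (Set.empty_subset _))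
  · intro h
    refine ⟨h.subset.trans hE, fun i hi => ?_, h.indep⟩
    by_cases hiE : i ∈ E
    · exact h.spans i hiE
    · exact (hl i hi hiE).mono le_rfl (Set.empty_subset _)

theorem wiredSetoid_anti {B B' : Set V} (h : B ⊆ B') : wiredSetoid B' ≤ wiredSetoid B := by
  rintro x y (hxy | ⟨hx, hy⟩)
  · exact Or.inl hxy
  · exact Or.inr ⟨fun hx' => hx (h hx'), fun hy' => hy (h hy')⟩

theorem spans_empty_of_rel {r : Setoid V} {ι : Type v} {q : ι → Sym2 V} {x y : V} (h : r x y) :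
    Spans r q ∅ s(x, y) := by
  intro S hS _
  rw [cuts_mk, not_not]
  exact hS x y h

theorem spans_wiredSetoid_of_not_touching {ι : Type v} {q : ι → Sym2 V} {B : Set V} {e : Sym2 V}
    (h : ∀ x ∈ e, x ∉ B) : Spans (wiredSetoid B) q ∅ e := by
  induction e with
  | _ x y => exact spans_empty_of_rel (Or.inr ⟨h x (by simp), h y (by simp)⟩)

/-- Enlarging the wired graph increases the maximal spanning forest stochastically. -/
theorem average_wiredBases_mono {H : SimpleGraph V} (hH : ∀ v, (H.neighborSet v).Finite)
    {B B' : Finset V} (hB : B ⊆ B') {f : Finset (Sym2 V) → ℝ} (hf : Monotone f) :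
    average (wiredBases H B) f ≤ average (wiredBases H B') f := by
  classical
  have hB' : (B : Set V) ⊆ B' := by exact_mod_cast hB
  have hfin := touching_finite hH B.finite_toSet
  have hfin' := touching_finite hH B'.finite_toSet
  -- Edges that touch `B'` but not `B` are loops at the wired vertex of `B`. Adding them changes no
  -- basis, so both families live on the same edges and differ only in the identification.
  rw [wiredBases, wiredBases, ← isBasis_of_loops (E := finsetOf (touching H B))
    (E' := finsetOf (touching H B'))]
  · exact average_bases_le_of_le hf (wiredSetoid_anti hB')
  · intro e he
    rw [mem_finsetOf hfin] at he
    exact (mem_finsetOf hfin').2 (touching_mono H hB' he)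
  · intro e he he'
    rw [mem_finsetOf hfin'] at he
    rw [mem_finsetOf hfin] at he'
    exact spans_wiredSetoid_of_not_touching fun x hx hxB => he' ⟨he.1, x, hxB, hx⟩

theorem average_freeBases_anti (H : SimpleGraph V) [DecidableEq (Sym2 V)] {E E' K : Finset (Sym2 V)}
    (hE : E ⊆ E') (hK : K ⊆ E) (hKH : ↑K ⊆ H.edgeSet) {f : Finset (Sym2 V) → ℝ} (hf : Monotone f)
    (hfK : ∀ T, f (T ∩ K) = f T) : average (freeBases H E') f ≤ average (freeBases H E) f := by
  classical
  have hsub : K ⊆ edgesIn H E := fun e he => mem_edgesIn.2 ⟨hK he, hKH he⟩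
  refine average_bases_mono hf (fun e he => ?_) fun T => ?_
  · rw [mem_edgesIn] at he ⊢
    exact ⟨hE he.1, he.2⟩
  · calc f (T ∩ edgesIn H E) = f (T ∩ edgesIn H E ∩ K) := (hfK _).symm
      _ = f (T ∩ K) := by rw [Finset.inter_assoc, Finset.inter_eq_right.2 hsub]
      _ = f T := hfK T

theorem freeBases_nonempty (H : SimpleGraph V) (E : Finset (Sym2 V)) : (freeBases H E).Nonempty :=
  bases_nonempty _ _ _

theorem wiredBases_nonempty (H : SimpleGraph V) (B : Finset V) : (wiredBases H B).Nonempty :=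
  bases_nonempty _ _ _

theorem subset_edgeSet_of_mem_freeBases {H : SimpleGraph V} {E T : Finset (Sym2 V)}
    (hT : T ∈ freeBases H E) : (T : Set (Sym2 V)) ⊆ H.edgeSet := fun _ he =>
  (mem_edgesIn.1 ((mem_bases.1 hT).subset he)).2

theorem subset_edgeSet_of_mem_wiredBases {H : SimpleGraph V} (hH : ∀ v, (H.neighborSet v).Finite)
    {B : Finset V} {T : Finset (Sym2 V)} (hT : T ∈ wiredBases H B) :
    (T : Set (Sym2 V)) ⊆ H.edgeSet := fun _ he =>
  ((mem_finsetOf (touching_finite hH B.finite_toSet)).1 ((mem_bases.1 hT).subset he)).1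

theorem indicator_le_one {α : Type*} (S : Set α) (ω : α) : S.indicator (1 : α → ℝ) ω ≤ 1 :=
  Set.indicator_le_self' (fun _ _ => zero_le_one) ω

theorem indicator_one_nonneg {α : Type*} (S : Set α) (ω : α) : 0 ≤ S.indicator (1 : α → ℝ) ω :=
  Set.indicator_nonneg (fun _ _ => zero_le_one) _

theorem exists_isFreeLimit [Countable V] (H : SimpleGraph V) :
    ∃ μ, IsProbabilityMeasure μ ∧ IsFreeLimit H μ := by
  classical
  refine exists_convergesTo _ (freeBases_nonempty H) fun A => ?_
  by_cases hA : (A : Set (Sym2 V)) ⊆ H.edgeSet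
  swap
  · refine ⟨0, tendsto_const_nhds.congr fun E => ?_⟩
    rw [average_indicator_containing_eq_zero]
    intro T hT hAT
    exact hA (Set.Subset.trans (by exact_mod_cast hAT) (subset_edgeSet_of_mem_freeBases hT))
  -- Monotonicity holds only among edge sets that contain `A`; replacing the index `E` by `E ∪ A`
  -- ensures this and changes nothing eventually.
  have hanti : Antitone fun E => average (freeBases H (E ∪ A)) fun T =>
      (containing A).indicator 1 (T : Set (Sym2 V)) := fun E E' h =>
    average_freeBases_anti H (E := E ∪ A) (E' := E' ∪ A) (K := A)
      (Finset.union_subset_union_left h) Finset.subset_union_right hA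
      (monotone_indicator_containing A) (indicator_containing_inter (A := A) (E := A) subset_rfl)
  refine ⟨_, (tendsto_atTop_ciInf hanti ⟨0, ?_⟩).congr' ?_⟩
  · rintro _ ⟨E, rfl⟩
    exact average_nonneg fun T _ => indicator_one_nonneg _ _
  · filter_upwards [eventually_ge_atTop A] with E hE
    rw [Finset.union_eq_left.2 hE]

/-- The endpoints of the edges in `A`. -/
def endpoints (A : Finset (Sym2 V)) : Set V := {x | ∃ e ∈ A, x ∈ e}

theorem endpoints_finite (A : Finset (Sym2 V)) : (endpoints A).Finite := by
  have : endpoints A = ⋃ e ∈ A, {x | x ∈ e} := by ext; simp [endpoints]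
  rw [this]
  refine Set.Finite.biUnion A.finite_toSet fun e _ => ?_
  induction e with
  | _ x y =>
    refine (Set.toFinite {x, y}).subset fun z hz => ?_
    simpa using hz

theorem subset_touching_of_endpoints {H : SimpleGraph V} {A : Finset (Sym2 V)} {B : Set V}
    (hA : ↑A ⊆ H.edgeSet) (hB : endpoints A ⊆ B) : (A : Set (Sym2 V)) ⊆ touching H B := by
  intro e he
  refine ⟨hA he, ?_⟩
  induction e with
  | _ x y => exact ⟨x, hB ⟨_, he, by simp⟩, by simp⟩

theorem exists_isWiredLimit [Countable V] {H : SimpleGraph V}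
    (hH : ∀ v, (H.neighborSet v).Finite) : ∃ μ, IsProbabilityMeasure μ ∧ IsWiredLimit H μ := by
  classical
  refine exists_convergesTo _ (wiredBases_nonempty H) fun A => ?_
  have hmono : Monotone fun B => average (wiredBases H B) fun T =>
      (containing A).indicator 1 (T : Set (Sym2 V)) := fun B B' h =>
    average_wiredBases_mono hH h (monotone_indicator_containing A)
  refine ⟨_, tendsto_atTop_ciSup hmono ⟨1, ?_⟩⟩
  rintro _ ⟨B, rfl⟩
  exact average_le_one fun T _ => indicator_le_one _ _

/-- The limit over the directed set of finite edge sets controls every family that eventually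
captures each edge. Once `E n` contains the edges of `H` in a threshold set `E₀`, it is the edge set
belonging to the index `E n ∪ E₀`. -/
theorem IsFreeLimit.convergesTo {H : SimpleGraph V} {μ : Measure (Set (Sym2 V))}
    (h : IsFreeLimit H μ) {β : Type*} {l : Filter β} {E : β → Finset (Sym2 V)}
    (hE : ∀ n, ↑(E n) ⊆ H.edgeSet) (hE' : ∀ e ∈ H.edgeSet, ∀ᶠ n in l, e ∈ E n) :
    ConvergesTo l (fun n => bases ⊥ id (E n)) μ := by
  classical
  intro A U hU
  obtain ⟨E₀, hE₀⟩ := mem_atTop_sets.1 (h A hU)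
  have hev : ∀ᶠ n in l, ∀ e ∈ E₀, e ∈ H.edgeSet → e ∈ E n := by
    rw [Filter.eventually_all_finset]
    intro e _
    by_cases he : e ∈ H.edgeSet
    · exact (hE' e he).mono fun n hn _ => hn
    · exact Eventually.of_forall fun n h => absurd h he
  rw [mem_map]
  filter_upwards [hev] with n hn
  have h1 := hE₀ (E n ∪ E₀) Finset.subset_union_right
  have h2 : edgesIn H (E n ∪ E₀) = E n := by
    ext e
    simp only [mem_edgesIn, Finset.mem_union]
    constructor
    · rintro ⟨he | he, heH⟩
      · exact he
      · exact hn e he heH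
    · exact fun he => ⟨Or.inl he, hE n he⟩
  rw [Set.mem_preimage, freeBases, h2] at h1
  exact h1

theorem ConvergesTo.comp {α β γ : Type*} {l : Filter β} {l' : Filter γ}
    {𝓑 : β → Finset (Finset α)} {μ : Measure (Set α)} (h : ConvergesTo l 𝓑 μ) {g : γ → β}
    (hg : Tendsto g l' l) : ConvergesTo l' (fun n => 𝓑 (g n)) μ := fun A => (h A).comp hg

end Limits

/-! ### Walks versus cuts -/

section Connectivity

variable {V : Type u}

/-- A walk cannot leave a set that no edge crosses; conversely, the set of vertices reachable from
`x` is crossed by no edge. -/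
theorem reachable_iff_spans {G : SimpleGraph V} {x y : V} :
    G.Reachable x y ↔ Spans ⊥ id G.edgeSet s(x, y) := by
  constructor
  · rintro ⟨p⟩ S _ hS
    rw [cuts_mk, not_not]
    induction p with
    | nil => rfl
    | cons h _ ih =>
      have := hS _ (SimpleGraph.mem_edgeSet G |>.2 h)
      rw [id, cuts_mk, not_not] at this
      exact this.trans ih
  · intro h
    have := h {z | G.Reachable x z} (saturated_bot _) (fun e he => by
      induction e with
      | _ a b =>
        have hab : G.Adj a b := he
        rw [id, cuts_mk, not_not]
        exact ⟨fun h => h.trans hab.reachable, fun h => h.trans hab.symm.reachable⟩)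
    rw [cuts_mk, not_not] at this
    exact this.1 (SimpleGraph.Reachable.refl x)

theorem not_cuts_of_isDiag {S : Set V} {e : Sym2 V} (h : e.IsDiag) : ¬ Cuts S e := by
  induction e with
  | _ x y =>
    have h' : x = y := h
    rw [cuts_mk, h']; simp

theorem spans_fromEdgeSet {r : Setoid V} {ω : Set (Sym2 V)} {e : Sym2 V} :
    Spans r id (SimpleGraph.fromEdgeSet ω).edgeSet e ↔ Spans r id ω e := by
  rw [SimpleGraph.edgeSet_fromEdgeSet]
  constructor
  · exact fun h => h.mono le_rfl Set.sdiff_subset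
  · intro h
    refine h.trans fun f hf => ?_
    by_cases hd : f.IsDiag
    · exact fun S _ _ => not_cuts_of_isDiag hd
    · exact spans_of_mem ⟨hf, hd⟩

theorem reachable_fromEdgeSet_iff_spans {ω : Set (Sym2 V)} {x y : V} :
    (SimpleGraph.fromEdgeSet ω).Reachable x y ↔ Spans ⊥ id ω s(x, y) := by
  rw [reachable_iff_spans, spans_fromEdgeSet]

theorem isTree_iff_spans {G : SimpleGraph V} :
    G.IsTree ↔ Nonempty V ∧ (∀ x y, Spans ⊥ id G.edgeSet s(x, y)) ∧
      ∀ e ∈ G.edgeSet, ¬ Spans ⊥ id (G.edgeSet \ {e}) e := by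
  rw [SimpleGraph.isTree_iff, SimpleGraph.connected_iff, SimpleGraph.isAcyclic_iff_forall_isBridge,
    and_comm (b := Nonempty V), and_assoc]
  refine and_congr Iff.rfl (and_congr ?_ ?_)
  · exact forall₂_congr fun x y => reachable_iff_spans
  · refine forall₂_congr fun e _ => ?_
    induction e with
    | _ x y =>
      rw [SimpleGraph.isBridge_iff, reachable_iff_spans, SimpleGraph.edgeSet_deleteEdges]

theorem cuts_map {W : Type v} {j : W → V} {S : Set V} {e : Sym2 W} :
    Cuts S (e.map j) ↔ Cuts (j ⁻¹' S) e := by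
  induction e with
  | _ x y => rw [Sym2.map_mk, cuts_mk, cuts_mk]; rfl

/-- Connectivity is preserved by maps along which saturated sets can be pulled back and extended. -/
theorem spans_map_iff {W : Type v} {j : W → V} {r : Setoid V} {s : Setoid W}
    (hres : ∀ S, Saturated r S → Saturated s (j ⁻¹' S))
    (hext : ∀ S', Saturated s S' → ∃ S, Saturated r S ∧ j ⁻¹' S = S') {T : Set (Sym2 W)}
    {e : Sym2 W} :
    Spans r id (Sym2.map j '' T) (e.map j) ↔ Spans s id T e := by
  constructor
  · intro h S' hS' hT
    obtain ⟨S, hS, rfl⟩ := hext S' hS'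
    rw [← cuts_map]
    refine h S hS ?_
    rintro _ ⟨f, hf, rfl⟩
    rw [id, cuts_map]
    exact hT f hf
  · intro h S hS hT
    rw [cuts_map]
    refine h _ (hres S hS) fun f hf => ?_
    rw [id, ← cuts_map]
    exact hT _ ⟨f, hf, rfl⟩

theorem spans_map_bot_iff {W : Type v} {j : W → V} (hj : Function.Injective j) {T : Set (Sym2 W)}
    {e : Sym2 W} :
    Spans (⊥ : Setoid V) id (Sym2.map j '' T) (e.map j) ↔ Spans (⊥ : Setoid W) id T e :=
  spans_map_iff (fun _ _ => saturated_bot _)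
    fun S' _ => ⟨j '' S', saturated_bot _, Set.preimage_image_eq S' hj⟩

theorem spans_map_quotient_iff {r : Setoid V} {T : Set (Sym2 V)} {e : Sym2 V} :
    Spans (⊥ : Setoid (Quotient r)) id (Sym2.map (Quotient.mk r) '' T) (e.map (Quotient.mk r)) ↔
      Spans r id T e := by
  refine spans_map_iff (fun S _ x y hxy => ?_) fun S' hS' => ⟨Quotient.mk r '' S',
    saturated_bot _, ?_⟩
  · rw [Set.mem_preimage, Set.mem_preimage, Quotient.sound hxy]
  · ext x
    constructor
    · rintro ⟨y, hy, hxy⟩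
      exact (hS' y x (Quotient.exact hxy)).1 hy
    · exact fun hx => ⟨x, hx, rfl⟩

end Connectivity

/-! ### Spanning trees as matroid bases -/

section SpanningTrees

variable {V : Type u} {G : SimpleGraph V}

theorem edgeSet_finite_of_verts {H : G.Subgraph} (h : H.verts.Finite) : H.edgeSet.Finite := by
  refine ((h.prod h).image fun z : V × V => s(z.1, z.2)).subset ?_
  intro e he
  induction e with
  | _ x y =>
    have hxy : H.Adj x y := he
    exact ⟨(x, y), ⟨H.edge_vert hxy, H.edge_vert hxy.symm⟩, rfl⟩

theorem isTree_coe_iff {S : G.Subgraph} :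
    S.coe.IsTree ↔ S.verts.Nonempty ∧
      (∀ x ∈ S.verts, ∀ y ∈ S.verts, Spans ⊥ id S.edgeSet s(x, y)) ∧
      ∀ e ∈ S.edgeSet, ¬ Spans ⊥ id (S.edgeSet \ {e}) e := by
  have hinj : Function.Injective (Sym2.map (Subtype.val : S.verts → V)) :=
    Sym2.map.injective Subtype.val_injective
  have himg : Sym2.map (Subtype.val : S.verts → V) '' S.coe.edgeSet = S.edgeSet :=
    S.image_coe_edgeSet_coe
  rw [isTree_iff_spans, Set.nonempty_coe_sort, ← himg]
  refine and_congr Iff.rfl (and_congr ?_ ?_)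
  · constructor
    · intro h x hx y hy
      exact (spans_map_bot_iff Subtype.val_injective).2 (h ⟨x, hx⟩ ⟨y, hy⟩)
    · intro h x y
      exact (spans_map_bot_iff Subtype.val_injective (e := s(x, y))).1 (h x x.2 y y.2)
  · rw [Set.forall_mem_image]
    refine forall₂_congr fun e _ => ?_
    rw [← Set.image_singleton, ← Set.image_sdiff hinj,
      spans_map_bot_iff Subtype.val_injective]

/-- The spanning trees of a finite connected subgraph are the bases of its edge set. -/
theorem spanningTrees_eq {H : G.Subgraph} (hfin : H.verts.Finite) (hH : H.Connected) :
    spanningTrees H = (fun T : Finset (Sym2 V) => (T : Set (Sym2 V))) ''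
      (bases ⊥ id (finsetOf H.edgeSet) : Finset (Finset (Sym2 V))) := by
  have hE := coe_finsetOf (edgeSet_finite_of_verts hfin)
  have hHspans : ∀ x ∈ H.verts, ∀ y ∈ H.verts, Spans ⊥ id H.edgeSet s(x, y) := by
    intro x hx y hy
    have := (SimpleGraph.Subgraph.connected_iff'.1 hH).preconnected ⟨x, hx⟩ ⟨y, hy⟩
    rw [reachable_iff_spans, ← spans_map_bot_iff Subtype.val_injective,
      H.image_coe_edgeSet_coe] at this
    exact this
  ext T
  constructor
  · rintro ⟨S, hSH, hv, htree, rfl⟩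
    rw [isTree_coe_iff] at htree
    obtain ⟨-, hcon, hacyc⟩ := htree
    have hsub : S.edgeSet ⊆ H.edgeSet := SimpleGraph.Subgraph.edgeSet_mono hSH
    have hSfin : S.edgeSet.Finite := (edgeSet_finite_of_verts hfin).subset hsub
    refine ⟨finsetOf S.edgeSet, ?_, coe_finsetOf hSfin⟩
    rw [Finset.mem_coe, mem_bases]
    refine ⟨?_, fun e he => ?_, fun e he => ?_⟩
    · rw [← Finset.coe_subset, hE, coe_finsetOf hSfin]
      exact hsub
    · rw [mem_finsetOf (edgeSet_finite_of_verts hfin)] at he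
      rw [coe_finsetOf hSfin]
      induction e with
      | _ x y =>
        have hxy : H.Adj x y := he
        exact hcon x (hv ▸ H.edge_vert hxy) y (hv ▸ H.edge_vert hxy.symm)
    · rw [coe_finsetOf hSfin]
      exact hacyc e ((mem_finsetOf hSfin).1 he)
  · rintro ⟨T, hT, rfl⟩
    rw [Finset.mem_coe, mem_bases] at hT
    have hsub : (T : Set (Sym2 V)) ⊆ H.edgeSet := by
      rw [← hE]; exact_mod_cast hT.subset
    let S : G.Subgraph :=
      { verts := H.verts
        Adj := fun x y => s(x, y) ∈ T
        adj_sub := fun {x y} h => H.adj_sub (hsub h)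
        edge_vert := fun {x y} h => H.edge_vert (hsub h)
        symm := ⟨fun x y h => by rwa [Sym2.eq_swap]⟩ }
    have hSE : S.edgeSet = T := by
      ext e
      induction e with
      | _ x y => exact Iff.rfl
    refine ⟨S, ⟨subset_rfl, fun x y h => hsub h⟩, rfl, ?_, hSE⟩
    rw [isTree_coe_iff, hSE]
    refine ⟨hH.nonempty, fun x hx y hy => (hHspans x hx y hy).trans fun e he => ?_, hT.indep⟩
    exact hT.spans e ((mem_finsetOf (edgeSet_finite_of_verts hfin)).2 he)

/-- The spanning trees of a wired graph are the bases of its edge set. -/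
theorem wiredSpanningTrees_eq (hG : G.Connected) (hloc : ∀ v, (G.neighborSet v).Finite)
    {H : G.Subgraph} {B : Finset V} (hB : H.verts = B) :
    wiredSpanningTrees H
      = (fun T : Finset (Sym2 V) => (T : Set (Sym2 V))) '' (wiredBases G B : Set _) := by
  have hfin := touching_finite hloc B.finite_toSet
  set r := wiredSetoid (B : Set V) with hr
  have hmap : ∀ e : Sym2 V, wiredEdge (B : Set V) e = Sym2.map (Quotient.mk r) e := fun e => rfl
  have hdiag : ∀ e : Sym2 V, (wiredEdge (B : Set V) e).IsDiag → Spans r (id : Sym2 V → Sym2 V) ∅ e := by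
    intro e he
    induction e with
    | _ x y =>
      have : Quotient.mk r x = Quotient.mk r y := he
      exact spans_empty_of_rel (Quotient.exact this)
  have hspans : ∀ (T : Set (Sym2 V)) e, Spans (⊥ : Setoid (Quotient r)) id
      (SimpleGraph.fromEdgeSet (wiredEdge (B : Set V) '' T)).edgeSet (wiredEdge (B : Set V) e) ↔
        Spans r id T e := by
    intro T e
    rw [spans_fromEdgeSet]
    exact spans_map_quotient_iff
  have hedges : ∀ T : Set (Sym2 V), (∀ e ∈ T, ¬ (wiredEdge (B : Set V) e).IsDiag) →
      (SimpleGraph.fromEdgeSet (wiredEdge (B : Set V) '' T)).edgeSet = wiredEdge (B : Set V) '' T := by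
    intro T hT
    rw [SimpleGraph.edgeSet_fromEdgeSet, _root_.sdiff_eq_left, Set.disjoint_left]
    rintro _ ⟨e, he, rfl⟩ hd
    exact hT e he hd
  have hindep : ∀ T : Set (Sym2 V), (∀ e ∈ T, ¬ (wiredEdge (B : Set V) e).IsDiag) →
      Set.InjOn (wiredEdge (B : Set V)) T → ∀ e ∈ T,
      (Spans (⊥ : Setoid (Quotient r)) id
        ((SimpleGraph.fromEdgeSet (wiredEdge (B : Set V) '' T)).edgeSet \ {wiredEdge (B : Set V) e})
        (wiredEdge (B : Set V) e) ↔ Spans r id (T \ {e}) e) := by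
    intro T hT hinj e he
    rw [hedges T hT, ← Set.image_singleton,
      ← hinj.image_sdiff_subset (Set.singleton_subset_iff.2 he)]
    exact spans_map_quotient_iff
  ext T
  rw [wiredSpanningTrees, hB]
  constructor
  · rintro ⟨hTG, hT, hinj, htree⟩
    rw [isTree_iff_spans] at htree
    obtain ⟨-, hcon, hacyc⟩ := htree
    have hsub : T ⊆ touching G B := by
      intro e he
      refine ⟨hTG he, ?_⟩
      by_contra hno
      push Not at hno
      refine hT e he ?_
      induction e with
      | _ x y =>
        exact Quotient.sound (Or.inr ⟨fun h => hno x h (by simp), fun h => hno y h (by simp)⟩)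
    have hTfin := hfin.subset hsub
    refine ⟨finsetOf T, ?_, coe_finsetOf hTfin⟩
    rw [Finset.mem_coe, wiredBases, mem_bases]
    refine ⟨?_, fun e he => ?_, fun e he => ?_⟩
    · rw [← Finset.coe_subset, coe_finsetOf hfin, coe_finsetOf hTfin]
      exact hsub
    · rw [coe_finsetOf hTfin, id, ← hspans T]
      induction e with
      | _ x y => exact hcon _ _
    · rw [mem_finsetOf hTfin] at he
      rw [coe_finsetOf hTfin, id, ← hindep T hT hinj e he]
      refine hacyc _ ?_
      rw [hedges T hT]
      exact ⟨e, he, rfl⟩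
  · rintro ⟨T, hT, rfl⟩
    rw [Finset.mem_coe, wiredBases, mem_bases] at hT
    have hsub : (T : Set (Sym2 V)) ⊆ touching G B := by
      rw [← coe_finsetOf hfin]; exact_mod_cast hT.subset
    have hloop : ∀ e ∈ (T : Set (Sym2 V)), ¬ (wiredEdge (B : Set V) e).IsDiag := fun e he hd =>
      hT.indep e he ((hdiag e hd).mono le_rfl (Set.empty_subset _))
    -- Parallel edges span each other, so an independent set contains at most one edge of each
    -- parallel class.
    have hinj : Set.InjOn (wiredEdge (B : Set V)) T := by
      intro e he f hf hef
      by_contra hne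
      refine hT.indep e he ?_
      have : Spans r id ((T : Set (Sym2 V)) \ {e}) f := spans_of_mem ⟨hf, fun h => hne h.symm⟩
      rw [← hspans] at this ⊢
      rw [id, hef]
      exact this
    refine ⟨fun e he => (hsub he).1, hloop, hinj, ?_⟩
    rw [isTree_iff_spans]
    refine ⟨hG.nonempty.map (Quotient.mk r), fun x y => ?_, fun e he => ?_⟩
    · induction x using Quotient.inductionOn with
      | _ x =>
      induction y using Quotient.inductionOn with
      | _ y =>
        have h1 : Spans r id (T : Set (Sym2 V)) s(x, y) := by
          have h2 := reachable_iff_spans.1 (hG.preconnected x y)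
          refine (h2.mono bot_le subset_rfl).trans fun e he => ?_
          by_cases het : e ∈ touching G B
          · exact hT.spans e ((mem_finsetOf hfin).2 het)
          · exact (spans_wiredSetoid_of_not_touching fun z hz hzB => het ⟨he, z, hzB, hz⟩).mono
              le_rfl (Set.empty_subset _)
        rw [← hspans] at h1
        exact h1
    · rw [hedges _ hloop] at he
      obtain ⟨e, he, rfl⟩ := he
      rw [hindep _ hloop hinj e he]
      exact hT.indep e he

end SpanningTrees

/-! ### Existence and uniqueness of the forest measures -/

section Existence

variable {V : Type u} {G : SimpleGraph V}

theorem exists_isExhaustion [Countable V] (hG : G.Connected) :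
    ∃ Gs : ℕ → G.Subgraph, IsExhaustion Gs ∧ ∀ n, (Gs n).IsInduced := by
  classical
  have := hG.nonempty
  obtain ⟨f, hf⟩ := exists_surjective_nat V
  have hext : ∀ t : Finset V, t.Nonempty → ∃ t' : Finset V, t ⊆ t' ∧
      (G.induce (t' : Set V)).Connected := fun t ht =>
    SimpleGraph.extend_finset_to_connected hG.preconnected ht
  choose! ext hext using hext
  obtain ⟨B, hB0, hBs⟩ : ∃ B : ℕ → Finset V, B 0 = ext {f 0} ∧
      ∀ n, B (n + 1) = ext (insert (f (n + 1)) (B n)) :=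
    ⟨fun n => Nat.rec (ext {f 0}) (fun n b => ext (insert (f (n + 1)) b)) n, rfl, fun _ => rfl⟩
  have hfB : ∀ n, f n ∈ B n := by
    intro n
    cases n with
    | zero => rw [hB0]; exact (hext _ (Finset.singleton_nonempty _)).1 (Finset.mem_singleton_self _)
    | succ n => rw [hBs]; exact (hext _ (Finset.insert_nonempty _ _)).1 (Finset.mem_insert_self _ _)
  have hconn : ∀ n, (G.induce (B n : Set V)).Connected := by
    intro n
    cases n with
    | zero => rw [hB0]; exact (hext _ (Finset.singleton_nonempty _)).2
    | succ n => rw [hBs]; exact (hext _ (Finset.insert_nonempty _ _)).2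
  have hmono : Monotone B := monotone_nat_of_le_succ fun n =>
    hBs n ▸ (Finset.subset_insert _ _).trans (hext _ (Finset.insert_nonempty _ _)).1
  refine ⟨fun n => (⊤ : G.Subgraph).induce (B n : Set V), ⟨fun n => (B n).finite_toSet, fun n => ?_,
    fun m n hmn => SimpleGraph.Subgraph.induce_mono_right (by exact_mod_cast hmono hmn), ?_⟩,
    fun n => ?_⟩
  · exact SimpleGraph.connected_induce_iff.1 (hconn n)
  · refine top_unique ⟨fun x _ => ?_, fun x y hxy => ?_⟩
    · obtain ⟨n, rfl⟩ := hf x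
      rw [SimpleGraph.Subgraph.verts_iSup]
      exact Set.mem_iUnion.2 ⟨n, hfB n⟩
    · obtain ⟨m, rfl⟩ := hf x
      obtain ⟨n, rfl⟩ := hf y
      rw [SimpleGraph.Subgraph.iSup_adj]
      exact ⟨max m n, hmono (le_max_left m n) (hfB m), hmono (le_max_right m n) (hfB n), hxy⟩
  · intro x hx y hy hxy
    exact ⟨hx, hy, hxy⟩

theorem isLocal_cylinderEvent (K A : Finset (Sym2 V)) :
    IsLocal K ((cylinderEvent K A).indicator 1) := by
  intro ω
  have : ω ∩ K ∈ cylinderEvent K A ↔ ω ∈ cylinderEvent K A := by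
    simp only [cylinderEvent, Set.mem_ofPred_eq, Set.inter_assoc, Set.inter_self]
  by_cases h : ω ∈ cylinderEvent K A
  · rw [Set.indicator_of_mem h, Set.indicator_of_mem (this.2 h)]; rfl
  · rw [Set.indicator_of_notMem h, Set.indicator_of_notMem fun h' => h (this.1 h')]

theorem ConvergesTo.tendsto_cylinderEvent {β : Type*} {l : Filter β}
    {𝓑 : β → Finset (Finset (Sym2 V))} {μ : Measure (Set (Sym2 V))} [IsFiniteMeasure μ]
    (h : ConvergesTo l 𝓑 μ) (K A : Finset (Sym2 V)) :
    Tendsto (fun n => average (𝓑 n) fun T => (cylinderEvent K A).indicator 1 (T : Set (Sym2 V))) l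
      (𝓝 (μ.real (cylinderEvent K A))) := by
  have := h.tendsto_average (isLocal_cylinderEvent K A)
  rwa [integral_indicator_one (s := cylinderEvent K A) (measurableSet_inter_eq K A)] at this

theorem cylinderEvent_self (A : Finset (Sym2 V)) : cylinderEvent A A = containing A := by
  ext ω
  simp only [cylinderEvent, Set.mem_ofPred_eq, Set.inter_eq_right, containing]

theorem IsExhaustion.eventually_mem_verts {Gs : ℕ → G.Subgraph} (h : IsExhaustion Gs) (x : V) :
    ∀ᶠ n in atTop, x ∈ (Gs n).verts := by
  have hx : x ∈ (⨆ n, Gs n).verts := by rw [h.iSup_eq_top]; trivial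
  rw [SimpleGraph.Subgraph.verts_iSup] at hx
  obtain ⟨m, hm⟩ := Set.mem_iUnion.1 hx
  filter_upwards [eventually_ge_atTop m] with n hn
  exact (h.mono hn).1 hm

theorem IsExhaustion.eventually_mem_edgeSet {Gs : ℕ → G.Subgraph} (h : IsExhaustion Gs) {e : Sym2 V}
    (he : e ∈ G.edgeSet) : ∀ᶠ n in atTop, e ∈ (Gs n).edgeSet := by
  induction e with
  | _ x y =>
    have hx : (⨆ n, Gs n).Adj x y := by rw [h.iSup_eq_top]; exact he
    rw [SimpleGraph.Subgraph.iSup_adj] at hx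
    obtain ⟨m, hm⟩ := hx
    filter_upwards [eventually_ge_atTop m] with n hn
    exact (h.mono hn).2 hm

theorem IsFreeLimit.isFSF {μ : Measure (Set (Sym2 V))} [IsProbabilityMeasure μ]
    (h : IsFreeLimit G μ) : IsFSF G μ := by
  refine ⟨inferInstance, fun Gs hGs K A => ?_⟩
  have hfin := fun n => edgeSet_finite_of_verts (hGs.finite n)
  have hc := h.convergesTo (l := atTop) (E := fun n => finsetOf (Gs n).edgeSet)
    (fun n => by rw [coe_finsetOf (hfin n)]; exact (Gs n).edgeSet_subset)
    fun e he => (hGs.eventually_mem_edgeSet he).mono fun n hn => (mem_finsetOf (hfin n)).2 hn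
  refine (hc.tendsto_cylinderEvent K A).congr fun n => ?_
  rw [spanningTrees_eq (hGs.finite n) (hGs.connected n), uniformProb_image_coe]

theorem IsWiredLimit.isWSF (hG : G.Connected) (hloc : ∀ v, (G.neighborSet v).Finite)
    {μ : Measure (Set (Sym2 V))} [IsProbabilityMeasure μ] (h : IsWiredLimit G μ) : IsWSF G μ := by
  classical
  refine ⟨inferInstance, fun Gs hGs _ K A => ?_⟩
  have hlim : Tendsto (fun n => finsetOf (Gs n).verts) atTop atTop := by
    refine tendsto_atTop_finset_of_monotone (fun m n hmn => ?_) fun x => ?_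
    · rw [← Finset.coe_subset, coe_finsetOf (hGs.finite m),
        coe_finsetOf (hGs.finite n)]
      exact (hGs.mono hmn).1
    · obtain ⟨n, hn⟩ := (hGs.eventually_mem_verts x).exists
      exact ⟨n, (mem_finsetOf (hGs.finite n)).2 hn⟩
  refine ((ConvergesTo.comp h hlim).tendsto_cylinderEvent K A).congr fun n => ?_
  rw [wiredSpanningTrees_eq hG hloc (coe_finsetOf (hGs.finite n)).symm, uniformProb_image_coe]

/-- `FSF` is obtained by choice. A single exhaustion already determines all containment
probabilities, so the chosen measure is the limit constructed here and the default value is never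
taken. -/
theorem isFreeLimit_FSF [Countable V] (hG : G.Connected) : IsFreeLimit G (FSF G) := by
  obtain ⟨μ, hμ, hlim⟩ := exists_isFreeLimit G
  have hex : ∃ μ, IsFSF G μ := ⟨μ, hlim.isFSF⟩
  have hF : IsFSF G (FSF G) := by
    rw [FSF, dif_pos hex]
    exact hex.choose_spec
  obtain ⟨Gs, hGs, -⟩ := exists_isExhaustion hG
  have : FSF G = μ := measure_ext_containing fun A => by
    rw [← cylinderEvent_self]
    exact tendsto_nhds_unique (hF.tendsto Gs hGs A A) (hlim.isFSF.tendsto Gs hGs A A)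
  rw [this]
  exact hlim

theorem isWiredLimit_WSF [Countable V] (hG : G.Connected)
    (hloc : ∀ v, (G.neighborSet v).Finite) : IsWiredLimit G (WSF G) := by
  obtain ⟨μ, hμ, hlim⟩ := exists_isWiredLimit hloc
  have hex : ∃ μ, IsWSF G μ := ⟨μ, hlim.isWSF hG hloc⟩
  have hW : IsWSF G (WSF G) := by
    rw [WSF, dif_pos hex]
    exact hex.choose_spec
  obtain ⟨Gs, hGs, hind⟩ := exists_isExhaustion hG
  have : WSF G = μ := measure_ext_containing fun A => by
    rw [← cylinderEvent_self]
    exact tendsto_nhds_unique (hW.tendsto Gs hGs hind A A)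
      ((hlim.isWSF hG hloc).tendsto Gs hGs hind A A)
  rw [this]
  exact hlim

end Existence

/-! ### The wired vertex as a cut vertex -/

section Separation

variable {V : Type u}

theorem wiredSetoid_univ : wiredSetoid (Set.univ : Set V) = ⊥ := by
  ext x y
  constructor
  · rintro (h | ⟨h, -⟩)
    · exact h
    · exact absurd trivial h
  · exact fun h => Or.inl h

theorem saturated_wiredSetoid_of_disjoint {B S : Set V} (h : ∀ x ∈ S, x ∈ B) :
    Saturated (wiredSetoid B) S := by
  rintro x y (rfl | ⟨hx, hy⟩)
  · rfl
  · exact iff_of_false (fun h' => hx (h x h')) fun h' => hy (h y h')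

/-- Up to complement, a set that is saturated for a wired graph avoids the wired vertices. -/
theorem Saturated.subset_or_compl_subset {B S : Set V} (h : Saturated (wiredSetoid B) S) :
    (∀ x ∈ S, x ∈ B) ∨ ∀ x ∈ Sᶜ, x ∈ B := by
  by_contra hcon
  push Not at hcon
  obtain ⟨⟨x, hx, hxB⟩, y, hy, hyB⟩ := hcon
  exact hy ((h x y (Or.inr ⟨hxB, hyB⟩)).1 hx)

/-- A saturated set can be modified so that it cuts no edges outside `U`. -/
theorem exists_saturated_localized {B S : Set V} (U : Set V) (h : Saturated (wiredSetoid B) S) :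
    ∃ S', Saturated (wiredSetoid B) S' ∧
      (∀ e : Sym2 V, (∀ x ∈ e, x ∈ U) → (Cuts S' e ↔ Cuts S e)) ∧
      ∀ e : Sym2 V, (∀ x ∈ e, x ∉ U) → ¬ Cuts S' e := by
  have key : ∀ S : Set V, (∀ x ∈ S, x ∈ B) → ∃ S', Saturated (wiredSetoid B) S' ∧
      (∀ e : Sym2 V, (∀ x ∈ e, x ∈ U) → (Cuts S' e ↔ Cuts S e)) ∧
      ∀ e : Sym2 V, (∀ x ∈ e, x ∉ U) → ¬ Cuts S' e := by
    intro S hS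
    -- A side contained in `B` avoids the wired vertex, so it may be intersected with any set and
    -- stays saturated.
    refine ⟨S ∩ U, saturated_wiredSetoid_of_disjoint fun x hx => hS x hx.1, fun e he => ?_,
      fun e he => ?_⟩
    · induction e with
      | _ x y =>
        have hx := he x (by simp)
        have hy := he y (by simp)
        simp [cuts_mk, hx, hy]
    · induction e with
      | _ x y =>
        have hx := he x (by simp)
        have hy := he y (by simp)
        simp [cuts_mk, hx, hy]
  rcases h.subset_or_compl_subset with h' | h'
  · exact key S h'
  · obtain ⟨S', h1, h2, h3⟩ := key Sᶜ h'
    exact ⟨S', h1, fun e he => (h2 e he).trans cuts_compl, h3⟩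

/-- Edges outside `U` can touch those inside only at the wired vertex, so they cannot help to
connect endpoints in `U`. Applied to a component, this makes the wired matroid a direct sum over
components. -/
theorem Spans.of_union_separated {ι : Type v} {q : ι → Sym2 V} {B U : Set V} {T₁ T₂ : Set ι} {i : ι}
    (h : Spans (wiredSetoid B) q (T₁ ∪ T₂) (q i)) (h₁ : ∀ k ∈ T₁, ∀ x ∈ q k, x ∈ U)
    (h₂ : ∀ k ∈ T₂, ∀ x ∈ q k, x ∉ U) (hi : ∀ x ∈ q i, x ∈ U) :
    Spans (wiredSetoid B) q T₁ (q i) := by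
  intro S hS hST
  obtain ⟨S', hS', hin, hout⟩ := exists_saturated_localized U hS
  rw [← hin _ hi]
  refine h S' hS' ?_
  rintro k (hk | hk)
  · rw [hin _ (h₁ k hk)]; exact hST k hk
  · exact hout _ (h₂ k hk)

theorem spans_map_wired_iff {W : Type v} {j : W → V} (hj : Function.Injective j) {B : Set V}
    {T : Set (Sym2 W)} {e : Sym2 W} :
    Spans (wiredSetoid B) id (Sym2.map j '' T) (e.map j) ↔
      Spans (wiredSetoid (j ⁻¹' B)) id T e := by
  refine spans_map_iff ?_ ?_
  · rintro S hS x y (rfl | hxy)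
    · rfl
    · exact hS _ _ (Or.inr hxy)
  · intro S' hS'
    have key : ∀ S' : Set W, (∀ x ∈ S', x ∈ j ⁻¹' B) →
        ∃ S, Saturated (wiredSetoid B) S ∧ j ⁻¹' S = S' := fun S' h =>
      ⟨j '' S', saturated_wiredSetoid_of_disjoint (by rintro _ ⟨x, hx, rfl⟩; exact h x hx),
        Set.preimage_image_eq S' hj⟩
    rcases hS'.subset_or_compl_subset with h | h
    · exact key S' h
    · obtain ⟨S, hS, hSS⟩ := key S'ᶜ h
      exact ⟨Sᶜ, hS.compl, by rw [Set.preimage_compl, hSS, compl_compl]⟩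

end Separation

/-! ### Factorisation over connected components -/

section Components

variable {V : Type u} {H : SimpleGraph V}

/-- The edges of a component as edges of the whole graph. -/
def compEmb (C : H.ConnectedComponent) : Sym2 C ↪ Sym2 V :=
  ⟨Sym2.map (↑), Sym2.map.injective Subtype.val_injective⟩

theorem mem_range_compEmb {C : H.ConnectedComponent} {e : Sym2 V} :
    (∃ e', compEmb C e' = e) ↔ ∀ x ∈ e, H.connectedComponentMk x = C := by
  induction e with
  | _ x y =>
    simp only [Sym2.mem_iff, forall_eq_or_imp, forall_eq]
    constructor
    · rintro ⟨e', he'⟩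
      induction e' with
      | _ a b =>
        have h1 : s((a : V), (b : V)) = s(x, y) := he'
        rcases Sym2.eq_iff.1 h1 with ⟨rfl, rfl⟩ | ⟨rfl, rfl⟩
        · exact ⟨a.2, b.2⟩
        · exact ⟨b.2, a.2⟩
    · rintro ⟨hx, hy⟩
      exact ⟨s(⟨x, hx⟩, ⟨y, hy⟩), rfl⟩

/-- The component of (an endpoint of) an edge. -/
def compOf (H : SimpleGraph V) (e : Sym2 V) : H.ConnectedComponent :=
  H.connectedComponentMk (Quot.out e).1

theorem out_fst_mem (e : Sym2 V) : (Quot.out e).1 ∈ e := by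
  have h : s((Quot.out e).1, (Quot.out e).2) = e := Quot.out_eq e
  have h' := Sym2.mem_mk_left (Quot.out e).1 (Quot.out e).2
  rwa [h] at h'

theorem connectedComponentMk_eq_compOf {e : Sym2 V} (he : e ∈ H.edgeSet) {x : V} (hx : x ∈ e) :
    H.connectedComponentMk x = compOf H e := by
  have key : ∀ y ∈ e, H.connectedComponentMk x = H.connectedComponentMk y := by
    intro y hy
    induction e with
    | _ a b =>
      have hab : H.Adj a b := he
      have := SimpleGraph.ConnectedComponent.eq.2 hab.reachable
      rw [Sym2.mem_iff] at hx hy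
      rcases hx with rfl | rfl <;> rcases hy with rfl | rfl <;> simp [this]
  exact key _ (out_fst_mem e)

theorem compOf_eq_iff {e : Sym2 V} (he : e ∈ H.edgeSet) {C : H.ConnectedComponent} :
    compOf H e = C ↔ ∃ e', compEmb C e' = e := by
  rw [mem_range_compEmb]
  constructor
  · rintro rfl x hx
    exact connectedComponentMk_eq_compOf he hx
  · intro h
    exact h _ (out_fst_mem e)

theorem compEmb_disjoint {C C' : H.ConnectedComponent} {e : Sym2 C} {e' : Sym2 C'}
    (h : compEmb C e = compEmb C' e') : C = C' := by
  have h1 := mem_range_compEmb.1 ⟨e, rfl⟩ _ (out_fst_mem (compEmb C e))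
  have h2 := mem_range_compEmb.1 ⟨e', h.symm⟩ _ (out_fst_mem (compEmb C e))
  exact h1.symm.trans h2

theorem compEmb_mem_edgeSet {C : H.ConnectedComponent} {e : Sym2 C} :
    compEmb C e ∈ H.edgeSet ↔ e ∈ C.toSimpleGraph.edgeSet := by
  induction e with
  | _ x y => exact Iff.rfl

/-- The restriction of a finite set of edges to a component. -/
def restr (C : H.ConnectedComponent) (E : Finset (Sym2 V)) : Finset (Sym2 C) :=
  E.preimage (compEmb C) (compEmb C).injective.injOn

theorem mem_restr {C : H.ConnectedComponent} {E : Finset (Sym2 V)} {e : Sym2 C} :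
    e ∈ restr C E ↔ compEmb C e ∈ E := by simp [restr]

theorem map_restr [DecidableEq H.ConnectedComponent] {E : Finset (Sym2 V)} (hE : ↑E ⊆ H.edgeSet)
    (C : H.ConnectedComponent) :
    (restr C E).map (compEmb C) = E.filter fun e => compOf H e = C := by
  ext e
  rw [Finset.mem_map, Finset.mem_filter]
  constructor
  · rintro ⟨e', he', rfl⟩
    rw [mem_restr] at he'
    exact ⟨he', (compOf_eq_iff (hE he')).2 ⟨e', rfl⟩⟩
  · rintro ⟨he, hC⟩
    obtain ⟨e', rfl⟩ := (compOf_eq_iff (hE he)).1 hC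
    exact ⟨e', mem_restr.2 he, rfl⟩

theorem indicator_containing_map {α β : Type*} (j : α ↪ β) (A T : Finset α) :
    (containing (A.map j)).indicator (1 : Set β → ℝ) ((T.map j : Finset β) : Set β)
      = (containing A).indicator 1 (T : Set α) := by
  have : ((T.map j : Finset β) : Set β) ∈ containing (A.map j) ↔ (T : Set α) ∈ containing A := by
    simp only [mem_containing, Finset.coe_subset, Finset.map_subset_map]
  by_cases h : (T : Set α) ∈ containing A
  · rw [Set.indicator_of_mem h, Set.indicator_of_mem (this.2 h)]; rfl
  · rw [Set.indicator_of_notMem h, Set.indicator_of_notMem fun h' => h (this.1 h')]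

/-- The average of an indicator over the bases inside a component. -/
theorem average_bases_component [DecidableEq H.ConnectedComponent] (B : Set V)
    {E A : Finset (Sym2 V)} (hE : ↑E ⊆ H.edgeSet) (hA : ↑A ⊆ H.edgeSet) (C : H.ConnectedComponent) :
    average (bases (wiredSetoid B) id (E.filter fun e => compOf H e = C))
        (fun T => (containing (A.filter fun e => compOf H e = C)).indicator 1 (T : Set (Sym2 V)))
      = average (bases (wiredSetoid ((↑) ⁻¹' B : Set C)) id (restr C E))
        (fun T => (containing (restr C A)).indicator 1 (T : Set (Sym2 C))) := by
  classical
  rw [← map_restr hE, ← map_restr hA, average_bases_map (r := wiredSetoid ((↑) ⁻¹' B : Set C))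
    (q := id) (s := wiredSetoid B) (p := id) (compEmb C)]
  · exact average_congr rfl fun T _ => indicator_containing_map _ _ _
  · intro T _ e _
    rw [Finset.coe_map]
    exact (spans_map_wired_iff Subtype.val_injective).symm

/-- A uniform basis restricts to independent uniform bases on the components. -/
theorem average_bases_eq_prod_filter [DecidableEq H.ConnectedComponent] [DecidableEq (Sym2 V)]
    (B : Set V) {E A : Finset (Sym2 V)} (hE : ↑E ⊆ H.edgeSet) (𝒟 : Finset H.ConnectedComponent) :
    average (bases (wiredSetoid B) id (E.filter fun e => compOf H e ∈ 𝒟))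
        (fun T => (containing (A.filter fun e => compOf H e ∈ 𝒟)).indicator 1 (T : Set (Sym2 V)))
      = ∏ C ∈ 𝒟, average (bases (wiredSetoid B) id (E.filter fun e => compOf H e = C))
        (fun T => (containing (A.filter fun e => compOf H e = C)).indicator 1
          (T : Set (Sym2 V))) := by
  induction 𝒟 using Finset.induction_on with
  | empty =>
    rw [Finset.prod_empty]
    simp only [Finset.notMem_empty, Finset.filter_false, containing_empty, Set.indicator_univ]
    exact average_const (bases_nonempty _ _ _) 1
  | insert C 𝒟 hC ih =>
    rw [Finset.prod_insert hC, ← ih]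
    set E₁ := E.filter fun e => compOf H e = C
    set E₂ := E.filter fun e => compOf H e ∈ 𝒟
    have hEu : E.filter (fun e => compOf H e ∈ insert C 𝒟) = E₁ ∪ E₂ := by
      rw [← Finset.filter_or]; simp only [Finset.mem_insert]
    have hAu : A.filter (fun e => compOf H e ∈ insert C 𝒟)
        = A.filter (fun e => compOf H e = C) ∪ A.filter (fun e => compOf H e ∈ 𝒟) := by
      rw [← Finset.filter_or]; simp only [Finset.mem_insert]
    have hd : Disjoint E₁ E₂ := by
      rw [Finset.disjoint_left]
      intro e he he'
      rw [Finset.mem_filter] at he he'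
      exact hC (he.2 ▸ he'.2)
    have hU₁ : ∀ e ∈ E₁, ∀ x ∈ e, x ∈ {x | H.connectedComponentMk x = C} := by
      intro e he x hx
      rw [Finset.mem_filter] at he
      exact (connectedComponentMk_eq_compOf (hE he.1) hx).trans he.2
    have hU₂ : ∀ e ∈ E₂, ∀ x ∈ e, x ∉ {x | H.connectedComponentMk x = C} := by
      intro e he x hx hxC
      rw [Finset.mem_filter] at he
      have : C = compOf H e := hxC.symm.trans (connectedComponentMk_eq_compOf (hE he.1) hx)
      exact hC (this ▸ he.2)
    rw [hEu, hAu, ← average_bases_union hd]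
    · refine average_congr rfl fun T hT => ?_
      rw [mem_bases] at hT
      rw [containing_union, Set.inter_indicator_one]
      simp only [Pi.mul_apply]
      have key : ∀ (P : Sym2 V → Prop) [DecidablePred P],
          (containing (A.filter P)).indicator (1 : Set (Sym2 V) → ℝ) (T : Set (Sym2 V))
            = (containing (A.filter P)).indicator 1 ((T ∩ E.filter P : Finset _) : Set _) := by
        intro P _
        have hiff : (T : Set (Sym2 V)) ∈ containing (A.filter P) ↔
            ((T ∩ E.filter P : Finset _) : Set (Sym2 V)) ∈ containing (A.filter P) := by
          simp only [mem_containing, Finset.coe_subset]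
          constructor
          · intro h e he
            refine Finset.mem_inter.2 ⟨h he, Finset.mem_filter.2 ⟨?_, (Finset.mem_filter.1 he).2⟩⟩
            have := hT.subset (h he)
            rw [Finset.mem_union, Finset.mem_filter, Finset.mem_filter] at this
            tauto
          · exact fun h => h.trans Finset.inter_subset_left
        by_cases h : (T : Set (Sym2 V)) ∈ containing (A.filter P)
        · rw [Set.indicator_of_mem h, Set.indicator_of_mem (hiff.1 h)]; rfl
        · rw [Set.indicator_of_notMem h, Set.indicator_of_notMem fun h' => h (hiff.2 h')]
      rw [key, key (fun e => compOf H e ∈ 𝒟)]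
    · intro T₁ hT₁ T₂ hT₂ e he h
      exact h.of_union_separated (fun k hk => hU₁ k (hT₁ hk)) (fun k hk => hU₂ k (hT₂ hk)) (hU₁ e he)
    · intro T₁ hT₁ T₂ hT₂ e he h
      rw [Set.union_comm] at h
      exact h.of_union_separated (U := {x | H.connectedComponentMk x = C}ᶜ)
        (fun k hk => hU₂ k (hT₂ hk)) (fun k hk x hx => not_not.2 (hU₁ k (hT₁ hk) x hx)) (hU₂ e he)

/-- Components met by `E` but not by `A` contribute the factor `1`. One formula serves both kinds of
forest, since for `B = Set.univ` the wired relation is trivial and the system is free. -/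
theorem average_bases_eq_prod (B : Set V) {E A : Finset (Sym2 V)} (hE : ↑E ⊆ H.edgeSet)
    (hA : ↑A ⊆ H.edgeSet) (𝒞 : Finset H.ConnectedComponent) (h𝒞 : ∀ e ∈ A, compOf H e ∈ 𝒞) :
    average (bases (wiredSetoid B) id E)
        (fun T => (containing A).indicator 1 (T : Set (Sym2 V)))
      = ∏ C ∈ 𝒞, average (bases (wiredSetoid ((↑) ⁻¹' B : Set C)) id (restr C E))
        (fun T => (containing (restr C A)).indicator 1 (T : Set (Sym2 C))) := by
  classical
  have h := average_bases_eq_prod_filter (H := H) B (A := A) hE (𝒞 ∪ E.image (compOf H))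
  rw [Finset.filter_true_of_mem fun e he =>
    Finset.mem_union_right _ (Finset.mem_image_of_mem _ he),
    Finset.filter_true_of_mem fun e he => Finset.mem_union_left _ (h𝒞 e he)] at h
  rw [h, ← Finset.prod_subset Finset.subset_union_left]
  · exact Finset.prod_congr rfl fun C _ => average_bases_component B hE hA C
  · intro C _ hC
    rw [Finset.filter_false_of_mem fun e he (hCe : compOf H e = C) => hC (hCe ▸ h𝒞 e he)]
    simp only [containing_empty, Set.indicator_univ]
    exact average_const (bases_nonempty _ _ _) 1

end Components

/-! ### Product measures over the components -/

section Glue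

variable {V : Type u} {H : SimpleGraph V}

theorem mem_glue_compEmb {F : ∀ C : H.ConnectedComponent, Set (Sym2 C)} {C : H.ConnectedComponent}
    {e : Sym2 C} : compEmb C e ∈ glue F ↔ e ∈ F C := by
  rw [glue, Set.mem_iUnion]
  constructor
  · rintro ⟨C', e', he', h⟩
    have h' : compEmb C' e' = compEmb C e := h
    obtain rfl := compEmb_disjoint h'
    rwa [← (compEmb C').injective h']
  · exact fun he => ⟨C, e, he, rfl⟩

theorem exists_of_mem_glue {F : ∀ C : H.ConnectedComponent, Set (Sym2 C)} {e : Sym2 V}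
    (h : e ∈ glue F) : ∃ C : H.ConnectedComponent, ∃ e' : Sym2 C, compEmb C e' = e := by
  rw [glue, Set.mem_iUnion] at h
  obtain ⟨C, e', -, he⟩ := h
  exact ⟨C, e', he⟩

theorem measurable_glue : Measurable (glue (H := H)) := by
  rw [measurable_set_iff]
  intro e
  by_cases h : ∃ C : H.ConnectedComponent, ∃ e' : Sym2 C, compEmb (H := H) C e' = e
  · obtain ⟨C, e', rfl⟩ := h
    simp only [mem_glue_compEmb]
    exact (measurable_set_mem e').comp (measurable_pi_apply C)
  · have : (fun F : ∀ C : H.ConnectedComponent, Set (Sym2 C) => e ∈ glue F) = fun _ => False := by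
      funext F
      exact eq_false fun hF => h (exists_of_mem_glue hF)
    rw [this]
    exact measurable_const

variable (m : ∀ C : H.ConnectedComponent, Measure (Set (Sym2 C))) [∀ C, IsProbabilityMeasure (m C)]

instance isProbabilityMeasure_map_glue :
    IsProbabilityMeasure ((Measure.infinitePi m).map glue) :=
  Measure.isProbabilityMeasure_map measurable_glue.aemeasurable

theorem map_glue_containing {A : Finset (Sym2 V)} (hA : ∀ e ∈ A, ∃ e', compEmb (compOf H e) e' = e)
    (𝒞 : Finset H.ConnectedComponent) (h𝒞 : ∀ e ∈ A, compOf H e ∈ 𝒞) :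
    ((Measure.infinitePi m).map glue).real (containing A)
      = ∏ C ∈ 𝒞, (m C).real (containing (restr C A)) := by
  have : glue ⁻¹' containing A = Set.pi 𝒞 fun C : H.ConnectedComponent => containing (restr C A) := by
    ext F
    simp only [Set.mem_preimage, mem_containing, Set.mem_pi]
    constructor
    · intro h C _ e he
      rw [Finset.mem_coe, mem_restr] at he
      exact mem_glue_compEmb.1 (h he)
    · intro h e he
      obtain ⟨e', he'⟩ := hA e he
      rw [← he', mem_glue_compEmb]
      refine h _ (h𝒞 e he) ?_
      rw [Finset.mem_coe, mem_restr, he']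
      exact he
  rw [measureReal_def, Measure.map_apply measurable_glue (measurableSet_containing A), this,
    Measure.infinitePi_pi m fun C _ => measurableSet_containing _, ENNReal.toReal_prod]
  rfl

theorem map_glue_containing_eq_zero {A : Finset (Sym2 V)} (hA : ¬ (A : Set (Sym2 V)) ⊆ H.edgeSet)
    (hm : ∀ (C : H.ConnectedComponent) (e : Sym2 C), e ∉ C.toSimpleGraph.edgeSet →
      (m C).real (containing {e}) = 0) :
    ((Measure.infinitePi m).map glue).real (containing A) = 0 := by
  rw [Set.not_subset] at hA
  obtain ⟨e, he, heH⟩ := hA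
  have hsub : containing A ⊆ containing {e} := fun ω hω => by
    rw [mem_containing, Finset.coe_singleton, Set.singleton_subset_iff]
    exact hω he
  refine le_antisymm ((measureReal_mono hsub).trans_eq ?_) measureReal_nonneg
  by_cases h : ∃ C : H.ConnectedComponent, ∃ e' : Sym2 C, compEmb (H := H) C e' = e
  · obtain ⟨C, e', rfl⟩ := h
    have hC : compOf H (compEmb C e') = C := mem_range_compEmb.1 ⟨e', rfl⟩ _ (out_fst_mem _)
    rw [map_glue_containing m (𝒞 := {C})]
    · rw [Finset.prod_singleton]
      have : restr C {compEmb C e'} = {e'} := by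
        ext f; simp [mem_restr]
      rw [this]
      exact hm C e' fun h => heH (compEmb_mem_edgeSet.2 h)
    · intro f hf
      rw [Finset.mem_singleton.1 hf, hC]
      exact ⟨e', rfl⟩
    · intro f hf
      rw [Finset.mem_singleton.1 hf, hC]
      exact Finset.mem_singleton_self C
  · rw [measureReal_def, Measure.map_apply measurable_glue (measurableSet_containing _)]
    have : glue ⁻¹' containing {e} = (∅ : Set (∀ C : H.ConnectedComponent, Set (Sym2 C))) := by
      rw [Set.eq_empty_iff_forall_notMem]
      intro F hF
      refine h (exists_of_mem_glue (F := F) ?_)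
      have hF' : ((({e} : Finset (Sym2 V)) : Set (Sym2 V))) ⊆ glue F := hF
      rwa [Finset.coe_singleton, Set.singleton_subset_iff] at hF'
    rw [this]
    simp

end Glue

/-! ### Componentwise forests as limits on disconnected graphs -/

section Componentwise

variable {V : Type u} {H : SimpleGraph V}

theorem ConvergesTo.real_eq_zero {α β : Type*} {l : Filter β} [l.NeBot]
    {𝓑 : β → Finset (Finset α)} {μ : Measure (Set α)} (h : ConvergesTo l 𝓑 μ) {A : Finset α}
    (hA : ∀ᶠ n in l, ∀ T ∈ 𝓑 n, ¬ A ⊆ T) : μ.real (containing A) = 0 :=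
  tendsto_nhds_unique (h A) (tendsto_const_nhds.congr'
    (hA.mono fun _ hn => (average_indicator_containing_eq_zero hn).symm))

theorem IsFreeLimit.real_eq_zero {μ : Measure (Set (Sym2 V))} (h : IsFreeLimit H μ)
    {A : Finset (Sym2 V)} (hA : ¬ (A : Set (Sym2 V)) ⊆ H.edgeSet) : μ.real (containing A) = 0 := by
  classical
  exact ConvergesTo.real_eq_zero h (Eventually.of_forall fun E T hT hAT =>
    hA (Set.Subset.trans (by exact_mod_cast hAT) (subset_edgeSet_of_mem_freeBases hT)))

theorem IsWiredLimit.real_eq_zero (hH : ∀ v, (H.neighborSet v).Finite)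
    {μ : Measure (Set (Sym2 V))} (h : IsWiredLimit H μ)
    {A : Finset (Sym2 V)} (hA : ¬ (A : Set (Sym2 V)) ⊆ H.edgeSet) : μ.real (containing A) = 0 := by
  classical
  exact ConvergesTo.real_eq_zero h (Eventually.of_forall fun E T hT hAT =>
    hA (Set.Subset.trans (by exact_mod_cast hAT) (subset_edgeSet_of_mem_wiredBases hH hT)))

theorem toSimpleGraph_neighborSet_finite (hH : ∀ v, (H.neighborSet v).Finite)
    (C : H.ConnectedComponent) (v : C) : (C.toSimpleGraph.neighborSet v).Finite :=
  ((hH v).preimage Subtype.val_injective.injOn).subset fun _ hw => hw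

instance (H : SimpleGraph V) : IsProbabilityMeasure (componentwiseFSF H) :=
  isProbabilityMeasure_map_glue _

instance (H : SimpleGraph V) : IsProbabilityMeasure (componentwiseWSF H) :=
  isProbabilityMeasure_map_glue _

theorem tendsto_preimage_atTop {α β : Type*} {j : α → β} (hj : Function.Injective j) :
    Tendsto (fun E : Finset β => E.preimage j hj.injOn) atTop atTop := by
  classical
  refine tendsto_atTop_finset_of_monotone (fun E E' h => ?_) fun a => ⟨{j a}, by simp⟩
  exact Finset.monotone_preimage hj h

/-- Only the finitely many components met by `A` matter. The finite-volume probability factors over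
them and each factor converges, which matches the product measure. If `A` is not contained in the
edges of `H`, both sides vanish. -/
theorem isFreeLimit_componentwiseFSF [Countable V] (H : SimpleGraph V) :
    IsFreeLimit H (componentwiseFSF H) := by
  classical
  have hC : ∀ C : H.ConnectedComponent, IsFreeLimit C.toSimpleGraph (FSF C.toSimpleGraph) :=
    fun C => isFreeLimit_FSF C.connected_toSimpleGraph
  intro A
  by_cases hA : (A : Set (Sym2 V)) ⊆ H.edgeSet
  · rw [componentwiseFSF, map_glue_containing _
      (fun e he => (compOf_eq_iff (hA he)).1 rfl) (A.image (compOf H))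
      fun e he => Finset.mem_image_of_mem _ he]
    have hprod : ∀ E, average (freeBases H E) (fun T => (containing A).indicator 1 (T : Set (Sym2 V)))
        = ∏ C ∈ A.image (compOf H), average (freeBases C.toSimpleGraph (restr C E))
          (fun T => (containing (restr C A)).indicator 1 (T : Set (Sym2 C))) := by
      intro E
      rw [freeBases, ← wiredSetoid_univ, average_bases_eq_prod _
        (fun e he => (mem_edgesIn.1 he).2) hA _ fun e he => Finset.mem_image_of_mem _ he]
      refine Finset.prod_congr rfl fun C _ => ?_
      rw [Set.preimage_univ, wiredSetoid_univ, freeBases]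
      congr 2
      ext e
      rw [mem_restr, mem_edgesIn, mem_edgesIn, mem_restr, compEmb_mem_edgeSet]
    simp_rw [hprod]
    refine tendsto_finsetProd _ fun C _ => ?_
    exact (ConvergesTo.comp (hC C) (tendsto_preimage_atTop (compEmb C).injective)) (restr C A)
  · rw [componentwiseFSF, map_glue_containing_eq_zero _ hA fun C e he =>
      (hC C).real_eq_zero (by simpa using he)]
    refine tendsto_const_nhds.congr fun E => ?_
    rw [average_indicator_containing_eq_zero]
    exact fun T hT hAT =>
      hA (Set.Subset.trans (by exact_mod_cast hAT) (subset_edgeSet_of_mem_freeBases hT))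

theorem isWiredLimit_componentwiseWSF [Countable V] {H : SimpleGraph V}
    (hH : ∀ v, (H.neighborSet v).Finite) : IsWiredLimit H (componentwiseWSF H) := by
  classical
  have hloc := toSimpleGraph_neighborSet_finite hH
  have hC : ∀ C : H.ConnectedComponent, IsWiredLimit C.toSimpleGraph (WSF C.toSimpleGraph) :=
    fun C => isWiredLimit_WSF C.connected_toSimpleGraph (hloc C)
  intro A
  by_cases hA : (A : Set (Sym2 V)) ⊆ H.edgeSet
  · rw [componentwiseWSF, map_glue_containing _
      (fun e he => (compOf_eq_iff (hA he)).1 rfl) (A.image (compOf H))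
      fun e he => Finset.mem_image_of_mem _ he]
    have hprod : ∀ B, average (wiredBases H B) (fun T => (containing A).indicator 1 (T : Set (Sym2 V)))
        = ∏ C ∈ A.image (compOf H), average (wiredBases C.toSimpleGraph
            (B.preimage ((↑) : C → V) Subtype.val_injective.injOn))
          (fun T => (containing (restr C A)).indicator 1 (T : Set (Sym2 C))) := by
      intro B
      have hfin := touching_finite hH B.finite_toSet
      rw [wiredBases, average_bases_eq_prod _
        (fun e he => ((mem_finsetOf hfin).1 he).1) hA _ fun e he => Finset.mem_image_of_mem _ he]
      refine Finset.prod_congr rfl fun C _ => ?_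
      rw [wiredBases, Finset.coe_preimage]
      congr 2
      ext e
      rw [mem_restr, mem_finsetOf hfin, mem_finsetOf (touching_finite (hloc C)
        (B.finite_toSet.preimage Subtype.val_injective.injOn))]
      refine and_congr compEmb_mem_edgeSet ?_
      induction e with
      | _ x y =>
        have : compEmb C s(x, y) = s((x : V), (y : V)) := rfl
        rw [this]
        simp only [Set.mem_preimage, Finset.mem_coe,
          Sym2.mem_iff]
        constructor
        · rintro ⟨v, hv, rfl | rfl⟩
          · exact ⟨x, hv, Or.inl rfl⟩
          · exact ⟨y, hv, Or.inr rfl⟩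
        · rintro ⟨v, hv, rfl | rfl⟩
          · exact ⟨v, hv, Or.inl rfl⟩
          · exact ⟨v, hv, Or.inr rfl⟩
    simp_rw [hprod]
    refine tendsto_finsetProd _ fun C _ => ?_
    exact (ConvergesTo.comp (hC C) (tendsto_preimage_atTop Subtype.val_injective)) (restr C A)
  · rw [componentwiseWSF, map_glue_containing_eq_zero _ hA fun C e he =>
      (hC C).real_eq_zero (hloc C) (by simpa using he)]
    refine tendsto_const_nhds.congr fun E => ?_
    rw [average_indicator_containing_eq_zero]
    exact fun T hT hAT =>
      hA (Set.Subset.trans (by exact_mod_cast hAT) (subset_edgeSet_of_mem_wiredBases hH hT))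

end Componentwise

/-! ### Mixtures of random-set laws -/

section Bind

variable {α : Type u} {Ω : Type v} [MeasurableSpace Ω] {μ : Measure Ω} [IsProbabilityMeasure μ]
  {κ : Ω → Measure (Set α)} [∀ ω, IsProbabilityMeasure (κ ω)]

theorem isProbabilityMeasure_bind_of_measurable (hκ : Measurable κ) :
    IsProbabilityMeasure (μ.bind κ) := ⟨by
  rw [Measure.bind_apply MeasurableSet.univ hκ.aemeasurable]
  simp⟩

theorem measureReal_bind {μ : Measure Ω} (hκ : Measurable κ) {S : Set (Set α)} (hS : MeasurableSet S) :
    (μ.bind κ).real S = ∫ ω, (κ ω).real S ∂μ := by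
  rw [measureReal_def, Measure.bind_apply hS hκ.aemeasurable]
  simp only [measureReal_def]
  rw [integral_toReal (f := fun ω => κ ω S) ((Measure.measurable_coe hS).comp hκ).aemeasurable]
  exact Eventually.of_forall fun ω => measure_lt_top _ _

theorem measurable_measureReal {κ : Ω → Measure (Set α)} (hκ : Measurable κ) {S : Set (Set α)}
    (hS : MeasurableSet S) : Measurable fun ω => (κ ω).real S :=
  ((Measure.measurable_coe hS).comp hκ).ennreal_toReal

theorem integrable_measureReal (hκ : Measurable κ) {S : Set (Set α)} (hS : MeasurableSet S) :
    Integrable (fun ω => (κ ω).real S) μ :=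
  Integrable.of_bound (measurable_measureReal hκ hS).aestronglyMeasurable 1
    (Eventually.of_forall fun ω => by
      rw [Real.norm_of_nonneg measureReal_nonneg]; exact measureReal_le_one)

theorem IsLocal.integral_eq_sum {K : Finset α} {φ : Set α → ℝ} (h : IsLocal K φ)
    (ν : Measure (Set α)) [IsFiniteMeasure ν] :
    ∫ ω, φ ω ∂ν = ∑ A ∈ K.powerset, φ A * ν.real {ω : Set α | ω ∩ K = A} := by
  rw [integral_congr_ae (Eventually.of_forall h.eq_sum), integral_finsetSum]
  · refine Finset.sum_congr rfl fun A _ => ?_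
    rw [integral_const_mul, integral_indicator_one (measurableSet_inter_eq K A)]
  · intro A _
    exact ((integrable_const (1 : ℝ)).indicator (measurableSet_inter_eq K A)).const_mul _

theorem IsLocal.integral_bind {K : Finset α} {φ : Set α → ℝ} (h : IsLocal K φ)
    (hκ : Measurable κ) : ∫ x, φ x ∂(μ.bind κ) = ∫ ω, (∫ x, φ x ∂(κ ω)) ∂μ := by
  have := isProbabilityMeasure_bind_of_measurable (μ := μ) hκ
  simp_rw [h.integral_eq_sum]
  rw [integral_finsetSum]
  · refine Finset.sum_congr rfl fun A _ => ?_
    rw [integral_const_mul, measureReal_bind hκ (measurableSet_inter_eq K A)]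
  · intro A _
    exact (integrable_measureReal hκ (measurableSet_inter_eq K A)).const_mul _

theorem ae_bind {μ : Measure Ω} {κ : Ω → Measure (Set α)} (hκ : Measurable κ) {S : Set (Set α)} (hS : MeasurableSet S)
    (h : ∀ᵐ ω ∂μ, ∀ᵐ x ∂(κ ω), x ∈ S) : ∀ᵐ x ∂(μ.bind κ), x ∈ S := by
  rw [ae_iff]
  change (μ.bind κ) Sᶜ = 0
  rw [Measure.bind_apply hS.compl hκ.aemeasurable, lintegral_eq_zero_iff (f := fun ω => κ ω Sᶜ)
    ((Measure.measurable_coe hS.compl).comp hκ)]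
  filter_upwards [h] with ω hω
  exact ae_iff.1 hω

end Bind

/-! ### Stochastic domination -/

section Domination

variable {α : Type u}

/-- `μ` dominates `ν` stochastically. -/
def StochLE (ν μ : Measure (Set α)) : Prop :=
  ∀ (K : Finset α) (f : Set α → ℝ), IsLocal K f → Monotone f → ∫ ω, f ω ∂ν ≤ ∫ ω, f ω ∂μ

theorem IsLocal.mono {K K' : Finset α} (hK : K ⊆ K') {f : Set α → ℝ} (hf : IsLocal K f) :
    IsLocal K' f := by
  intro ω
  have hK' : (K : Set α) ⊆ K' := by exact_mod_cast hK
  rw [← hf, Set.inter_assoc, Set.inter_eq_right.2 hK', hf]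

theorem stochLE_of_subset {E : Set α} {ν μ : Measure (Set α)} (hν : ∀ᵐ ω ∂ν, ω ⊆ E)
    (hμ : ∀ᵐ ω ∂μ, ω ⊆ E)
    (h : ∀ (K : Finset α) (f : Set α → ℝ), ↑K ⊆ E → IsLocal K f → Monotone f →
      ∫ ω, f ω ∂ν ≤ ∫ ω, f ω ∂μ) : StochLE ν μ := by
  classical
  intro K f hf hm
  have heq : ∀ ρ : Measure (Set α), (∀ᵐ ω ∂ρ, ω ⊆ E) →
      ∫ ω, f ω ∂ρ = ∫ ω, f (ω ∩ (K.filter (· ∈ E) : Finset α)) ∂ρ := by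
    intro ρ hρ
    refine integral_congr_ae ?_
    filter_upwards [hρ] with ω hω
    rw [← hf ω]
    congr 1
    ext a
    simp only [Set.mem_inter_iff, Finset.coe_filter, Set.mem_ofPred_eq, Finset.mem_coe]
    exact ⟨fun h => ⟨h.1, h.2, hω h.1⟩, fun h => ⟨h.1, h.2.1⟩⟩
  rw [heq ν hν, heq μ hμ]
  refine h (K.filter (· ∈ E)) _ ?_ ?_ ?_
  · intro a ha
    exact (Finset.mem_filter.1 ha).2
  · intro ω
    simp only [Set.inter_assoc, Set.inter_self]
  · exact fun ω ω' hω => hm (Set.inter_subset_inter_left _ hω)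

theorem ae_subset_of_real_eq_zero [Countable α] {E : Set α} {μ : Measure (Set α)}
    [IsFiniteMeasure μ] (h : ∀ e ∉ E, μ.real (containing {e}) = 0) : ∀ᵐ ω ∂μ, ω ⊆ E := by
  have : ∀ᵐ ω ∂μ, ∀ e, e ∉ E → e ∉ ω := by
    rw [ae_all_iff]
    intro e
    by_cases he : e ∈ E
    · exact Eventually.of_forall fun _ h => absurd he h
    · have h0 := h e he
      rw [measureReal_eq_zero_iff] at h0
      filter_upwards [measure_eq_zero_iff_ae_notMem.1 h0] with ω hω _ heω
      exact hω (by rwa [mem_containing, Finset.coe_singleton, Set.singleton_subset_iff])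
  filter_upwards [this] with ω hω e he
  exact by_contra fun h => hω e h he

end Domination

/-! ### Measurability of the resampling kernels -/

section Kernels

variable {V : Type u} {G : SimpleGraph V}

/-- For each `n`, walks of length `n` from a fixed vertex end in a countable set. Countability is
what permits almost sure statements about all edges at once and measurable limits along `atTop`. -/
theorem Connected.countable {G : SimpleGraph V} (hG : G.Connected)
    (hfin : ∀ v, (G.neighborSet v).Finite) : Countable V := by
  obtain ⟨v⟩ := hG.nonempty
  let s : ℕ → Set V := fun n => Nat.rec {v} (fun _ t => ⋃ x ∈ t, G.neighborSet x) n
  have hs : ∀ n, (s n).Countable := by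
    intro n
    induction n with
    | zero => exact Set.countable_singleton v
    | succ n ih => exact ih.biUnion fun x _ => (hfin x).countable
  have hu : (Set.univ : Set V) ⊆ ⋃ n, s n := by
    intro w _
    obtain ⟨p⟩ := hG.preconnected w v
    clear hs
    induction p with
    | nil => exact Set.mem_iUnion.2 ⟨0, rfl⟩
    | cons h p ih =>
      obtain ⟨n, hn⟩ := Set.mem_iUnion.1 (ih (Set.mem_univ _))
      exact Set.mem_iUnion.2 ⟨n + 1, Set.mem_biUnion hn h.symm⟩
  exact Set.countable_univ_iff.1 ((Set.countable_iUnion hs).mono hu)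

/-- Connections are realized by finitely many edges. -/
theorem Spans.exists_finset {ω : Set (Sym2 V)} {e : Sym2 V} (h : Spans ⊥ id ω e) :
    ∃ A : Finset (Sym2 V), ↑A ⊆ ω ∧ Spans ⊥ id (A : Set (Sym2 V)) e := by
  classical
  induction e with
  | _ x y =>
    obtain ⟨p⟩ := reachable_fromEdgeSet_iff_spans.2 h
    refine ⟨p.edges.toFinset, fun e he => ?_, reachable_fromEdgeSet_iff_spans.1 ⟨p.transfer _ ?_⟩⟩
    · have := p.edges_subset_edgeSet (List.mem_toFinset.1 he)
      rw [SimpleGraph.edgeSet_fromEdgeSet] at this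
      exact this.1
    · intro e he
      have := p.edges_subset_edgeSet he
      rw [SimpleGraph.edgeSet_fromEdgeSet] at this ⊢
      exact ⟨by simpa using he, this.2⟩

theorem measurableSet_spans [Countable V] (e : Sym2 V) :
    MeasurableSet {ω : Set (Sym2 V) | Spans ⊥ id ω e} := by
  have : {ω : Set (Sym2 V) | Spans ⊥ id ω e}
      = ⋃ A ∈ {A : Finset (Sym2 V) | Spans ⊥ id (A : Set (Sym2 V)) e}, containing A := by
    ext ω
    simp only [Set.mem_ofPred_eq, Set.mem_iUnion, exists_prop]
    constructor
    · intro h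
      obtain ⟨A, hA, hs⟩ := h.exists_finset
      exact ⟨A, hs, hA⟩
    · rintro ⟨A, hs, hA⟩
      exact hs.mono le_rfl hA
  rw [this]
  exact MeasurableSet.biUnion (Set.to_countable _) fun A _ => measurableSet_containing A

theorem mem_edgeSet_inducedComponentGraph {ω : Set (Sym2 V)} {e : Sym2 V} :
    e ∈ (inducedComponentGraph G ω).edgeSet ↔ e ∈ G.edgeSet ∧ Spans ⊥ id ω e := by
  induction e with
  | _ x y =>
    rw [← reachable_fromEdgeSet_iff_spans]
    exact Iff.rfl

theorem inducedComponentGraph_le (ω : Set (Sym2 V)) : inducedComponentGraph G ω ≤ G :=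
  fun _ _ h => h.1

theorem measurable_edgeSet_inducedComponentGraph [Countable V] :
    Measurable fun ω : Set (Sym2 V) => (inducedComponentGraph G ω).edgeSet := by
  rw [measurable_set_iff]
  intro e
  simp only [mem_edgeSet_inducedComponentGraph]
  exact measurable_const.and (measurableSet_setOfPred.1 (measurableSet_spans e))

open Classical in
/-- The elements of `E` in `X`. -/
def within {α : Type*} (E : Finset α) (X : Set α) : Finset α := E.filter (· ∈ X)

theorem mem_within {α : Type*} {E : Finset α} {X : Set α} {e : α} :
    e ∈ within E X ↔ e ∈ E ∧ e ∈ X := by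
  classical
  exact Finset.mem_filter

/-- The bases of the edges of `E` in `X`. -/
def basesWithin (r : Setoid V) (E : Finset (Sym2 V)) (X : Set (Sym2 V)) :
    Finset (Finset (Sym2 V)) := bases r id (within E X)

theorem isLocal_average_basesWithin (r : Setoid V) (E : Finset (Sym2 V))
    (f : Finset (Sym2 V) → ℝ) : IsLocal E fun X => average (basesWithin r E X) f := by
  intro X
  have : within E (X ∩ (E : Set (Sym2 V))) = within E X := by
    ext e; simp +contextual [mem_within]
  simp only [basesWithin]
  rw [this]

theorem freeBases_eq_basesWithin (H : SimpleGraph V) (E : Finset (Sym2 V)) :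
    freeBases H E = basesWithin ⊥ E H.edgeSet := by
  rw [freeBases, basesWithin]
  congr 1
  ext e
  rw [mem_edgesIn, mem_within]

theorem wiredBases_eq_basesWithin (hG : ∀ v, (G.neighborSet v).Finite) {H : SimpleGraph V}
    (hH : H ≤ G) (B : Finset V) :
    wiredBases H B = basesWithin (wiredSetoid B) (finsetOf (touching G B)) H.edgeSet := by
  rw [wiredBases, basesWithin]
  congr 1
  ext e
  rw [mem_within, mem_finsetOf (touching_finite hG B.finite_toSet),
    mem_finsetOf (touching_finite (neighborSet_finite_of_le hG hH) B.finite_toSet)]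
  have := @SimpleGraph.edgeSet_mono V H G hH e
  constructor
  · rintro ⟨h1, h2⟩
    exact ⟨⟨this h1, h2⟩, h1⟩
  · rintro ⟨⟨h1, h2⟩, h3⟩
    exact ⟨h3, h2⟩

/-- Each finite-volume average sees only a finite part of `X ω` and is therefore measurable. Limits
along a countably generated filter remain measurable, and the containment events form a generating
π-system. -/
theorem measurable_of_convergesTo {β : Type*} {l : Filter β} [l.NeBot] [l.IsCountablyGenerated]
    {Ω : Type*} [MeasurableSpace Ω] {κ : Ω → Measure (Set (Sym2 V))}
    [∀ ω, IsProbabilityMeasure (κ ω)] {r : β → Setoid V} {E : β → Finset (Sym2 V)}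
    {X : Ω → Set (Sym2 V)} (hX : Measurable X)
    (h : ∀ ω, ConvergesTo l (fun n => basesWithin (r n) (E n) (X ω)) (κ ω)) : Measurable κ := by
  refine Measurable.measure_of_isPiSystem_of_isProbabilityMeasure generateFrom_containing
    isPiSystem_containing ?_
  rintro _ ⟨A, rfl⟩
  have hm : Measurable fun ω => (κ ω).real (containing A) :=
    measurable_of_tendsto_metrizable' l
      (fun n => (isLocal_average_basesWithin (r n) (E n) _).measurable.comp hX)
      (tendsto_pi_nhds.2 fun ω => h ω A)
  have heq : (fun ω => κ ω (containing A)) = fun ω => ENNReal.ofReal ((κ ω).real (containing A)) :=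
    funext fun ω => (ofReal_measureReal (μ := κ ω)).symm
  rw [heq]
  exact hm.ennreal_ofReal

theorem measurable_componentwiseFSF [Countable V] :
    Measurable fun ω => componentwiseFSF (inducedComponentGraph G ω) := by
  refine measurable_of_convergesTo (l := atTop) (r := fun _ : Finset (Sym2 V) => ⊥)
    (E := fun E => E) (measurable_edgeSet_inducedComponentGraph (G := G)) fun ω => ?_
  simp_rw [← freeBases_eq_basesWithin]
  exact isFreeLimit_componentwiseFSF _

theorem isWiredLimit_componentwiseWSF_inducedComponentGraph [Countable V]
    (hG : ∀ v, (G.neighborSet v).Finite) (ω : Set (Sym2 V)) :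
    IsWiredLimit (inducedComponentGraph G ω) (componentwiseWSF (inducedComponentGraph G ω)) :=
  isWiredLimit_componentwiseWSF (neighborSet_finite_of_le hG (inducedComponentGraph_le ω))

theorem measurable_componentwiseWSF [Countable V] (hG : ∀ v, (G.neighborSet v).Finite) :
    Measurable fun ω => componentwiseWSF (inducedComponentGraph G ω) := by
  refine measurable_of_convergesTo (l := atTop) (r := fun B : Finset V => wiredSetoid (B : Set V))
    (E := fun B => finsetOf (touching G B)) (measurable_edgeSet_inducedComponentGraph (G := G))
    fun ω => ?_
  simp_rw [← wiredBases_eq_basesWithin hG (inducedComponentGraph_le ω)]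
  exact isWiredLimit_componentwiseWSF_inducedComponentGraph hG ω

end Kernels

section Subset

variable {V : Type u} [Countable V] {H : SimpleGraph V} {μ : Measure (Set (Sym2 V))}
  [IsFiniteMeasure μ]

theorem IsFreeLimit.ae_subset (h : IsFreeLimit H μ) : ∀ᵐ ω ∂μ, ω ⊆ H.edgeSet :=
  ae_subset_of_real_eq_zero fun e he => h.real_eq_zero (by simpa using he)

theorem IsWiredLimit.ae_subset (hH : ∀ v, (H.neighborSet v).Finite) (h : IsWiredLimit H μ) :
    ∀ᵐ ω ∂μ, ω ⊆ H.edgeSet :=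
  ae_subset_of_real_eq_zero fun e he => h.real_eq_zero hH (by simpa using he)

theorem measurableSet_subset (E : Set (Sym2 V)) : MeasurableSet {ω : Set (Sym2 V) | ω ⊆ E} := by
  have : {ω : Set (Sym2 V) | ω ⊆ E} = ⋂ e ∈ Eᶜ, {ω | e ∈ ω}ᶜ := by
    ext ω
    simp only [Set.mem_ofPred_eq, Set.mem_iInter, Set.mem_compl_iff, Set.subset_def]
    exact forall_congr' fun e => by tauto
  rw [this]
  exact MeasurableSet.biInter (Set.to_countable _) fun e _ => (measurableSet_mem e).compl

end Subset

/-! ### Wired resampling lowers the law -/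

section ResampleDomination

variable {V : Type u} [Countable V] {G : SimpleGraph V}

theorem ae_subset_resampleWSF (hG : ∀ v, (G.neighborSet v).Finite) (μ : Measure (Set (Sym2 V)))
    [IsProbabilityMeasure μ] : ∀ᵐ ω ∂(resampleWSF G μ), ω ⊆ G.edgeSet := by
  refine ae_bind (measurable_componentwiseWSF hG) (measurableSet_subset G.edgeSet)
    (Eventually.of_forall fun ω => ?_)
  filter_upwards [(isWiredLimit_componentwiseWSF_inducedComponentGraph hG ω).ae_subset
    (neighborSet_finite_of_le hG (inducedComponentGraph_le ω))] with x hx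
  exact hx.trans (SimpleGraph.edgeSet_mono (inducedComponentGraph_le ω))

theorem ae_subset_resampleFSF (μ : Measure (Set (Sym2 V)))
    [IsProbabilityMeasure μ] : ∀ᵐ ω ∂(resampleFSF G μ), ω ⊆ G.edgeSet := by
  refine ae_bind measurable_componentwiseFSF (measurableSet_subset G.edgeSet)
    (Eventually.of_forall fun ω => ?_)
  filter_upwards [(isFreeLimit_componentwiseFSF (inducedComponentGraph G ω)).ae_subset] with x hx
  exact hx.trans (SimpleGraph.edgeSet_mono (inducedComponentGraph_le ω))

theorem isProbabilityMeasure_resampleWSF (hG : ∀ v, (G.neighborSet v).Finite)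
    (μ : Measure (Set (Sym2 V))) [IsProbabilityMeasure μ] :
    IsProbabilityMeasure (resampleWSF G μ) :=
  isProbabilityMeasure_bind_of_measurable (measurable_componentwiseWSF hG)

theorem isProbabilityMeasure_resampleFSF
    (μ : Measure (Set (Sym2 V))) [IsProbabilityMeasure μ] :
    IsProbabilityMeasure (resampleFSF G μ) :=
  isProbabilityMeasure_bind_of_measurable measurable_componentwiseFSF

/-- Resampling inside a finite vertex set decreases the forest stochastically. -/
theorem integral_average_wiredBases_le (hG : ∀ v, (G.neighborSet v).Finite) {β : Type*}
    {l : Filter β} [l.NeBot] {μ : Measure (Set (Sym2 V))} [IsProbabilityMeasure μ]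
    {r : β → Setoid V} {E : β → Finset (Sym2 V)} (hE : ∀ e ∈ G.edgeSet, ∀ᶠ n in l, e ∈ E n)
    (h : ConvergesTo l (fun n => bases (r n) id (E n)) μ) (hμ : ∀ᵐ ω ∂μ, ω ⊆ G.edgeSet)
    {K : Finset (Sym2 V)} (hK : ↑K ⊆ G.edgeSet) {f : Set (Sym2 V) → ℝ} (hf : IsLocal K f)
    (hm : Monotone f) {B : Finset V} (hB : endpoints K ⊆ B) :
    ∫ ω, average (wiredBases (inducedComponentGraph G ω) B) (fun T => f T) ∂μ ≤ ∫ ω, f ω ∂μ := by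
  classical
  set F := finsetOf (touching G B) with hFdef
  have hFfin := touching_finite hG B.finite_toSet
  have hKF : K ⊆ F := fun e he => (mem_finsetOf hFfin).2 (subset_touching_of_endpoints hK hB he)
  have hFG : ∀ e ∈ F, e ∈ G.edgeSet := fun e he => ((mem_finsetOf hFfin).1 he).1
  have hfm : Monotone fun T : Finset (Sym2 V) => f T := fun T T' hT => hm (by exact_mod_cast hT)
  -- Connection in the whole forest is not a local event. Testing connection only inside the finite
  -- set `E'` makes the functional local, so the weak limit can be taken before `E'` grows.
  let ψ : Finset (Sym2 V) → Set (Sym2 V) → ℝ := fun E' ω =>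
    average (bases (wiredSetoid (B : Set V)) id (F.filter fun e => Spans ⊥ id (ω ∩ E') e))
      fun T => f T
  have hψloc : ∀ E', IsLocal E' (ψ E') := by
    intro E' ω
    simp only [ψ, Set.inter_assoc, Set.inter_self]
  obtain ⟨C, hC⟩ := hf.exists_bound
  have hbound : ∀ (𝓑 : Finset (Finset (Sym2 V))), 𝓑.Nonempty →
      ‖average 𝓑 fun T => f T‖ ≤ C := by
    intro 𝓑 h𝓑
    rw [Real.norm_eq_abs, abs_le]
    constructor
    · rw [← average_const h𝓑 (-C)]
      exact average_mono fun T _ => (abs_le.1 (hC T)).1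
    · rw [← average_const h𝓑 C]
      exact average_mono fun T _ => (abs_le.1 (hC T)).2
  have hψle : ∀ E'' : Finset (Sym2 V), F ⊆ E'' →
      ∫ ω, ψ (edgesIn G E'') ω ∂μ ≤ ∫ ω, f ω ∂μ := by
    intro E'' hF
    refine le_of_tendsto_of_tendsto (h.tendsto_average (hψloc _)) (h.tendsto_average hf) ?_
    have hev : ∀ᶠ n in l, ∀ e ∈ F, e ∈ E n := by
      rw [Filter.eventually_all_finset]
      exact fun e he => hE e (hFG e he)
    filter_upwards [hev] with n hn
    have := average_resample_le (r := r n) (r₂ := wiredSetoid (B : Set V)) (q := id) (F := F)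
      (E := E n) (E' := edgesIn G E'') hn (fun e he => mem_edgesIn.2 ⟨hF he, hFG e he⟩)
      (fun e he x y hxy => ?_) hfm (fun T => ?_)
    · refine le_trans (le_of_eq (average_congr rfl fun T _ => ?_)) this
      simp only [ψ]
      congr 2
      ext e
      rw [mem_connectedEdges, Finset.mem_filter, Finset.coe_inter]
      rfl
    -- An edge of `G` outside `F` does not touch `B`, so both its endpoints lie in the wired class.
    · rw [Finset.mem_sdiff, mem_edgesIn, mem_finsetOf hFfin] at he
      have hxy' : e = s(x, y) := hxy
      refine Or.inr ⟨fun hx => he.2 ⟨he.1.2, x, hx, ?_⟩, fun hy => he.2 ⟨he.1.2, y, hy, ?_⟩⟩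
      · rw [hxy']; exact Sym2.mem_mk_left x y
      · rw [hxy']; exact Sym2.mem_mk_right x y
    · rw [Finset.coe_inter]
      exact (hf.mono hKF) T
  -- Each connection uses finitely many edges and `F` is finite, so for almost every `ω` the
  -- truncated average is eventually equal to the full one.
  have hlim : Tendsto (fun E'' => ∫ ω, ψ (edgesIn G E'') ω ∂μ) atTop
      (𝓝 (∫ ω, average (wiredBases (inducedComponentGraph G ω) B) (fun T => f T) ∂μ)) := by
    refine tendsto_integral_filter_of_dominated_convergence (fun _ => C)
      (Eventually.of_forall fun E'' => (hψloc _).measurable.aestronglyMeasurable)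
      (Eventually.of_forall fun E'' => Eventually.of_forall fun ω => hbound _ (bases_nonempty _ _ _))
      (integrable_const C) ?_
    filter_upwards [hμ] with ω hω
    refine tendsto_const_nhds.congr' ?_
    have hev : ∀ᶠ E'' : Finset (Sym2 V) in atTop, ∀ e ∈ F,
        Spans ⊥ id ω e → Spans ⊥ id (ω ∩ edgesIn G E'') e := by
      rw [Filter.eventually_all_finset]
      intro e _
      by_cases hs : Spans ⊥ id ω e
      · obtain ⟨A, hA, hAs⟩ := hs.exists_finset
        filter_upwards [eventually_ge_atTop A] with E'' hE'' _
        refine hAs.mono le_rfl fun i hi => ⟨hA hi, ?_⟩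
        exact mem_edgesIn.2 ⟨hE'' hi, hω (hA hi)⟩
      · exact Eventually.of_forall fun _ h => absurd h hs
    filter_upwards [hev] with E'' hE''
    rw [wiredBases_eq_basesWithin hG (inducedComponentGraph_le ω), basesWithin]
    simp only [ψ]
    congr 2
    ext e
    rw [mem_within, Finset.mem_filter, mem_edgeSet_inducedComponentGraph]
    constructor
    · rintro ⟨he, -, hs⟩
      exact ⟨he, hE'' e he hs⟩
    · rintro ⟨he, hs⟩
      exact ⟨he, hFG e he, hs.mono le_rfl Set.inter_subset_left⟩
  exact le_of_tendsto hlim ((eventually_ge_atTop F).mono hψle)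

/-- Resampling wired forests on the induced-component graph decreases a weak limit of uniform
spanning forests stochastically. -/
theorem stochLE_resampleWSF (hG : ∀ v, (G.neighborSet v).Finite) {β : Type*}
    {l : Filter β} [l.NeBot] {μ : Measure (Set (Sym2 V))} [IsProbabilityMeasure μ]
    {r : β → Setoid V} {E : β → Finset (Sym2 V)} (hE : ∀ e ∈ G.edgeSet, ∀ᶠ n in l, e ∈ E n)
    (h : ConvergesTo l (fun n => bases (r n) id (E n)) μ) (hμ : ∀ᵐ ω ∂μ, ω ⊆ G.edgeSet) :
    StochLE (resampleWSF G μ) μ := by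
  classical
  refine stochLE_of_subset (ae_subset_resampleWSF hG μ) hμ fun K f hK hf hm => ?_
  rw [resampleWSF, hf.integral_bind (measurable_componentwiseWSF hG)]
  obtain ⟨C, hC⟩ := hf.exists_bound
  have hbound : ∀ (𝓑 : Finset (Finset (Sym2 V))), 𝓑.Nonempty →
      ‖average 𝓑 fun T => f T‖ ≤ C := by
    intro 𝓑 h𝓑
    rw [Real.norm_eq_abs, abs_le]
    constructor
    · rw [← average_const h𝓑 (-C)]
      exact average_mono fun T _ => (abs_le.1 (hC T)).1
    · rw [← average_const h𝓑 C]
      exact average_mono fun T _ => (abs_le.1 (hC T)).2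
  -- As `B` grows, the finite wired averages on each fixed induced-component graph converge to its
  -- wired forest; dominated convergence passes this through the integral over `ω`.
  have hlim : Tendsto (fun B : Finset V =>
      ∫ ω, average (wiredBases (inducedComponentGraph G ω) B) (fun T => f T) ∂μ) atTop
      (𝓝 (∫ ω, (∫ x, f x ∂(componentwiseWSF (inducedComponentGraph G ω))) ∂μ)) := by
    refine tendsto_integral_filter_of_dominated_convergence (fun _ => C)
      (Eventually.of_forall fun B => ?_)
      (Eventually.of_forall fun B => Eventually.of_forall fun ω =>
        hbound _ (wiredBases_nonempty _ _))
      (integrable_const C) (Eventually.of_forall fun ω =>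
        (isWiredLimit_componentwiseWSF_inducedComponentGraph hG ω).tendsto_average hf)
    simp_rw [wiredBases_eq_basesWithin hG (inducedComponentGraph_le _)]
    exact ((isLocal_average_basesWithin _ _ _).measurable.comp
      measurable_edgeSet_inducedComponentGraph).aestronglyMeasurable
  refine le_of_tendsto hlim ?_
  filter_upwards [eventually_ge_atTop (endpoints_finite K).toFinset] with B hB
  exact integral_average_wiredBases_le hG hE h hμ hK hf hm
    fun x hx => hB ((endpoints_finite K).mem_toFinset.2 hx)

end ResampleDomination

/-! ### From domination to equality of laws -/

section Equality

variable {α : Type u}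

theorem isLocal_indicator {K : Finset α} {S : Set (Set α)} (h : ∀ ω : Set α, ω ∩ K ∈ S ↔ ω ∈ S) :
    IsLocal K (S.indicator 1) := by
  intro ω
  by_cases hω : ω ∈ S
  · rw [Set.indicator_of_mem hω, Set.indicator_of_mem ((h ω).2 hω)]; rfl
  · rw [Set.indicator_of_notMem hω, Set.indicator_of_notMem fun h' => hω ((h ω).1 h')]

theorem monotone_indicator {S : Set (Set α)} (h : ∀ ω ω', ω ⊆ ω' → ω ∈ S → ω' ∈ S) :
    Monotone (S.indicator (1 : Set α → ℝ)) := by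
  intro ω ω' hω
  by_cases hS : ω ∈ S
  · rw [Set.indicator_of_mem hS, Set.indicator_of_mem (h ω ω' hω hS)]; rfl
  · rw [Set.indicator_of_notMem hS]
    exact indicator_one_nonneg _ _

theorem isLocal_indicator_containing {A K : Finset α} (h : A ⊆ K) :
    IsLocal K ((containing A).indicator 1) := by
  refine isLocal_indicator fun ω => ?_
  have h' : (A : Set α) ⊆ K := by exact_mod_cast h
  exact ⟨fun hω => hω.trans Set.inter_subset_left, fun hω => Set.subset_inter hω h'⟩

theorem StochLE.real_le {ν μ : Measure (Set α)} (h : StochLE ν μ) {K : Finset α}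
    {S : Set (Set α)} (hS : MeasurableSet S) (hK : ∀ ω : Set α, ω ∩ K ∈ S ↔ ω ∈ S)
    (hm : ∀ ω ω', ω ⊆ ω' → ω ∈ S → ω' ∈ S) : ν.real S ≤ μ.real S := by
  have := h K _ (isLocal_indicator hK) (monotone_indicator hm)
  rwa [integral_indicator_one hS, integral_indicator_one hS] at this

theorem StochLE.real_containing_le {ν μ : Measure (Set α)} (h : StochLE ν μ) (A : Finset α) :
    ν.real (containing A) ≤ μ.real (containing A) :=
  h.real_le (K := A) (measurableSet_containing A)
    (fun _ => ⟨fun hω => hω.trans Set.inter_subset_left, fun hω => Set.subset_inter hω subset_rfl⟩)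
    fun _ _ hω hA => hA.trans hω

theorem mem_containing_singleton {e : α} {ω : Set α} : ω ∈ containing {e} ↔ e ∈ ω := by
  rw [mem_containing, Finset.coe_singleton, Set.singleton_subset_iff]

/-- When the set grows to contain all of `A`, the subtracted indicator costs `1`, but at least one
summand has risen from `0` to `1`. Testing domination on this function reverses the inequality for
`containing A`, up to the marginals. -/
theorem monotone_card_sub_indicator (A : Finset α) :
    Monotone fun ω : Set α => ∑ e ∈ A, (containing {e}).indicator (1 : Set α → ℝ) ω
      - (containing A).indicator 1 ω := by
  classical
  intro ω ω' hω
  have hle : ∀ e, (containing {e}).indicator (1 : Set α → ℝ) ω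
      ≤ (containing {e}).indicator 1 ω' := fun e =>
    monotone_indicator (S := containing {e}) (fun _ _ h hA => Set.Subset.trans hA h) hω
  by_cases h' : ω' ∈ containing A
  · by_cases h : ω ∈ containing A
    · simp only [Set.indicator_of_mem h, Set.indicator_of_mem h']
      exact sub_le_sub_right (Finset.sum_le_sum fun e _ => hle e) _
    · simp only [Set.indicator_of_notMem h, Set.indicator_of_mem h', sub_zero]
      rw [mem_containing, Set.not_subset] at h
      obtain ⟨a, ha, haω⟩ := h
      rw [← Finset.add_sum_erase A _ ha, ← Finset.add_sum_erase A _ ha]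
      have h1 : (containing {a}).indicator (1 : Set α → ℝ) ω = 0 :=
        Set.indicator_of_notMem (fun h => haω (mem_containing_singleton.1 h)) _
      have h2 : (containing {a}).indicator (1 : Set α → ℝ) ω' = 1 :=
        Set.indicator_of_mem (mem_containing_singleton.2 (h' ha)) _
      have h3 := Finset.sum_le_sum fun e (_ : e ∈ A.erase a) => hle e
      simp only [Pi.one_apply]
      rw [h1, h2]
      linarith
  · have h : ω ∉ containing A := fun h => h' (Set.Subset.trans h hω)
    simp only [Set.indicator_of_notMem h, Set.indicator_of_notMem h', sub_zero]
    exact Finset.sum_le_sum fun e _ => hle e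

/-- Stochastic domination and equal marginals imply equality. -/
theorem StochLE.eq_of_marginals {ν μ : Measure (Set α)} [IsProbabilityMeasure ν]
    [IsProbabilityMeasure μ] (h : StochLE ν μ)
    (h' : ∀ e, μ.real (containing {e}) ≤ ν.real (containing {e})) : ν = μ := by
  classical
  refine measure_ext_containing fun A => le_antisymm (h.real_containing_le A) ?_
  have hloc : IsLocal A fun ω : Set α => ∑ e ∈ A, (containing {e}).indicator (1 : Set α → ℝ) ω
      - (containing A).indicator 1 ω := by
    intro ω
    refine congrArg₂ (· - ·) (Finset.sum_congr rfl fun e he =>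
        isLocal_indicator_containing (Finset.singleton_subset_iff.2 he) ω)
      (isLocal_indicator_containing subset_rfl ω)
  have key := h A _ hloc (monotone_card_sub_indicator A)
  have hint : ∀ ρ : Measure (Set α), IsProbabilityMeasure ρ →
      ∫ ω, (∑ e ∈ A, (containing {e}).indicator (1 : Set α → ℝ) ω
        - (containing A).indicator 1 ω) ∂ρ
      = ∑ e ∈ A, ρ.real (containing {e}) - ρ.real (containing A) := by
    intro ρ _
    have hi : ∀ A' : Finset α, Integrable ((containing A').indicator (1 : Set α → ℝ)) ρ :=
      fun A' => (integrable_const (1 : ℝ)).indicator (measurableSet_containing A')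
    rw [integral_sub (integrable_finsetSum _ fun e _ => hi {e}) (hi A),
      integral_finsetSum _ fun e _ => hi {e}, integral_indicator_one (measurableSet_containing A)]
    congr 1
    exact Finset.sum_congr rfl fun e _ => integral_indicator_one (measurableSet_containing {e})
  rw [hint ν inferInstance, hint μ inferInstance] at key
  have := Finset.sum_le_sum fun e (_ : e ∈ A) => h' e
  linarith

/-- The event that a random set meets `D`. -/
def hitting (D : Finset α) : Set (Set α) := {ω | ∃ a ∈ D, a ∈ ω}

theorem measurableSet_hitting (D : Finset α) : MeasurableSet (hitting D) := by
  have : hitting D = ⋃ a ∈ D, {ω | a ∈ ω} := by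
    ext ω; simp [hitting]
  rw [this]
  exact Finset.measurableSet_biUnion _ fun a _ => measurableSet_mem a

/-- If the smaller random set meets all sets of a family, each of which isolates an element of the
larger random set, then the two have the same law. -/
theorem StochLE.eq_of_hitting [Countable α] {ν μ : Measure (Set α)} [IsProbabilityMeasure ν]
    [IsProbabilityMeasure μ] (h : StochLE ν μ) {𝒞 : Set (Finset α)}
    (hν : ∀ D ∈ 𝒞, ∀ᵐ ω ∂ν, ω ∈ hitting D)
    (hμ : ∀ᵐ ω ∂μ, ∀ e ∈ ω, ∃ D ∈ 𝒞, ∀ a ∈ D, a ∈ ω → a = e) : ν = μ := by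
  classical
  refine h.eq_of_marginals fun e => ?_
  -- The event that each `D` in `𝒟` is met in an element other than `e`; it is local and increasing.
  -- The smaller set satisfies it almost surely when it omits `e`, while the larger set cannot
  -- satisfy all these events when it contains `e`. Domination thus gives the missing comparison of
  -- marginals.
  let U : Finset 𝒞 → Set (Set α) := fun 𝒟 => ⋂ D ∈ 𝒟, hitting ((D : Finset α).erase e)
  have hUm : ∀ 𝒟, MeasurableSet (U 𝒟) := fun 𝒟 =>
    Finset.measurableSet_biInter _ fun D _ => measurableSet_hitting _
  have hUanti : Antitone U := fun 𝒟 𝒟' h𝒟 =>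
    Set.biInter_subset_biInter_left (by exact_mod_cast h𝒟)
  have hνU : ∀ 𝒟, ν.real (containing {e})ᶜ ≤ ν.real (U 𝒟) := by
    intro 𝒟
    refine ENNReal.toReal_mono (measure_ne_top _ _) (measure_mono_ae ?_)
    have hall : ∀ᵐ ω ∂ν, ∀ D : 𝒞, ω ∈ hitting (D : Finset α) :=
      ae_all_iff.2 fun D => hν D D.2
    filter_upwards [hall] with ω hω he
    refine Set.mem_iInter₂.2 fun D _ => ?_
    obtain ⟨a, haD, haω⟩ := hω D
    refine ⟨a, Finset.mem_erase.2 ⟨?_, haD⟩, haω⟩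
    rintro rfl
    exact he (mem_containing_singleton.2 haω)
  have hU : ∀ 𝒟, ν.real (U 𝒟) ≤ μ.real (U 𝒟) := by
    intro 𝒟
    refine h.real_le (K := 𝒟.biUnion fun D => (D : Finset α)) (hUm 𝒟) (fun ω => ?_)
      fun ω ω' hω hωU => ?_
    · simp only [U, Set.mem_iInter]
      refine forall_congr' fun D => forall_congr' fun hD => ?_
      refine exists_congr fun a => and_congr_right fun ha => ?_
      refine and_iff_left ?_
      exact Finset.mem_coe.2 (Finset.mem_biUnion.2 ⟨D, hD, (Finset.mem_erase.1 ha).2⟩)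
    · simp only [U, Set.mem_iInter] at hωU ⊢
      exact fun D hD => (hωU D hD).imp fun a ha => ⟨ha.1, hω ha.2⟩
  have hlim : Tendsto (fun 𝒟 => μ.real (U 𝒟)) atTop (𝓝 (μ.real (⋂ 𝒟, U 𝒟))) :=
    (ENNReal.tendsto_toReal (measure_ne_top _ _)).comp
      (tendsto_measure_iInter_atTop (fun 𝒟 => (hUm 𝒟).nullMeasurableSet) hUanti
        ⟨∅, measure_ne_top _ _⟩)
  have hle : ν.real (containing {e})ᶜ ≤ μ.real (⋂ 𝒟, U 𝒟) :=
    ge_of_tendsto' hlim fun 𝒟 => (hνU 𝒟).trans (hU 𝒟)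
  have hle' : μ.real (⋂ 𝒟, U 𝒟) ≤ μ.real (containing {e})ᶜ := by
    refine ENNReal.toReal_mono (measure_ne_top _ _) (measure_mono_ae ?_)
    filter_upwards [hμ] with ω hω hωU he
    have heω : e ∈ ω := he (by simp)
    obtain ⟨D, hD, hDe⟩ := hω e heω
    have h1 := Set.mem_iInter₂.1 (Set.mem_iInter.1 hωU {⟨D, hD⟩}) ⟨D, hD⟩ (by simp)
    obtain ⟨a, ha, haω⟩ := h1
    rw [Finset.mem_erase] at ha
    exact ha.1 (hDe a ha.2 haω)
  rw [probReal_compl_eq_one_sub (measurableSet_containing _)] at hle hle'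
  linarith

/-- Domination for increasing open events. -/
theorem StochLE.real_iUnion_le [Countable α] {ν μ : Measure (Set α)} [IsProbabilityMeasure ν]
    [IsProbabilityMeasure μ] (h : StochLE ν μ) (𝒮 : Set (Finset α)) :
    ν.real (⋃ A : 𝒮, containing (A : Finset α)) ≤ μ.real (⋃ A : 𝒮, containing (A : Finset α)) := by
  classical
  let U : Finset 𝒮 → Set (Set α) := fun 𝒟 => ⋃ A ∈ 𝒟, containing (A : Finset α)
  have hUm : ∀ 𝒟, MeasurableSet (U 𝒟) := fun 𝒟 =>
    Finset.measurableSet_biUnion _ fun D _ => measurableSet_containing _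
  have hUmono : Monotone U := fun 𝒟 𝒟' h𝒟 =>
    Set.biUnion_subset_biUnion_left (by exact_mod_cast h𝒟)
  have hUU : ⋃ 𝒟, U 𝒟 = ⋃ A : 𝒮, containing (A : Finset α) := by
    apply Set.Subset.antisymm
    · exact Set.iUnion_subset fun 𝒟 => Set.iUnion₂_subset fun A _ =>
        Set.subset_iUnion (fun A : 𝒮 => containing (A : Finset α)) A
    · refine Set.iUnion_subset fun A => ?_
      refine Set.Subset.trans ?_ (Set.subset_iUnion U {A})
      exact fun ω hω => Set.mem_iUnion₂.2 ⟨A, by simp, hω⟩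
  have hlim : ∀ ρ : Measure (Set α), IsProbabilityMeasure ρ →
      Tendsto (fun 𝒟 => ρ.real (U 𝒟)) atTop (𝓝 (ρ.real (⋃ 𝒟, U 𝒟))) := fun ρ _ =>
    (ENNReal.tendsto_toReal (measure_ne_top _ _)).comp (tendsto_measure_iUnion_atTop hUmono)
  rw [← hUU]
  refine le_of_tendsto_of_tendsto' (hlim ν inferInstance) (hlim μ inferInstance) fun 𝒟 => ?_
  refine h.real_le (K := 𝒟.biUnion fun D => (D : Finset α)) (hUm 𝒟) (fun ω => ?_)
      fun ω ω' hω hωU => ?_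
  · simp only [U, Set.mem_iUnion]
    refine exists_congr fun A => exists_congr fun hA => ?_
    refine ⟨fun h => h.trans Set.inter_subset_left, fun h => Set.subset_inter h ?_⟩
    intro a ha
    exact Finset.mem_coe.2 (Finset.mem_biUnion.2 ⟨A, hA, ha⟩)
  · simp only [U, Set.mem_iUnion] at hωU ⊢
    obtain ⟨A, hA, hAω⟩ := hωU
    exact ⟨A, hA, hAω.trans hω⟩

end Equality

/-! ### Rays in infinite, locally finite graphs -/

section Rays

variable {W : Type u} {T : SimpleGraph W}

/-- König's lemma. -/
theorem exists_ray_of_infinite [Infinite W] (hT : T.Connected)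
    (hfin : ∀ v, (T.neighborSet v).Finite) : Nonempty (Ray T) := by
  classical
  obtain ⟨x⟩ := hT.nonempty
  -- The vertices that some geodesic from `x` reaches through `v`. If there are infinitely many of
  -- them, infinitely many lie behind one of the finitely many neighbours farther from `x`;
  -- iterating gives a geodesic ray.
  let Z : W → Set W := fun v => {z | T.dist x z = T.dist x v + T.dist v z}
  have step : ∀ v, (Z v).Infinite → ∃ w, T.Adj v w ∧ T.dist x w = T.dist x v + 1 ∧
      (Z w).Infinite := by
    intro v hv
    have hsub : Z v \ {v} ⊆ ⋃ w ∈ {w | w ∈ T.neighborSet v ∧ T.dist x w = T.dist x v + 1}, Z w := by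
      rintro z ⟨hz, hzv⟩
      obtain ⟨p, hp⟩ := (hT.preconnected v z).exists_walk_length_eq_dist
      cases p with
      | nil => exact absurd rfl hzv
      | @cons _ w _ h q =>
        rw [SimpleGraph.Walk.length_cons] at hp
        have h1 := SimpleGraph.dist_le q
        have h2 := hT.dist_triangle (u := x) (v := w) (w := z)
        have h3 := hT.dist_triangle (u := x) (v := v) (w := w)
        have h4 : T.dist v w = 1 := SimpleGraph.dist_eq_one_iff_adj.2 h
        have hz' : T.dist x z = T.dist x v + T.dist v z := hz
        refine Set.mem_biUnion (x := w) ⟨h, by omega⟩ ?_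
        change T.dist x z = T.dist x w + T.dist w z
        omega
    by_contra hcon
    push Not at hcon
    refine (hv.sdiff (Set.finite_singleton v)) (Set.Finite.subset ?_ hsub)
    refine Set.Finite.biUnion ((hfin v).subset fun w hw => hw.1) fun w hw => ?_
    exact hcon w hw.1 hw.2
  have h0 : (Z x).Infinite := by
    have : Z x = Set.univ := by
      ext z; simp [Z]
    rw [this]
    exact Set.infinite_univ
  choose! g hg using step
  let r : ℕ → W := fun n => g^[n] x
  have hr : ∀ n, (Z (r n)).Infinite := by
    intro n
    induction n with
    | zero => exact h0
    | succ n ih =>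
      simp only [r, Function.iterate_succ_apply']
      exact (hg _ ih).2.2
  have hsucc : ∀ n, r (n + 1) = g (r n) := fun n => by
    simp only [r, Function.iterate_succ_apply']
  have hd : ∀ n, T.dist x (r n) = n := by
    intro n
    induction n with
    | zero => simp [r]
    | succ n ih => rw [hsucc, (hg _ (hr n)).2.1, ih]
  exact ⟨⟨r, fun n => by rw [hsucc]; exact (hg _ (hr n)).1, fun m n hmn => by
    rw [← hd m, ← hd n, hmn]⟩⟩

theorem Ray.edges_infinite (r : Ray T) : r.edges.Infinite := by
  intro hfin
  have hsub : Set.range r.vertex ⊆ ⋃ e ∈ r.edges, {x | x ∈ e} := by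
    rintro _ ⟨n, rfl⟩
    exact Set.mem_biUnion (x := s(r.vertex n, r.vertex (n + 1))) ⟨n, rfl⟩ (Sym2.mem_mk_left _ _)
  refine (Set.infinite_range_of_injective r.injective) (Set.Finite.subset ?_ hsub)
  refine hfin.biUnion fun e _ => ?_
  induction e with
  | _ x y =>
    refine (Set.toFinite {x, y}).subset fun z hz => ?_
    simpa using hz

end Rays

/-! ### Finite cuts in one-ended forests -/

section OneEnded

variable {V : Type u} {ω : Set (Sym2 V)}

/-- Only the existence of a ray in each component is used: the ray leaves the finite set `S`, so the
component of a point of `S` does too. -/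
theorem ComponentsOneEnded.exists_cuts (h : ComponentsOneEnded ω) {S : Set V} (hS : S.Finite)
    (hne : S.Nonempty) : ∃ e ∈ ω, Cuts S e := by
  obtain ⟨x, hx⟩ := hne
  have h1 := h ((SimpleGraph.fromEdgeSet ω).connectedComponentMk x)
  obtain ⟨-, ⟨q⟩⟩ := Nat.card_eq_one_iff_unique.1 h1
  induction q using Quotient.inductionOn with
  | _ r =>
    have hinf : (Set.range fun n => (r.vertex n : V)).Infinite :=
      Set.infinite_range_of_injective (Subtype.val_injective.comp r.injective)
    obtain ⟨_, ⟨n, rfl⟩, hn⟩ := hinf.exists_notMem_finite hS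
    have hreach : (SimpleGraph.fromEdgeSet ω).Reachable x (r.vertex n) :=
      (SimpleGraph.ConnectedComponent.eq.1 (r.vertex n).2).symm
    have hsp := reachable_fromEdgeSet_iff_spans.1 hreach
    by_contra hcon
    push Not at hcon
    refine hsp S (saturated_bot S) hcon ?_
    rw [cuts_mk]
    exact fun h => hn (h.1 hx)

/-- A side of an edge in a locally finite forest that is infinite contains an infinite path. -/
theorem exists_ray_in_component {T T' : SimpleGraph V} (hT : T' ≤ T)
    (hfin : ∀ v, (T'.neighborSet v).Finite) {x : V} {C : T.ConnectedComponent}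
    (hC : T.connectedComponentMk x = C) (hx : {z | T'.Reachable x z}.Infinite) :
    ∃ r : Ray C.toSimpleGraph, ∀ e ∈ r.edges, ∀ z ∈ e, T'.Reachable x z := by
  let C' := T'.connectedComponentMk x
  have hC' : ∀ z, z ∈ C' ↔ T'.Reachable x z := fun z =>
    SimpleGraph.ConnectedComponent.eq.trans ⟨fun h => h.symm, fun h => h.symm⟩
  have hinf : Infinite C' := by
    refine Set.infinite_coe_iff.2 (hx.mono fun z hz => ?_)
    exact (hC' z).2 hz
  obtain ⟨r⟩ := exists_ray_of_infinite C'.connected_toSimpleGraph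
    (toSimpleGraph_neighborSet_finite hfin C')
  have hmem : ∀ n, T'.Reachable x (r.vertex n : V) := fun n => (hC' _).1 (r.vertex n).2
  have hmemC : ∀ n, (r.vertex n : V) ∈ C := fun n => by
    rw [← hC]
    exact SimpleGraph.ConnectedComponent.eq.2 ((hmem n).mono hT).symm
  refine ⟨⟨fun n => ⟨r.vertex n, hmemC n⟩, fun n => ?_, fun m n hmn => ?_⟩, ?_⟩
  · have : T'.Adj (r.vertex n) (r.vertex (n + 1)) := r.adj n
    exact hT this
  · exact r.injective (Subtype.ext (congrArg (fun z : C => (z : V)) hmn))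
  · rintro _ ⟨n, rfl⟩ z hz
    rcases Sym2.mem_iff.1 hz with rfl | rfl
    · exact hmem n
    · exact hmem (n + 1)

/-- In a one-ended forest every edge is isolated by a finite cut. -/
theorem ComponentsOneEnded.exists_finite_cut (h : ComponentsOneEnded ω) {G : SimpleGraph V}
    (hG : ∀ v, (G.neighborSet v).Finite) (hω : ω ⊆ G.edgeSet) {e : Sym2 V} (he : e ∈ ω)
    (hforest : ¬ Spans ⊥ id (ω \ {e}) e) :
    ∃ S : Finset V, S.Nonempty ∧ ∀ a ∈ ω, Cuts (S : Set V) a → a = e := by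
  classical
  set T' := SimpleGraph.fromEdgeSet (ω \ {e}) with hT'
  have hTT : T' ≤ SimpleGraph.fromEdgeSet ω := SimpleGraph.fromEdgeSet_mono Set.sdiff_subset
  have hfin : ∀ v, (T'.neighborSet v).Finite := fun v =>
    (hG v).subset fun w hw => by
      have hw' : T'.Adj v w := hw
      rw [hT', SimpleGraph.fromEdgeSet_adj] at hw'
      exact hω hw'.1.1
  -- A finite side of `e` is the required set: every edge of `ω` other than `e` survives in `T'` and
  -- cannot leave a component of `T'`.
  have side : ∀ x, {z | T'.Reachable x z}.Finite →
      ∃ S : Finset V, S.Nonempty ∧ ∀ a ∈ ω, Cuts (S : Set V) a → a = e := by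
    intro x hx
    refine ⟨hx.toFinset, ⟨x, hx.mem_toFinset.2 (SimpleGraph.Reachable.refl x)⟩,
      fun a ha hcut => ?_⟩
    by_contra hne
    rw [hx.coe_toFinset] at hcut
    obtain ⟨u, v, rfl, hu, hv⟩ := hcut
    have hu' : T'.Reachable x u := hu
    refine hv (hu'.trans (SimpleGraph.Adj.reachable ?_))
    rw [hT', SimpleGraph.fromEdgeSet_adj]
    refine ⟨⟨ha, hne⟩, ?_⟩
    rintro rfl
    exact hv hu
  induction e with
  | _ x y =>
    by_cases hx : {z | T'.Reachable x z}.Finite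
    · exact side x hx
    by_cases hy : {z | T'.Reachable y z}.Finite
    · exact side y hy
    -- If both sides were infinite, each would contain a ray. The two rays share no edge, so they
    -- are not equivalent and the component has two ends.
    exfalso
    set C := (SimpleGraph.fromEdgeSet ω).connectedComponentMk x with hC
    have hyC : (SimpleGraph.fromEdgeSet ω).connectedComponentMk y = C :=
      SimpleGraph.ConnectedComponent.eq.2
        (reachable_fromEdgeSet_iff_spans.2 (spans_of_mem (q := id) he)).symm
    obtain ⟨p, hp⟩ := exists_ray_in_component hTT hfin hC.symm hx
    obtain ⟨q, hq⟩ := exists_ray_in_component hTT hfin hyC hy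
    obtain ⟨hsub, -⟩ := Nat.card_eq_one_iff_unique.1 (h C)
    have heq : (symmDiff p.edges q.edges).Finite :=
      Quotient.exact (Subsingleton.elim (Quotient.mk (raySetoid _) p) (Quotient.mk (raySetoid _) q))
    refine p.edges_infinite (heq.subset fun f hf => Or.inl ⟨hf, fun hf' => ?_⟩)
    obtain ⟨n, rfl⟩ := hf
    have h1 := hp _ ⟨n, rfl⟩ _ (Sym2.mem_mk_left _ _)
    have h2 := hq _ hf' _ (Sym2.mem_mk_left _ _)
    exact hforest (reachable_fromEdgeSet_iff_spans.1 (h1.trans h2.symm))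

end OneEnded

/-! ### Almost sure properties of the limit forests -/

section Forest

variable {V : Type u} {G H : SimpleGraph V}

/-- A weak limit of uniform spanning forests is a forest. -/
theorem ae_forest [Countable V] {β : Type*} {l : Filter β} [l.NeBot] {μ : Measure (Set (Sym2 V))}
    [IsFiniteMeasure μ] {r : β → Setoid V} {E : β → Finset (Sym2 V)}
    (h : ConvergesTo l (fun n => bases (r n) id (E n)) μ) :
    ∀ᵐ ω ∂μ, ∀ e ∈ ω, ¬ Spans ⊥ id (ω \ {e}) e := by
  classical
  have key : ∀ (A : Finset (Sym2 V)) (e : Sym2 V), e ∉ A → Spans ⊥ id (A : Set (Sym2 V)) e →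
      ∀ᵐ ω ∂μ, ω ∉ containing (insert e A) := by
    intro A e he hs
    refine measure_eq_zero_iff_ae_notMem.1 ?_
    rw [← measureReal_eq_zero_iff]
    refine ConvergesTo.real_eq_zero h (Eventually.of_forall fun n T hT hAT => ?_)
    refine (mem_bases.1 hT).indep e (hAT (Finset.mem_insert_self e A)) (hs.mono bot_le ?_)
    exact fun i hi => ⟨hAT (Finset.mem_insert_of_mem hi), fun hie => he (by
      rw [Set.mem_singleton_iff] at hie; rwa [← hie])⟩
  have hall : ∀ᵐ ω ∂μ, ∀ (A : Finset (Sym2 V)) (e : Sym2 V), e ∉ A →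
      Spans ⊥ id (A : Set (Sym2 V)) e → ω ∉ containing (insert e A) := by
    rw [ae_all_iff]
    intro A
    rw [ae_all_iff]
    intro e
    by_cases he : e ∉ A ∧ Spans ⊥ id (A : Set (Sym2 V)) e
    · exact (key A e he.1 he.2).mono fun ω hω _ _ => hω
    · exact Eventually.of_forall fun ω h1 h2 => absurd ⟨h1, h2⟩ he
  filter_upwards [hall] with ω hω e he hs
  obtain ⟨A, hA, hAs⟩ := hs.exists_finset
  refine hω A e (fun heA => (hA heA).2 rfl) hAs ?_
  rw [mem_containing, Finset.coe_insert]
  exact Set.insert_subset he (hA.trans Set.sdiff_subset)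

/-- The finite edge cuts of `G`. -/
def finiteCuts (G : SimpleGraph V) : Set (Finset (Sym2 V)) :=
  {D | ∃ S : Finset V, S.Nonempty ∧ ∀ e, e ∈ D ↔ e ∈ G.edgeSet ∧ Cuts (S : Set V) e}

theorem exists_mem_finiteCuts (hG : ∀ v, (G.neighborSet v).Finite) {S : Finset V}
    (hS : S.Nonempty) :
    ∃ D ∈ finiteCuts G, ∀ e, e ∈ D ↔ e ∈ G.edgeSet ∧ Cuts (S : Set V) e := by
  have hfin : {e | e ∈ G.edgeSet ∧ Cuts (S : Set V) e}.Finite := by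
    refine (touching_finite hG S.finite_toSet).subset ?_
    rintro e ⟨he, x, y, rfl, hx, -⟩
    exact ⟨he, x, hx, Sym2.mem_mk_left x y⟩
  exact ⟨hfin.toFinset, ⟨S, hS, fun e => hfin.mem_toFinset⟩, fun e => hfin.mem_toFinset⟩

/-- The wired spanning forest crosses every cut of a finite set of vertices. -/
theorem IsWiredLimit.ae_hitting [Countable V] (hH : ∀ v, (H.neighborSet v).Finite)
    {μ : Measure (Set (Sym2 V))} [IsProbabilityMeasure μ] (h : IsWiredLimit H μ) (hHG : H ≤ G)
    {S : Finset V} {D : Finset (Sym2 V)}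
    (hD : ∀ e, e ∈ D ↔ e ∈ G.edgeSet ∧ Cuts (S : Set V) e)
    (hS : ∃ e ∈ H.edgeSet, Cuts (S : Set V) e) : ∀ᵐ ω ∂μ, ω ∈ hitting D := by
  classical
  have hloc : IsLocal D ((hitting D).indicator 1) := isLocal_indicator fun ω =>
    exists_congr fun a => and_congr_right fun ha => and_iff_left (Finset.mem_coe.2 ha)
  have hlim := ConvergesTo.tendsto_average h hloc
  rw [integral_indicator_one (measurableSet_hitting D)] at hlim
  have hone : μ.real (hitting D) = 1 := by
    refine tendsto_nhds_unique hlim (tendsto_const_nhds.congr' ?_)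
    -- Once `B` contains `S`, the set `S` avoids the wired vertex and is saturated. A basis that
    -- spans an edge leaving `S` must then itself contain an edge crossing `S`.
    filter_upwards [eventually_ge_atTop S] with B hB
    refine (average_const (wiredBases_nonempty H B) 1).symm.trans (average_congr rfl fun T hT => ?_)
    rw [Set.indicator_of_mem]
    · rfl
    by_contra hcon
    have hbasis := mem_bases.1 hT
    have hBS : (S : Set V) ⊆ B := by exact_mod_cast hB
    have hfin := touching_finite hH B.finite_toSet
    have huncut : ∀ i ∈ (T : Set (Sym2 V)), ¬ Cuts (S : Set V) (id i) := fun i hi hcut =>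
      hcon ⟨i, (hD i).2 ⟨SimpleGraph.edgeSet_mono hHG
        (subset_edgeSet_of_mem_wiredBases hH hT hi), hcut⟩, hi⟩
    obtain ⟨e, he, hcut⟩ := hS
    have heB : e ∈ finsetOf (touching H (B : Set V)) := by
      rw [mem_finsetOf hfin]
      obtain ⟨x, y, rfl, hx, -⟩ := hcut
      exact ⟨he, x, hBS hx, Sym2.mem_mk_left x y⟩
    exact hbasis.spans e heB S (saturated_wiredSetoid_of_disjoint hBS) huncut hcut
  rw [measureReal_def, ENNReal.toReal_eq_one_iff] at hone
  exact (mem_ae_iff_prob_eq_one (measurableSet_hitting D)).2 hone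

theorem exists_cuts_of_connected [Infinite V] (hG : G.Connected) {S : Finset V}
    (hS : S.Nonempty) : ∃ e ∈ G.edgeSet, Cuts (S : Set V) e := by
  obtain ⟨x, hx⟩ := hS
  obtain ⟨y, hy⟩ := Infinite.exists_notMem_finset S
  have hsp := reachable_iff_spans.1 (hG.preconnected x y)
  by_contra hcon
  push Not at hcon
  refine hsp S (saturated_bot _) hcon ?_
  rw [cuts_mk]
  exact fun h => hy (h.1 hx)

/-- The wired spanning forest is dominated by the free spanning forest. -/
theorem IsWiredLimit.stochLE (hH : ∀ v, (H.neighborSet v).Finite)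
    {μ ν : Measure (Set (Sym2 V))} [IsProbabilityMeasure μ] [IsProbabilityMeasure ν]
    (hν : IsWiredLimit H ν) (hμ : IsFreeLimit H μ) : StochLE ν μ := by
  classical
  intro K f hf hm
  -- The free limit is taken along the edge sets of the wired graphs, so that in finite volume the
  -- two forests differ only by the identification of vertices.
  have hfree : ConvergesTo atTop
      (fun B : Finset V => bases ⊥ id (finsetOf (touching H (B : Set V)))) μ := by
    refine hμ.convergesTo (fun B => ?_) fun e he => ?_
    · rw [coe_finsetOf (touching_finite hH B.finite_toSet)]
      exact fun e he => he.1
    · induction e with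
      | _ x y =>
        filter_upwards [eventually_ge_atTop {x}] with B hB
        rw [mem_finsetOf (touching_finite hH B.finite_toSet)]
        exact ⟨he, x, hB (Finset.mem_singleton_self x), Sym2.mem_mk_left x y⟩
  refine le_of_tendsto_of_tendsto' (ConvergesTo.tendsto_average hν hf) (hfree.tendsto_average hf)
    fun B => ?_
  exact average_bases_le_of_le (fun T T' hT => hm (by exact_mod_cast hT)) bot_le

theorem convergesTo_of_isFreeLimit {μ : Measure (Set (Sym2 V))} (h : IsFreeLimit G μ) :
    ConvergesTo atTop (fun E => bases ⊥ id (edgesIn G E)) μ := h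

/-- The event that the endpoints of `e` are connected without using `e`. -/
theorem iUnion_containing_eq (e : Sym2 V) :
    ⋃ A : {A : Finset (Sym2 V) | e ∉ A ∧ Spans ⊥ id (A : Set (Sym2 V)) e},
      containing (A : Finset (Sym2 V)) = {ω | Spans ⊥ id (ω \ {e}) e} := by
  ext ω
  simp only [Set.mem_iUnion, Set.mem_ofPred_eq]
  constructor
  · rintro ⟨⟨A, heA, hA⟩, hAω⟩
    exact hA.mono le_rfl fun i hi => ⟨hAω hi, fun hie => heA (by
      rw [Set.mem_singleton_iff] at hie; rwa [← hie])⟩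
  · intro h
    obtain ⟨A, hA, hs⟩ := h.exists_finset
    exact ⟨⟨A, fun heA => (hA heA).2 rfl, hs⟩, hA.trans Set.sdiff_subset⟩

end Forest

/-! ### Invariance under resampling -/

section Conclusion

variable {V : Type u} {G : SimpleGraph V} [Countable V]

/-- A random set that crosses all finite cuts and is dominated by a one-ended forest has the law of
that forest. -/
theorem StochLE.eq_of_oneEnded (hG : ∀ v, (G.neighborSet v).Finite)
    {ν μ : Measure (Set (Sym2 V))} [IsProbabilityMeasure ν] [IsProbabilityMeasure μ]
    (h : StochLE ν μ) (hν : ∀ D ∈ finiteCuts G, ∀ᵐ ω ∂ν, ω ∈ hitting D)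
    (hsub : ∀ᵐ ω ∂μ, ω ⊆ G.edgeSet) (hforest : ∀ᵐ ω ∂μ, ∀ e ∈ ω, ¬ Spans ⊥ id (ω \ {e}) e)
    (hone : ∀ᵐ ω ∂μ, ComponentsOneEnded ω) : ν = μ := by
  refine h.eq_of_hitting hν ?_
  filter_upwards [hsub, hforest, hone] with ω h1 h2 h3 e he
  obtain ⟨S, hS, hcut⟩ := h3.exists_finite_cut hG h1 he (h2 e he)
  obtain ⟨D, hD, hDS⟩ := exists_mem_finiteCuts hG hS
  exact ⟨D, hD, fun a haD haω => hcut a haω ((hDS a).1 haD).2⟩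

/-- The resampled law is dominated by `μ`, so only the crossing of finite cuts is at stake. The
original forest has infinite components and crosses the cut at some edge; this edge lies in the
induced-component graph, whose wired forest must therefore cross the cut as well. -/
theorem IsWiredLimit.resampleWSF_eq (hG : ∀ v, (G.neighborSet v).Finite)
    {μ : Measure (Set (Sym2 V))} [IsProbabilityMeasure μ] (hμ : IsWiredLimit G μ)
    (hone : ∀ᵐ ω ∂μ, ComponentsOneEnded ω) : resampleWSF G μ = μ := by
  have := isProbabilityMeasure_resampleWSF hG μ
  have hsub := hμ.ae_subset hG
  refine StochLE.eq_of_oneEnded hG (stochLE_resampleWSF hG (fun e he => ?_) hμ hsub) ?_ hsub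
    (ae_forest hμ) hone
  · induction e with
    | _ x y =>
      filter_upwards [eventually_ge_atTop {x}] with B hB
      rw [mem_finsetOf (touching_finite hG B.finite_toSet)]
      exact ⟨he, x, hB (Finset.mem_singleton_self x), Sym2.mem_mk_left x y⟩
  · rintro D ⟨S, hS, hD⟩
    refine ae_bind (measurable_componentwiseWSF hG) (measurableSet_hitting D) ?_
    filter_upwards [hsub, hone] with ω h1 h2
    refine (isWiredLimit_componentwiseWSF_inducedComponentGraph hG ω).ae_hitting
      (neighborSet_finite_of_le hG (inducedComponentGraph_le ω)) (inducedComponentGraph_le ω) hD ?_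
    obtain ⟨e, he, hcut⟩ := h2.exists_cuts S.finite_toSet hS
    exact ⟨e, mem_edgeSet_inducedComponentGraph.2 ⟨h1 he, spans_of_mem (q := id) he⟩, hcut⟩

/-- The wired forest is dominated by the free one and crosses every finite cut, because `G` is
infinite and connected. One-endedness of the free forest then forces equality. -/
theorem IsWiredLimit.eq_of_isFreeLimit [Infinite V] (hconn : G.Connected) (hG : ∀ v, (G.neighborSet v).Finite)
    {ν μ : Measure (Set (Sym2 V))} [IsProbabilityMeasure ν] [IsProbabilityMeasure μ]
    (hν : IsWiredLimit G ν) (hμ : IsFreeLimit G μ) (hone : ∀ᵐ ω ∂μ, ComponentsOneEnded ω) :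
    ν = μ := by
  refine StochLE.eq_of_oneEnded hG (hν.stochLE hG hμ) ?_ hμ.ae_subset
    (ae_forest (convergesTo_of_isFreeLimit hμ)) hone
  rintro D ⟨S, hS, hD⟩
  exact hν.ae_hitting hG le_rfl hD (exists_cuts_of_connected hconn hS)

theorem stochLE_resampleWSF_resampleFSF (hG : ∀ v, (G.neighborSet v).Finite)
    (μ : Measure (Set (Sym2 V))) [IsProbabilityMeasure μ] :
    StochLE (resampleWSF G μ) (resampleFSF G μ) := by
  intro K f hf hm
  rw [resampleWSF, resampleFSF, hf.integral_bind (measurable_componentwiseWSF hG),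
    hf.integral_bind measurable_componentwiseFSF]
  have hint : ∀ κ : Set (Sym2 V) → Measure (Set (Sym2 V)), (∀ ω, IsProbabilityMeasure (κ ω)) →
      Measurable κ → Integrable (fun ω => ∫ x, f x ∂(κ ω)) μ := by
    intro κ _ hκ
    simp_rw [hf.integral_eq_sum]
    exact integrable_finsetSum _ fun A _ =>
      (integrable_measureReal hκ (measurableSet_inter_eq K A)).const_mul _
  refine integral_mono (hint _ (fun _ => inferInstance) (measurable_componentwiseWSF hG))
    (hint _ (fun _ => inferInstance) measurable_componentwiseFSF) fun ω => ?_
  exact (isWiredLimit_componentwiseWSF_inducedComponentGraph hG ω).stochLE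
    (neighborSet_finite_of_le hG (inducedComponentGraph_le ω))
    (isFreeLimit_componentwiseFSF _) K f hf hm

theorem measurableSet_spans_without (e : Sym2 V) :
    MeasurableSet {ω : Set (Sym2 V) | Spans ⊥ id (ω \ {e}) e} := by
  rw [← iUnion_containing_eq]
  exact MeasurableSet.iUnion fun A => measurableSet_containing _

/-- If a random forest is invariant under wired resampling, it is invariant under free
resampling. -/
theorem resampleFSF_eq_of_resampleWSF_eq (hG : ∀ v, (G.neighborSet v).Finite)
    {μ : Measure (Set (Sym2 V))} [IsProbabilityMeasure μ]
    (h : resampleWSF G μ = μ) : resampleFSF G μ = μ := by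
  have := isProbabilityMeasure_resampleFSF (G := G) μ
  have hle := stochLE_resampleWSF_resampleFSF hG μ
  rw [h] at hle
  refine (hle.eq_of_marginals fun e => ?_).symm
  by_cases he : e ∈ G.edgeSet
  swap
  · have h0 : (resampleFSF G μ).real (containing {e}) = 0 := by
      rw [measureReal_eq_zero_iff, measure_eq_zero_iff_ae_notMem]
      filter_upwards [ae_subset_resampleFSF (G := G) μ] with ω hω hωe
      exact he (hω (mem_containing_singleton.1 hωe))
    rw [h0]
    exact measureReal_nonneg
  set U := {ω : Set (Sym2 V) | Spans ⊥ id (ω \ {e}) e} with hUdef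
  have hU : MeasurableSet U := measurableSet_spans_without e
  set N := {ω : Set (Sym2 V) | Spans ⊥ id ω e}ᶜ with hNdef
  have hN : MeasurableSet N := (measurableSet_spans e).compl
  have hdom : μ.real U ≤ (resampleFSF G μ).real U := by
    have := hle.real_iUnion_le {A : Finset (Sym2 V) | e ∉ A ∧ Spans ⊥ id (A : Set (Sym2 V)) e}
    rwa [iUnion_containing_eq] at this
  -- An absent edge either has its endpoints in different components (`N`) or has them connected
  -- without it (`U`).
  have hcover : μ.real (containing {e})ᶜ ≤ μ.real N + μ.real U := by
    refine (measureReal_mono fun ω hω => ?_).trans (measureReal_union_le N U)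
    rw [Set.mem_compl_iff, mem_containing_singleton] at hω
    by_cases hs : Spans ⊥ id ω e
    · right
      change Spans ⊥ id (ω \ {e}) e
      rwa [Set.sdiff_singleton_eq_self hω]
    · exact Or.inl hs
  -- If `ω` does not connect the endpoints of `e`, the resampled forest lies in a graph that does
  -- not connect them either: it omits `e`, and `U` fails. Otherwise the bound holds because the
  -- presence of `e` and a connection avoiding `e` exclude each other in a forest.
  have hkernel : ∀ ω, N.indicator (1 : Set (Sym2 V) → ℝ) ω
      + (componentwiseFSF (inducedComponentGraph G ω)).real U
      ≤ (componentwiseFSF (inducedComponentGraph G ω)).real (containing {e})ᶜ := by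
    intro ω
    have hlim := isFreeLimit_componentwiseFSF (inducedComponentGraph G ω)
    by_cases hω : ω ∈ N
    · have hsubset := hlim.ae_subset
      have h1 : (componentwiseFSF (inducedComponentGraph G ω)).real (containing {e}) = 0 := by
        rw [measureReal_eq_zero_iff, measure_eq_zero_iff_ae_notMem]
        filter_upwards [hsubset] with x hx hxe
        exact hω (mem_edgeSet_inducedComponentGraph.1 (hx (mem_containing_singleton.1 hxe))).2
      have h2 : (componentwiseFSF (inducedComponentGraph G ω)).real U = 0 := by
        rw [measureReal_eq_zero_iff, measure_eq_zero_iff_ae_notMem]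
        filter_upwards [hsubset] with x hx hxU
        have hxU' : Spans ⊥ id (x \ {e}) e := hxU
        exact hω (hxU'.trans fun i hi => (mem_edgeSet_inducedComponentGraph.1 (hx hi.1)).2)
      rw [probReal_compl_eq_one_sub (measurableSet_containing _), h1, h2,
        Set.indicator_of_mem hω]
      simp
    · rw [Set.indicator_of_notMem hω, zero_add]
      refine ENNReal.toReal_mono (measure_ne_top _ _) (measure_mono_ae ?_)
      filter_upwards [ae_forest (convergesTo_of_isFreeLimit hlim)] with x hx hxU hxe
      exact hx e (mem_containing_singleton.1 hxe) hxU
  have hκ := measurable_componentwiseFSF (G := G)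
  have hNint : Integrable (N.indicator (1 : Set (Sym2 V) → ℝ)) μ :=
    (integrable_const (1 : ℝ)).indicator hN
  have hint : μ.real N + (resampleFSF G μ).real U ≤ (resampleFSF G μ).real (containing {e})ᶜ := by
    rw [resampleFSF, measureReal_bind hκ hU, measureReal_bind hκ (measurableSet_containing _).compl,
      ← integral_indicator_one hN, ← integral_add hNint (integrable_measureReal hκ hU)]
    exact integral_mono (hNint.add (integrable_measureReal hκ hU))
      (integrable_measureReal hκ (measurableSet_containing _).compl) hkernel
  rw [probReal_compl_eq_one_sub (measurableSet_containing _)] at hint hcover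
  linarith

end Conclusion

end SpanningForest

end

theorem corollary1p6 {V : Type*} [Infinite V] (G : SimpleGraph V) (hconn : G.Connected)
    (hfin : ∀ v, (G.neighborSet v).Finite) :
    ((∀ᵐ ω ∂(SpanningForest.WSF G), SpanningForest.ComponentsOneEnded ω) →
      SpanningForest.resampleWSF G (SpanningForest.WSF G) = SpanningForest.WSF G) ∧
    ((∀ᵐ ω ∂(SpanningForest.FSF G), SpanningForest.ComponentsOneEnded ω) →
      SpanningForest.resampleWSF G (SpanningForest.FSF G) = SpanningForest.FSF G ∧
      SpanningForest.resampleFSF G (SpanningForest.WSF G) = SpanningForest.FSF G ∧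
      SpanningForest.resampleFSF G (SpanningForest.FSF G) = SpanningForest.FSF G) := by
  have := SpanningForest.Connected.countable hconn hfin
  have hw := SpanningForest.isWiredLimit_WSF hconn hfin
  have hf := SpanningForest.isFreeLimit_FSF hconn
  refine ⟨hw.resampleWSF_eq hfin, fun hone => ?_⟩
  have heq := hw.eq_of_isFreeLimit hconn hfin hf hone
  -- The free and wired measures coincide, so all three identities become statements about `WSF`
  -- alone, and the last two become the same.
  rw [← heq] at hone ⊢
  have h1 := hw.resampleWSF_eq hfin hone
  have h2 := SpanningForest.resampleFSF_eq_of_resampleWSF_eq hfin h1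
  exact ⟨h1, h2, h2⟩
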